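/- **Setting.** Fix an integer $d\ge 2$, let $e_1$ be the first vector of the canonical basis of $\mathbb{R}^d$, and write $Z_s=(x_1,v_1,\dots,x_s,v_s)$ for a configuration of $s$ particles (positions $x_i$, velocities $v_i$ in $\mathbb{R}^d$). For $\varepsilon>0$ let $$\mathcal D^\varepsilon_s=\{Z_s : x_i\cdot e_1\ge \varepsilon/2 \ \forall i,\ |x_i-x_j|\ge\varepsilon\ \forall i\ne j\},\qquad \mathcal D^0_s=\{Z_s: x_i\cdot e_1\ge 0\ \forall i\}.$$ Let $T^{s,\varepsilon}_t$ be the hard sphere flow on $\mathcal D^\varepsilon_s$ (defined almost everywhere: straight motion, elastic collisions $v_i'=v_i-\varepsilon^{-2}((v_i-v_j)\cdot(x_i-x_j))(x_i-x_j)$ when $|x_i-x_j|=\varepsilon$, specular reflection $v_i'=v_i-2(v_i\cdot e_1)e_1$ when $x_i\cdot e_1=\varepsilon/2$), $T^{s,0}_t$ the free flow on $\mathcal D^0_s$ with specular reflection at $x\cdot e_1=0$, and $\mathcal T^{s,\cdot}_t f=f\circ T^{s,\cdot}_{-t}$. Define $$\mathcal C^{N,\varepsilon}_{s,s+1}f(Z_s)=\sum_{i=1}^s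 (N-s)\varepsilon^{d-1}\int_{\mathbb S^{d-1}\times\mathbb R^d}\omega\cdot(v_{s+1}-v_i)\,f(Z_s,x_i+\varepsilon\omega,v_{s+1})\,d\omega\,dv_{s+1},$$ $$\mathcal C^{0}_{s,s+1}f(Z_s)=\sum_{i=1}^s\int_{\mathbb S^{d-1}\times\mathbb R^d}[\omega\cdot(v_{s+1}-v_i)]_+\big(f(\dots,x_i,v_i',\dots,x_i,v_{s+1}')-f(Z_s,x_i,v_{s+1})\big)\,d\omega\,dv_{s+1},$$ where, in the first formula, $f$ is extended by $0$ outside $\mathcal D^\varepsilon_{s+1}$ and, in the second, $v_i'=v_i-((v_i-v_{s+1})\cdot\omega)\omega$, $v_{s+1}'=v_{s+1}+((v_i-v_{s+1})\cdot\omega)\omega$. **Spaces.** For $h\in L^\infty(\mathcal D^\varepsilon_s)$ let $|h|_{\varepsilon,s,\beta}=\operatorname{ess\,sup}|h(Z_s)|\exp(\frac\beta2\sum_i|v_i|^2)$. Let $\mathbf X_{N,\varepsilon,\beta,\mu}$ be the set of sequences $(h^{(s)})_{1\le s\le N}$, $h^{(s)}\in L^\infty(\mathcal D^\varepsilon_s)$,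 with $\max_{s}|h^{(s)}|_{\varepsilon,s,\beta}e^{s\mu}<\infty$. Let $\mathbf X_{0,\beta,\mu}$ be the set of sequences $(f^{(s)})_{s\ge1}$ of continuous functions on $\mathcal D^0_s$ vanishing at infinity, invariant under the reflection $v_i\mapsto v_i-2(v_i\cdot e_1)e_1$ of the velocity of a particle at the wall ($x_i\cdot e_1=0$), with $\sup_{s}|f^{(s)}|_{0,s,\beta}e^{s\mu}<\infty$, where $|f|_{0,s,\beta}=\sup_{\mathcal D^0_s}|f(Z_s)|\exp(\frac\beta2\sum_i|v_i|^2)$. For functions $\tilde\beta>0$ and $\tilde\mu$ on $[0,T]$, $\widetilde{\mathbf X}_{N,\varepsilon,\tilde\beta,\tilde\mu}$ is the set of $H$ on $[0,T]$ with $H(t)\in\mathbf X_{N,\varepsilon,\tilde\beta(t),\tilde\mu(t)}$ for all $t$, with these norms bounded uniformly in $t\in[0,T]$, and with $\lim_{u\to t^-}|h^{(s)}(t)-h^{(s)}(u)|_{\varepsilon,s,\tilde\beta(t)}=0$ for all $t\in(0,T]$ and all $s$; $\widetilde{\mathbf X}_{0,\tilde\beta,\tilde\mu}$ is defined in the same way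 from $\mathbf X_{0,\beta,\mu}$ and $|\cdot|_{0,s,\beta}$. **Operators.** For $1\le s\le N-1$, $$\mathfrak E^{(s)}_{N,\varepsilon}(F_{N,0},H)(t)=f^{(s)}_{N,0}+\int_0^t\mathcal T^{s,\varepsilon}_{-u}\,\mathcal C^{N,\varepsilon}_{s,s+1}\,\mathcal T^{s+1,\varepsilon}_u\,h^{(s+1)}(u)\,du,\qquad \mathfrak E^{(N)}_{N,\varepsilon}(F_{N,0},H)(t)=f^{(N)}_{N,0},$$ the integral being evaluated with representatives of $h^{(s+1)}(u)$ that are, off a fixed null set of $\mathcal D^\varepsilon_{s+1}$, left-continuous in $u\in(0,T]$ (for instance the values $\lim_{r\to0}$ of the averages of $h^{(s+1)}(u)$ over balls of radius $r$). For $s\ge1$, $$\mathfrak E^{(s)}_{0}(F_0,F)(t)=\mathcal T^{s,0}_tf^{(s)}_0+\int_0^t\mathcal T^{s,0}_{t-u}\,\mathcal C^{0}_{s,s+1}f^{(s+1)}(u)\,du .$$ **Theorem (joint local existence and uniqueness for the BBGKY and Boltzmann hierarchies).** Let $\beta_0>0$ and $\mu_0\in\mathbb R$. There exist $\lambda>0$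 and $T>0$ (depending, for the fixed dimension $d$, only on $\beta_0$ and $\mu_0$) such that, with $\tilde\beta(t)=\beta_0-\lambda t$ and $\tilde\mu(t)=\mu_0-\lambda t$, one has $\tilde\beta>0$ on $[0,T]$ and the following holds. For every positive integer $N$ and every $\varepsilon>0$ with $N\varepsilon^{d-1}=1$, every $F_{N,0}\in\mathbf X_{N,\varepsilon,\beta_0,\mu_0}$ and every $F_0\in\mathbf X_{0,\beta_0,\mu_0}$, there is exactly one $H_N\in\widetilde{\mathbf X}_{N,\varepsilon,\tilde\beta,\tilde\mu}$ with $$H_N(t)=\mathfrak E_{N,\varepsilon}(F_{N,0},H_N)(t)\quad\text{in } L^\infty,\ \text{for all } t\in[0,T],$$ and exactly one $F\in\widetilde{\mathbf X}_{0,\tilde\beta,\tilde\mu}$ with $$F(t)=\mathfrak E_0(F_0,F)(t)\quad\text{for all } t\in[0,T].$$ For these solutions all the integrals in $\mathfrak E_{N,\varepsilon}$ (for almost every configuration) and in $\mathfrak E_0$ (for every configuration) converge absolutely. -/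

import Mathlib

open MeasureTheory Set Filter Topology
open scoped ENNReal ZeroAtInfty

noncomputable section

namespace Hierarchy

/-! ### Configurations, walls and hard spheres -/

/-- The space `ℝ^d` with its Euclidean norm. -/
abbrev E (d : ℕ) : Type := EuclideanSpace ℝ (Fin d)

/-- Configurations of `s` particles: particle `i` has position `(Z i).1` and velocity `(Z i).2`. -/
abbrev Conf (d s : ℕ) : Type := Fin s → E d × E d

/-- The first vector of the canonical basis, normal to the wall. -/
def e₁ (d : ℕ) [NeZero d] : E d := EuclideanSpace.single 0 1

/-- The specular reflection `y ↦ y - 2 (y · e₁) e₁`. -/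
def reflect {d : ℕ} [NeZero d] (y : E d) : E d := y - (2 * inner ℝ y (e₁ d)) • e₁ d

/-- The phase space of `s` hard spheres of diameter `ε` in the half-space `x · e₁ > 0`. -/
def phaseSpace (d : ℕ) [NeZero d] (ε : ℝ) (s : ℕ) : Set (Conf d s) :=
  {Z | (∀ i, ε / 2 ≤ inner ℝ (Z i).1 (e₁ d)) ∧ ∀ i j, i ≠ j → ε ≤ ‖(Z i).1 - (Z j).1‖}

/-- Lebesgue measure on the phase space of `s` hard spheres. -/
def phaseMeasure (d : ℕ) [NeZero d] (ε : ℝ) (s : ℕ) : Measure (Conf d s) :=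
  volume.restrict (phaseSpace d ε s)

/-- No particle is involved in two contacts at once (with two other particles, or with another
particle and the wall). -/
def NonPathological {d s : ℕ} [NeZero d] (ε : ℝ) (Z : Conf d s) : Prop :=
  ∀ i j, i ≠ j → ‖(Z i).1 - (Z j).1‖ = ε →
    inner ℝ (Z i).1 (e₁ d) ≠ ε / 2 ∧ ∀ k, i ≠ k → ‖(Z i).1 - (Z k).1‖ = ε → k = j

open Classical in
/-- The velocity jump at contacts: elastic collision for particles at distance `ε`, specular
reflection for particles touching the wall. For nonpathological configurations at most one of the
correction terms is present for each particle. -/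
def scatter {d s : ℕ} [NeZero d] (ε : ℝ) (Z : Conf d s) : Conf d s := fun i =>
  ((Z i).1,
    (Z i).2
      - (∑ j ∈ Finset.univ.filter (fun j => i ≠ j ∧ ‖(Z i).1 - (Z j).1‖ = ε),
          ((1 / ε ^ 2) * inner ℝ ((Z i).2 - (Z j).2) ((Z i).1 - (Z j).1)) • ((Z i).1 - (Z j).1))
      - (if inner ℝ (Z i).1 (e₁ d) = ε / 2 then (2 * inner ℝ (Z i).2 (e₁ d)) • e₁ d else 0))

/-- Straight motion during a time `τ`, with constant velocities. -/
def drift {d s : ℕ} (τ : ℝ) (Z : Conf d s) : Conf d s := fun i =>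
  ((Z i).1 + τ • (Z i).2, (Z i).2)

/-- `γ` is a global hard sphere trajectory without pathological event, velocities being taken
right-continuous in time: just after each time the motion is straight with the current velocities;
just before each time it is straight with velocities which the jump law sends to the current
ones. (Away from contacts the jump law is the identity.) -/
def IsTrajectory {d s : ℕ} [NeZero d] (ε : ℝ) (γ : ℝ → Conf d s) : Prop :=
  (∀ t, γ t ∈ phaseSpace d ε s ∧ NonPathological ε (γ t)) ∧
  (∀ t, ∀ᶠ r in 𝓝[>] t, γ r = drift (r - t) (γ t)) ∧
  (∀ t, ∃ Z : Conf d s, γ t = scatter ε Z ∧ ∀ᶠ r in 𝓝[<] t, γ r = drift (r - t) Z)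

/-- `γ` is a trajectory whose state just after or just before time `0` is `Z`
(the two differ only if `Z` has a contact). -/
def IsTrajectoryFrom {d s : ℕ} [NeZero d] (ε : ℝ) (Z : Conf d s) (γ : ℝ → Conf d s) : Prop :=
  IsTrajectory ε γ ∧ (γ 0 = Z ∨ ∀ᶠ r in 𝓝[<] (0 : ℝ), γ r = drift r Z)

open Classical in
/-- The hard sphere transport: the configuration at time `t` on the trajectory from `Z`. The value
for the (negligible) set of `Z` without a global trajectory is arbitrary. -/
def hsFlow {d s : ℕ} [NeZero d] (ε t : ℝ) (Z : Conf d s) : Conf d s :=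
  if h : ∃ γ, IsTrajectoryFrom ε Z γ then h.choose t else Z

open Classical in
/-- The backwards hard sphere flow acting on functions, `f ↦ f ∘ T_{-t}`, with value `0` on the
negligible set where the hard sphere flow is not defined. -/
def hsTransport {d s : ℕ} [NeZero d] (ε t : ℝ) (f : Conf d s → ℝ) : Conf d s → ℝ := fun Z =>
  if ∃ γ, IsTrajectoryFrom ε Z γ then f (hsFlow ε (-t) Z) else 0

/-! ### Spaces for the BBGKY hierarchy -/

/-- `L^∞` of the phase space of `s` hard spheres (classes modulo almost everywhere equality). -/
abbrev Linf (d : ℕ) [NeZero d] (ε : ℝ) (s : ℕ) : Type := Lp ℝ ∞ (phaseMeasure d ε s)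

/-- The weight `exp (β/2 ∑ |v_i|²)`. -/
def gaussWeight {d s : ℕ} (β : ℝ) (Z : Conf d s) : ℝ :=
  Real.exp (β / 2 * ∑ i, ‖(Z i).2‖ ^ 2)

/-- The norm `|h|_{ε,s,β}`: the essential supremum of `|h(Z)| exp (β/2 ∑ |v_i|²)`. -/
def normEps {d : ℕ} [NeZero d] {ε : ℝ} {s : ℕ} (β : ℝ) (h : Linf d ε s) : ℝ≥0∞ :=
  eLpNorm (fun Z => h Z * gaussWeight β Z) ∞ (phaseMeasure d ε s)

/-- Finite sequences `(h^{(s)})_{1 ≤ s ≤ N}`, where `k : Fin N` stands for `s = k + 1`. -/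
abbrev BBGKYSeq (d : ℕ) [NeZero d] (ε : ℝ) (N : ℕ) : Type := (k : Fin N) → Linf d ε (k + 1)

/-- The norm `‖H‖_{N,ε,β,μ} = max_s |h^{(s)}|_{ε,s,β} exp (s μ)`. -/
def normBBGKY {d : ℕ} [NeZero d] {ε : ℝ} {N : ℕ} (β μ : ℝ) (H : BBGKYSeq d ε N) : ℝ≥0∞ :=
  ⨆ k : Fin N, normEps β (H k) * ENNReal.ofReal (Real.exp (((k : ℕ) + 1 : ℝ) * μ))

/-- The space `X_{N,ε,β,μ}`. -/
def XBBGKY (d : ℕ) [NeZero d] (ε : ℝ) (N : ℕ) (β μ : ℝ) : Set (BBGKYSeq d ε N) :=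
  {H | (∀ k, normEps β (H k) < ∞) ∧ normBBGKY β μ H < ∞}

/-- Membership in the space of time-dependent sequences on `[0,T]` with weights `β(t)`, `μ(t)`. -/
structure InXTildeBBGKY {d : ℕ} [NeZero d] {ε : ℝ} {N : ℕ} (T : ℝ) (β μ : ℝ → ℝ)
    (H : ℝ → BBGKYSeq d ε N) : Prop where
  mem : ∀ t ∈ Icc 0 T, H t ∈ XBBGKY d ε N (β t) (μ t)
  bounded : (⨆ t ∈ Icc 0 T, normBBGKY (β t) (μ t) (H t)) < ∞
  left_cont : ∀ t ∈ Ioc 0 T, ∀ k,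
    Tendsto (fun u => normEps (β t) (H t k - H u k)) (𝓝[<] t) (𝓝 0)

/-! ### The BBGKY operator -/

/-- The Lebesgue value of an `L^∞` class, `lim_{r → 0} ⨍_{B(Z,r)} h`: a representative which
depends only on the class and for which
`|lebesgueValue h Z - lebesgueValue h' Z| ≤ ‖h - h'‖_∞` wherever both limits exist.
Hence, for `h` left-continuous in time with values in `L^∞`, the function `lebesgueValue (h u) Z`
is, for all `Z` outside one negligible set, left-continuous in `u`; this determines the traces
used in the transport-collision operator. -/
def lebesgueValue {d : ℕ} [NeZero d] {ε : ℝ} {s : ℕ} (h : Linf d ε s) : Conf d s → ℝ := fun Z =>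
  limUnder (𝓝[>] (0 : ℝ)) fun r => ⨍ W in Metric.closedBall Z r, h W ∂(phaseMeasure d ε s)

/-- The product of the surface measure on the unit sphere and of Lebesgue measure on `ℝ^d`. -/
def adjunctionMeasure (d : ℕ) : Measure (Metric.sphere (0 : E d) 1 × E d) :=
  ((volume : Measure (E d)).toSphere).prod volume

/-- The configuration `(Z, x, v)` with an added particle. -/
def adjoin {d s : ℕ} (Z : Conf d s) (x v : E d) : Conf d (s + 1) :=
  Fin.snoc (α := fun _ => E d × E d) Z (x, v)

/-- Integrand of the `i`-th term of the collision operator,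
`ω · (v - v_i) f(Z, x_i + ε ω, v)`, where `f` is a function on the phase space of `s + 1` hard
spheres (extended by `0`). -/
def collisionIntegrand {d s : ℕ} [NeZero d] (ε : ℝ) (f : Conf d (s + 1) → ℝ) (Z : Conf d s)
    (i : Fin s) (p : Metric.sphere (0 : E d) 1 × E d) : ℝ :=
  inner ℝ (p.1 : E d) (p.2 - (Z i).2) *
    (phaseSpace d ε (s + 1)).indicator f (adjoin Z ((Z i).1 + ε • (p.1 : E d)) p.2)

/-- The collision operator `C^{N,ε}_{s,s+1}`. -/
def collision {d s : ℕ} [NeZero d] (N : ℕ) (ε : ℝ) (f : Conf d (s + 1) → ℝ) : Conf d s → ℝ :=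
  fun Z => ∑ i, ((N : ℝ) - s) * ε ^ (d - 1) *
    ∫ p, collisionIntegrand ε f Z i p ∂(adjunctionMeasure d)

/-- The function `T_{-u} C^{N,ε}_{s,s+1} T_u h`, where `h ∈ L^∞` of the `s + 1` particle space. -/
def conjugatedCollision {d s : ℕ} [NeZero d] (N : ℕ) {ε : ℝ} (u : ℝ) (h : Linf d ε (s + 1)) :
    Conf d s → ℝ :=
  hsTransport ε (-u) (collision N ε (hsTransport ε u (lebesgueValue h)))

/-- The BBGKY operator:
`f₀^{(s)} + ∫_0^t T_{-u} C^{N,ε}_{s,s+1} T_u h^{(s+1)}(u) du` for `s < N`, and `f₀^{(N)}` for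
`s = N` (with `s = k + 1`). -/
def bbgkyOperator {d : ℕ} [NeZero d] {ε : ℝ} {N : ℕ} (F₀ : BBGKYSeq d ε N)
    (H : ℝ → BBGKYSeq d ε N) (t : ℝ) (k : Fin N) : Conf d (k + 1) → ℝ := fun Z =>
  F₀ k Z +
    if hk : (k : ℕ) + 1 < N then
      ∫ u in (0 : ℝ)..t, conjugatedCollision N u (H u ⟨k + 1, hk⟩) Z
    else 0

/-- All the integrals in the BBGKY operator converge absolutely, for almost every configuration. -/
def BBGKYConverges {d : ℕ} [NeZero d] {ε : ℝ} {N : ℕ} (T : ℝ) (H : ℝ → BBGKYSeq d ε N) : Prop :=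
  ∀ t ∈ Icc 0 T, ∀ (k : Fin N) (hk : (k : ℕ) + 1 < N),
    ∀ᵐ Z ∂(phaseMeasure d ε (k + 1)),
      IntervalIntegrable (fun u => conjugatedCollision N u (H u ⟨k + 1, hk⟩) Z) volume 0 t ∧
      ∀ᵐ u ∂(volume.restrict (Ioc 0 t)), ∀ i,
        Integrable (collisionIntegrand ε
          (hsTransport ε u (lebesgueValue (H u ⟨k + 1, hk⟩))) (hsFlow ε u Z) i)
          (adjunctionMeasure d)

/-- `H` belongs to the space of weights `β`, `μ` on `[0,T]` and `H(t) = 𝔈_{N,ε}(F₀, H)(t)` for all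
`t ∈ [0,T]`, the equality being that of `L^∞`, i.e. almost everywhere. -/
structure IsBBGKYSolution {d : ℕ} [NeZero d] {ε : ℝ} {N : ℕ} (T : ℝ) (β μ : ℝ → ℝ)
    (F₀ : BBGKYSeq d ε N) (H : ℝ → BBGKYSeq d ε N) : Prop where
  mem : InXTildeBBGKY T β μ H
  fixed : ∀ t ∈ Icc 0 T, ∀ k : Fin N, H t k =ᵐ[phaseMeasure d ε (k + 1)] bbgkyOperator F₀ H t k

/-! ### Spaces for the Boltzmann hierarchy -/

/-- The phase space `({x · e₁ ≥ 0} × ℝ^d)^s` of `s` point particles. -/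
def halfPhase (d : ℕ) [NeZero d] (s : ℕ) : Set (Conf d s) :=
  {Z | ∀ i, 0 ≤ inner ℝ (Z i).1 (e₁ d)}

/-- Extension by `0` of a function on the phase space of point particles. -/
def ext₀ {d : ℕ} [NeZero d] {s : ℕ} (f : C₀(halfPhase d s, ℝ)) : Conf d s → ℝ :=
  Function.extend Subtype.val f 0

/-- The boundary condition: reflecting the velocity of a particle that lies on the wall does not
change `f`. -/
def BoundaryCondition {d : ℕ} [NeZero d] {s : ℕ} (f : C₀(halfPhase d s, ℝ)) : Prop :=
  ∀ Z ∈ halfPhase d s, ∀ i, inner ℝ (Z i).1 (e₁ d) = 0 →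
    ext₀ f Z = ext₀ f (Function.update Z i ((Z i).1, reflect (Z i).2))

/-- The norm `|f|_{0,s,β}`. -/
def normZero {d : ℕ} [NeZero d] {s : ℕ} (β : ℝ) (f : C₀(halfPhase d s, ℝ)) : ℝ≥0∞ :=
  ⨆ Z : halfPhase d s, ENNReal.ofReal (|f Z| * gaussWeight β (Z : Conf d s))

/-- Infinite sequences `(f^{(s)})_{s ≥ 1}`, where `k : ℕ` stands for `s = k + 1`. -/
abbrev BoltzmannSeq (d : ℕ) [NeZero d] : Type := (k : ℕ) → C₀(halfPhase d (k + 1), ℝ)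

/-- The norm `‖F‖_{0,β,μ} = sup_s |f^{(s)}|_{0,s,β} exp (s μ)`. -/
def normBoltzmann {d : ℕ} [NeZero d] (β μ : ℝ) (F : BoltzmannSeq d) : ℝ≥0∞ :=
  ⨆ k : ℕ, normZero β (F k) * ENNReal.ofReal (Real.exp ((k + 1 : ℝ) * μ))

/-- The space `X_{0,β,μ}`. -/
def XBoltzmann (d : ℕ) [NeZero d] (β μ : ℝ) : Set (BoltzmannSeq d) :=
  {F | (∀ k, BoundaryCondition (F k) ∧ normZero β (F k) < ∞) ∧ normBoltzmann β μ F < ∞}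

/-- Membership in the space of time-dependent sequences on `[0,T]` with weights `β(t)`, `μ(t)`. -/
structure InXTildeBoltzmann {d : ℕ} [NeZero d] (T : ℝ) (β μ : ℝ → ℝ)
    (F : ℝ → BoltzmannSeq d) : Prop where
  mem : ∀ t ∈ Icc 0 T, F t ∈ XBoltzmann d (β t) (μ t)
  bounded : (⨆ t ∈ Icc 0 T, normBoltzmann (β t) (μ t) (F t)) < ∞
  left_cont : ∀ t ∈ Ioc 0 T, ∀ k,
    Tendsto (fun u => normZero (β t) (F t k - F u k)) (𝓝[<] t) (𝓝 0)

/-! ### The Boltzmann operator -/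

open Classical in
/-- The free flow in the half-space with specular reflection: a particle which would have crossed
the wall has its position and velocity reflected. -/
def freeFlow {d s : ℕ} [NeZero d] (t : ℝ) (Z : Conf d s) : Conf d s := fun i =>
  if 0 ≤ inner ℝ ((Z i).1 + t • (Z i).2) (e₁ d) then ((Z i).1 + t • (Z i).2, (Z i).2)
  else (reflect ((Z i).1 + t • (Z i).2), reflect (Z i).2)

/-- The backwards free flow acting on functions, `f ↦ f ∘ T_{-t}`. -/
def freeTransport {d s : ℕ} [NeZero d] (t : ℝ) (f : Conf d s → ℝ) : Conf d s → ℝ := fun Z =>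
  f (freeFlow (-t) Z)

/-- Integrand of the `i`-th term of the Boltzmann collision operator,
`[ω · (v - v_i)]_+ (f(…, x_i, v_i', …, x_i, v') - f(Z, x_i, v))`. -/
def collisionIntegrand₀ {d s : ℕ} (f : Conf d (s + 1) → ℝ) (Z : Conf d s)
    (i : Fin s) (p : Metric.sphere (0 : E d) 1 × E d) : ℝ :=
  max (inner ℝ (p.1 : E d) (p.2 - (Z i).2)) 0 *
    (f (adjoin
          (Function.update Z i
            ((Z i).1, (Z i).2 - inner ℝ ((Z i).2 - p.2) (p.1 : E d) • (p.1 : E d)))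
          (Z i).1 (p.2 + inner ℝ ((Z i).2 - p.2) (p.1 : E d) • (p.1 : E d)))
      - f (adjoin Z (Z i).1 p.2))

/-- The Boltzmann collision operator `C^0_{s,s+1}`. -/
def collision₀ {d s : ℕ} (f : Conf d (s + 1) → ℝ) : Conf d s → ℝ := fun Z =>
  ∑ i, ∫ p, collisionIntegrand₀ f Z i p ∂(adjunctionMeasure d)

/-- The Boltzmann operator
`T_t f₀^{(s)} + ∫_0^t T_{t-u} C^0_{s,s+1} f^{(s+1)}(u) du` (with `s = k + 1`). -/
def boltzmannOperator {d : ℕ} [NeZero d] (F₀ : BoltzmannSeq d) (F : ℝ → BoltzmannSeq d)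
    (t : ℝ) (k : ℕ) : Conf d (k + 1) → ℝ := fun Z =>
  freeTransport t (ext₀ (F₀ k)) Z +
    ∫ u in (0 : ℝ)..t, freeTransport (t - u) (collision₀ (ext₀ (F u (k + 1)))) Z

/-- All the integrals in the Boltzmann operator converge absolutely. -/
def BoltzmannConverges {d : ℕ} [NeZero d] (T : ℝ) (F : ℝ → BoltzmannSeq d) : Prop :=
  ∀ t ∈ Icc 0 T, ∀ (k : ℕ), ∀ Z ∈ halfPhase d (k + 1),
    IntervalIntegrable
      (fun u => freeTransport (t - u) (collision₀ (ext₀ (F u (k + 1)))) Z) volume 0 t ∧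
    ∀ i, Integrable (collisionIntegrand₀ (ext₀ (F t (k + 1))) Z i) (adjunctionMeasure d)

/-- `F` belongs to the space of weights `β`, `μ` on `[0,T]` and `F(t) = 𝔈_0(F₀, F)(t)` for all
`t ∈ [0,T]`. -/
structure IsBoltzmannSolution {d : ℕ} [NeZero d] (T : ℝ) (β μ : ℝ → ℝ)
    (F₀ : BoltzmannSeq d) (F : ℝ → BoltzmannSeq d) : Prop where
  mem : InXTildeBoltzmann T β μ F
  fixed : ∀ t ∈ Icc 0 T, ∀ k, ∀ Z : halfPhase d (k + 1), F t k Z = boltzmannOperator F₀ F t k Z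

end Hierarchy

end

open Hierarchy

/-! Write E for the sum of the |v_i|². In both hierarchies a collision couples level s to level s +
1 and costs a factor growing with s and with the velocities. The weights `β₀ - lam * t` and `μ₀ -
lam * t`, which shrink in time, pay for it: a source acting at time u, measured with the weights of
a later time t, gains exp(-lam (s + E/2)(t - u)), and integrating this in u recovers the loss.

The BBGKY hierarchy is finite and triangular. Level N is constant in time and level s is an explicit
time integral of level s + 1, so existence and uniqueness follow by downward induction without any
contraction. One step (`exists_weightedPath_integral`) rests on conservation of energy by the flow
and on `integral_sqrt_exp_le`, which yields both the weighted bound and left-continuity. The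
difficulty is that the collision operator evaluates an L^∞ class on the hypersurface of contact
configurations, which is a null set. Time supplies the missing dimension: by
`ae_adjoin_hsFlow_notMem`, the backward flow from a non-grazing contact avoids a given null set for
almost every time, configuration, impact direction and added velocity. Along the last free flight
before the contact these data are differentiable functions of the configuration at the start of the
flight, and differentiable maps between spaces of equal dimension send null sets to null sets. The
same principle shows that the flow pulls null sets back to null sets (`volume_trajectory_null`).
Joint measurability of the flow holds because its graph is σ-compact (`isSigmaCompact_reach`), and a
null set common to all times comes from left-continuity and rational times
(`exists_measurable_lebesgueValue`).

The Boltzmann hierarchy is infinite and needs a contraction. Even extension across the wall turns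
the reflected free flow into straight motion in the whole space, and the collision operator commutes
with the reflections. That operator costs a constant times s + E/2, while time integration returns 1
/ (lam (s + E/2)); for large `lam` the Duhamel map halves distances in the hierarchy norm
(`abs_integral_collision₀_le`), and Picard iteration converges. Left-continuity in the weighted norm
requires that free transport be continuous on the solution; this holds because at a positive time
the solution decays better in velocity than its weight demands (`duhamel_tail`). -/

noncomputable section

set_option linter.unusedSectionVars false

namespace Hierarchy

/-! ### The jump law -/

section Scatter

variable {d s : ℕ} [NeZero d] {ε : ℝ}

/-- Configurations of the phase space that may occur on a trajectory. -/
def Admissible (ε : ℝ) (Z : Conf d s) : Prop := Z ∈ phaseSpace d ε s ∧ NonPathological ε Z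

/-- Twice the kinetic energy. -/
def energy (Z : Conf d s) : ℝ := ∑ i, ‖(Z i).2‖ ^ 2

/-- Reversal of all velocities. -/
def rev (Z : Conf d s) : Conf d s := fun i => ((Z i).1, -(Z i).2)

@[simp] lemma rev_rev (Z : Conf d s) : rev (rev Z) = Z := by
  funext i; simp [rev]

@[simp] lemma scatter_fst (Z : Conf d s) (i : Fin s) : (scatter ε Z i).1 = (Z i).1 := rfl

@[simp] lemma drift_fst (τ : ℝ) (Z : Conf d s) (i : Fin s) :
    (drift τ Z i).1 = (Z i).1 + τ • (Z i).2 := rfl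

@[simp] lemma drift_snd (τ : ℝ) (Z : Conf d s) (i : Fin s) : (drift τ Z i).2 = (Z i).2 := rfl

@[simp] lemma drift_zero (Z : Conf d s) : drift 0 Z = Z := by
  funext i; simp [drift]

lemma drift_drift (a b : ℝ) (Z : Conf d s) : drift a (drift b Z) = drift (a + b) Z := by
  funext i; ext1
  · simp only [drift_fst, drift_snd]; module
  · rfl

lemma drift_rev (a : ℝ) (Z : Conf d s) : drift a (rev Z) = rev (drift (-a) Z) := by
  funext i; simp [drift, rev]

lemma inner_e₁_self : inner ℝ (e₁ d) (e₁ d) = (1 : ℝ) := by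
  simp [e₁]

lemma nonPathological_congr {Z W : Conf d s} (h : ∀ i, (Z i).1 = (W i).1)
    (hZ : NonPathological ε Z) : NonPathological ε W := by
  intro i j hij hc
  have := hZ i j hij (by rw [h, h]; exact hc)
  simpa only [h] using this

lemma admissible_congr {Z W : Conf d s} (h : ∀ i, (Z i).1 = (W i).1)
    (hZ : Admissible ε Z) : Admissible ε W := by
  refine ⟨?_, nonPathological_congr h hZ.2⟩
  have := hZ.1
  simpa only [phaseSpace, mem_ofPred_eq, h] using this

lemma scatter_of_pair {Z : Conf d s} (hZ : NonPathological ε Z) {i j : Fin s} (hij : i ≠ j)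
    (hc : ‖(Z i).1 - (Z j).1‖ = ε) :
    (scatter ε Z i).2 = (Z i).2 -
      ((1 / ε ^ 2) * inner ℝ ((Z i).2 - (Z j).2) ((Z i).1 - (Z j).1)) • ((Z i).1 - (Z j).1) := by
  classical
  have h1 : Finset.univ.filter (fun k => i ≠ k ∧ ‖(Z i).1 - (Z k).1‖ = ε) = {j} := by
    ext k
    simp only [Finset.mem_filter, Finset.mem_univ, true_and, Finset.mem_singleton]
    exact ⟨fun h => (hZ i j hij hc).2 k h.1 h.2, fun h => h ▸ ⟨hij, hc⟩⟩
  have h2 := (hZ i j hij hc).1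
  simp only [scatter]
  rw [if_neg h2]
  simp only [sub_zero]
  congr 1
  convert Finset.sum_singleton _ _ using 2
  convert h1

lemma scatter_of_wall {Z : Conf d s} {i : Fin s}
    (h : ∀ j, i ≠ j → ‖(Z i).1 - (Z j).1‖ ≠ ε) (hw : inner ℝ (Z i).1 (e₁ d) = ε / 2) :
    (scatter ε Z i).2 = reflect (Z i).2 := by
  classical
  simp only [scatter, if_pos hw, reflect]
  rw [Finset.sum_eq_zero]
  · simp
  · intro j hj
    simp only [Finset.mem_filter, Finset.mem_univ, true_and] at hj
    exact absurd hj.2 (h j hj.1)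

lemma scatter_of_free {Z : Conf d s} {i : Fin s}
    (h : ∀ j, i ≠ j → ‖(Z i).1 - (Z j).1‖ ≠ ε) (hw : inner ℝ (Z i).1 (e₁ d) ≠ ε / 2) :
    (scatter ε Z i).2 = (Z i).2 := by
  classical
  simp only [scatter, if_neg hw]
  rw [Finset.sum_eq_zero]
  · simp
  · intro j hj
    simp only [Finset.mem_filter, Finset.mem_univ, true_and] at hj
    exact absurd hj.2 (h j hj.1)

lemma scatter_cases {Z : Conf d s} (hZ : NonPathological ε Z) (i : Fin s) :
    (∃ j, i ≠ j ∧ ‖(Z i).1 - (Z j).1‖ = ε ∧ (scatter ε Z i).2 = (Z i).2 -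
      ((1 / ε ^ 2) * inner ℝ ((Z i).2 - (Z j).2) ((Z i).1 - (Z j).1)) • ((Z i).1 - (Z j).1)) ∨
    ((∀ j, i ≠ j → ‖(Z i).1 - (Z j).1‖ ≠ ε) ∧ inner ℝ (Z i).1 (e₁ d) = ε / 2 ∧
      (scatter ε Z i).2 = reflect (Z i).2) ∨
    ((∀ j, i ≠ j → ‖(Z i).1 - (Z j).1‖ ≠ ε) ∧ inner ℝ (Z i).1 (e₁ d) ≠ ε / 2 ∧
      (scatter ε Z i).2 = (Z i).2) := by
  by_cases h : ∃ j, i ≠ j ∧ ‖(Z i).1 - (Z j).1‖ = ε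
  · obtain ⟨j, h1, h2⟩ := h
    exact Or.inl ⟨j, h1, h2, scatter_of_pair hZ h1 h2⟩
  · push Not at h
    by_cases hw : inner ℝ (Z i).1 (e₁ d) = ε / 2
    · exact Or.inr (Or.inl ⟨h, hw, scatter_of_wall h hw⟩)
    · exact Or.inr (Or.inr ⟨h, hw, scatter_of_free h hw⟩)

lemma reflect_reflect (y : E d) : reflect (reflect y) = y := by
  simp only [reflect, inner_sub_left, inner_smul_left, inner_e₁_self]
  simp only [conj_trivial]
  module

lemma norm_reflect (y : E d) : ‖reflect y‖ = ‖y‖ := by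
  have : ‖reflect y‖ ^ 2 = ‖y‖ ^ 2 := by
    rw [← real_inner_self_eq_norm_sq, ← real_inner_self_eq_norm_sq]
    simp only [reflect, inner_sub_left, inner_sub_right, inner_smul_left, inner_smul_right,
      inner_e₁_self, conj_trivial, real_inner_comm y (e₁ d)]
    ring
  exact (sq_eq_sq₀ (norm_nonneg _) (norm_nonneg _)).1 this

lemma norm_sub_comm_contact {Z : Conf d s} {i j : Fin s} (h : ‖(Z i).1 - (Z j).1‖ = ε) :
    ‖(Z j).1 - (Z i).1‖ = ε := by rw [norm_sub_rev]; exact h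

/-- Contacts depend on positions only, so the second jump involves the same partner. The first jump
has reversed the normal relative velocity, hence the two corrections cancel. -/
lemma scatter_scatter (hε : 0 < ε) {Z : Conf d s} (hZ : NonPathological ε Z) :
    scatter ε (scatter ε Z) = Z := by
  have hS : NonPathological ε (scatter ε Z) := nonPathological_congr (fun _ => rfl) hZ
  funext i
  ext1
  · rfl
  rcases scatter_cases hZ i with ⟨j, hij, hc, h⟩ | ⟨hn, hw, h⟩ | ⟨hn, hw, h⟩
  · have hj := scatter_of_pair hZ hij.symm (norm_sub_comm_contact hc)
    rw [scatter_of_pair hS hij (by simpa using hc), h, hj]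
    simp only [scatter_fst]
    set n := (Z i).1 - (Z j).1 with hn
    have hn' : (Z j).1 - (Z i).1 = -n := by rw [hn]; abel
    have hnn : inner ℝ n n = ε ^ 2 := by rw [real_inner_self_eq_norm_sq, hc]
    rw [hn']
    simp only [inner_sub_left, inner_smul_left, inner_neg_right, inner_neg_left, hnn, conj_trivial,
      smul_neg]
    have : ε ^ 2 ≠ 0 := by positivity
    generalize inner ℝ (Z i).2 n = a
    generalize inner ℝ (Z j).2 n = b
    rw [sub_sub, sub_eq_self, ← add_smul]
    convert zero_smul ℝ n using 2
    field_simp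
    ring
  · rw [scatter_of_wall (by simpa using hn) (by simpa using hw), h, reflect_reflect]
  · rw [scatter_of_free (by simpa using hn) (by simpa using hw), h]

lemma norm_sq_add_of_pair (hε : 0 < ε) {Z : Conf d s} (hZ : NonPathological ε Z) {i j : Fin s}
    (hij : i ≠ j) (hc : ‖(Z i).1 - (Z j).1‖ = ε) :
    ‖(scatter ε Z i).2‖ ^ 2 + ‖(scatter ε Z j).2‖ ^ 2 = ‖(Z i).2‖ ^ 2 + ‖(Z j).2‖ ^ 2 := by
  have hj := scatter_of_pair hZ hij.symm (norm_sub_comm_contact hc)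
  rw [scatter_of_pair hZ hij hc, hj]
  set n := (Z i).1 - (Z j).1 with hn
  have hn' : (Z j).1 - (Z i).1 = -n := by rw [hn]; abel
  have hnn : inner ℝ n n = ε ^ 2 := by rw [real_inner_self_eq_norm_sq, hc]
  rw [hn']
  simp only [← real_inner_self_eq_norm_sq]
  have : ε ^ 2 ≠ 0 := by positivity
  simp only [inner_sub_left, inner_sub_right, inner_smul_left, inner_smul_right, inner_neg_right,
    inner_neg_left, hnn, conj_trivial, real_inner_comm (Z i).2 n, real_inner_comm (Z j).2 n]
  generalize inner ℝ (Z i).2 n = a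
  generalize inner ℝ (Z j).2 n = b
  field_simp
  ring

/-- The map `p` sending a particle to its contact partner, or to itself if it has none, is an
involution. Energy is conserved on each orbit, and summing over all particles counts every
contribution twice. -/
lemma energy_scatter (hε : 0 < ε) {Z : Conf d s} (hZ : NonPathological ε Z) :
    energy (scatter ε Z) = energy Z := by
  classical
  let p : Fin s → Fin s := fun i =>
    if h : ∃ j, i ≠ j ∧ ‖(Z i).1 - (Z j).1‖ = ε then h.choose else i
  have hp1 : ∀ i j, i ≠ j → ‖(Z i).1 - (Z j).1‖ = ε → p i = j := by
    intro i j hij hc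
    have h : ∃ j, i ≠ j ∧ ‖(Z i).1 - (Z j).1‖ = ε := ⟨j, hij, hc⟩
    simp only [p, dif_pos h]
    exact (hZ i j hij hc).2 _ h.choose_spec.1 h.choose_spec.2
  have hp2 : ∀ i, (¬∃ j, i ≠ j ∧ ‖(Z i).1 - (Z j).1‖ = ε) → p i = i := by
    intro i h
    simp only [p, dif_neg h]
  have hinv : Function.Involutive p := by
    intro i
    by_cases h : ∃ j, i ≠ j ∧ ‖(Z i).1 - (Z j).1‖ = ε
    · obtain ⟨j, hij, hc⟩ := h
      rw [hp1 i j hij hc, hp1 j i hij.symm (norm_sub_comm_contact hc)]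
    · rw [hp2 i h, hp2 i h]
  have key : ∀ i, ‖(scatter ε Z i).2‖ ^ 2 + ‖(scatter ε Z (p i)).2‖ ^ 2
      = ‖(Z i).2‖ ^ 2 + ‖(Z (p i)).2‖ ^ 2 := by
    intro i
    rcases scatter_cases hZ i with ⟨j, hij, hc, -⟩ | ⟨hn, hw, h⟩ | ⟨hn, hw, h⟩
    · rw [hp1 i j hij hc]
      exact norm_sq_add_of_pair hε hZ hij hc
    · rw [hp2 i (by push Not; exact hn), h, norm_reflect]
    · rw [hp2 i (by push Not; exact hn), h]
  have hsum : ∀ f : Fin s → ℝ, ∑ i, f (p i) = ∑ i, f i := fun f =>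
    (Equiv.sum_comp (Function.Involutive.toPerm p hinv) f)
  have h1 := Finset.sum_congr (rfl : (Finset.univ : Finset (Fin s)) = _) fun i _ => key i
  rw [Finset.sum_add_distrib, Finset.sum_add_distrib,
    hsum (fun i => ‖(scatter ε Z i).2‖ ^ 2), hsum (fun i => ‖(Z i).2‖ ^ 2)] at h1
  simp only [energy]
  linarith

lemma energy_drift (a : ℝ) (Z : Conf d s) : energy (drift a Z) = energy Z := rfl

open Classical in
lemma scatter_snd (Z : Conf d s) (i : Fin s) : (scatter ε Z i).2 = (Z i).2
      - (∑ j, if i ≠ j ∧ ‖(Z i).1 - (Z j).1‖ = ε then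
          ((1 / ε ^ 2) * inner ℝ ((Z i).2 - (Z j).2) ((Z i).1 - (Z j).1)) • ((Z i).1 - (Z j).1)
          else 0)
      - (if inner ℝ (Z i).1 (e₁ d) = ε / 2 then (2 * inner ℝ (Z i).2 (e₁ d)) • e₁ d else 0) := by
  simp only [scatter, Finset.sum_filter]

lemma scatter_rev (Z : Conf d s) : scatter ε (rev Z) = rev (scatter ε Z) := by
  classical
  funext i
  ext1
  · rfl
  have h : ∀ W : Conf d s, (rev W i).2 = -(W i).2 := fun _ => rfl
  rw [h, scatter_snd, scatter_snd]
  have h2 : ∀ j, (if i ≠ j ∧ ‖(rev Z i).1 - (rev Z j).1‖ = ε then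
      ((1 / ε ^ 2) * inner ℝ ((rev Z i).2 - (rev Z j).2) ((rev Z i).1 - (rev Z j).1)) •
        ((rev Z i).1 - (rev Z j).1) else 0) = -(if i ≠ j ∧ ‖(Z i).1 - (Z j).1‖ = ε then
      ((1 / ε ^ 2) * inner ℝ ((Z i).2 - (Z j).2) ((Z i).1 - (Z j).1)) •
        ((Z i).1 - (Z j).1) else 0) := by
    intro j
    by_cases hc : i ≠ j ∧ ‖(Z i).1 - (Z j).1‖ = ε
    · have hc' : i ≠ j ∧ ‖(rev Z i).1 - (rev Z j).1‖ = ε := hc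
      rw [if_pos hc, if_pos hc']
      simp only [rev, inner_sub_left, inner_neg_left]
      module
    · have hc' : ¬(i ≠ j ∧ ‖(rev Z i).1 - (rev Z j).1‖ = ε) := hc
      rw [if_neg hc, if_neg hc', neg_zero]
  simp only [h2, Finset.sum_neg_distrib]
  simp only [rev, inner_neg_left]
  split_ifs
  · module
  · module

/-- If no contact is transversal the jump law is trivial. -/
lemma scatter_eq_self {Z : Conf d s}
    (h1 : ∀ i j, i ≠ j → ‖(Z i).1 - (Z j).1‖ = ε →
      inner ℝ ((Z i).2 - (Z j).2) ((Z i).1 - (Z j).1) = (0 : ℝ))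
    (h2 : ∀ i, inner ℝ (Z i).1 (e₁ d) = ε / 2 → inner ℝ (Z i).2 (e₁ d) = (0 : ℝ)) :
    scatter ε Z = Z := by
  classical
  funext i
  ext1
  · rfl
  simp only [scatter]
  rw [Finset.sum_eq_zero]
  · split_ifs with h
    · simp [h2 i h]
    · simp
  · intro j hj
    simp only [Finset.mem_filter, Finset.mem_univ, true_and] at hj
    rw [h1 i j hj.1 hj.2]
    simp

/-- Expanding the square, ‖x + r v‖² - ε² is r times 2⟨v, x⟩ + r‖v‖², and the second factor is
negative for small r > 0 as soon as ⟨v, x⟩ < 0. -/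
lemma inner_nonneg_of_eventually_norm {x v : E d} (hx : ‖x‖ = ε) (hε : 0 < ε)
    (h : ∃ᶠ r in 𝓝[>] (0 : ℝ), ε ≤ ‖x + r • v‖) : 0 ≤ inner ℝ v x := by
  by_contra! hneg
  have hev : ∀ᶠ r in 𝓝[>] (0 : ℝ), 2 * inner ℝ v x + r * ‖v‖ ^ 2 < 0 := by
    have : Tendsto (fun r : ℝ => 2 * inner ℝ v x + r * ‖v‖ ^ 2) (𝓝[>] 0)
        (𝓝 (2 * inner ℝ v x + 0 * ‖v‖ ^ 2)) :=
      (Continuous.tendsto (by fun_prop) 0).mono_left nhdsWithin_le_nhds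
    exact this.eventually_lt_const (by linarith)
  obtain ⟨r, hr, hr2, hr0⟩ := (h.and_eventually (hev.and self_mem_nhdsWithin)).exists
  have h1 : ε ^ 2 ≤ ‖x + r • v‖ ^ 2 := by gcongr
  rw [norm_add_sq_real, hx, inner_smul_right, norm_smul, mul_pow, Real.norm_eq_abs, sq_abs,
    real_inner_comm] at h1
  have hr0' : 0 < r := hr0
  have : r * (2 * inner ℝ v x + r * ‖v‖ ^ 2) < 0 := mul_neg_of_pos_of_neg hr0' hr2
  nlinarith

lemma inner_nonneg_of_eventually_wall {x v : E d} (hx : inner ℝ x (e₁ d) = ε / 2)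
    (h : ∃ᶠ r in 𝓝[>] (0 : ℝ), ε / 2 ≤ inner ℝ (x + r • v) (e₁ d)) :
    0 ≤ inner ℝ v (e₁ d) := by
  obtain ⟨r, hr, hr0⟩ := (h.and_eventually self_mem_nhdsWithin).exists
  rw [inner_add_left, hx, inner_smul_left] at hr
  have hr0' : (0 : ℝ) < r := hr0
  simp only [conj_trivial] at hr
  by_contra! hneg
  nlinarith

/-- A configuration that can move freely both forwards and backwards has no transversal contact. -/
lemma scatter_eq_self_of_frequently (hε : 0 < ε) {Z : Conf d s}
    (hf : ∃ᶠ r in 𝓝[>] (0 : ℝ), drift r Z ∈ phaseSpace d ε s)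
    (hb : ∃ᶠ r in 𝓝[>] (0 : ℝ), drift (-r) Z ∈ phaseSpace d ε s) : scatter ε Z = Z := by
  have e1 : ∀ (r : ℝ) (i j : Fin s), (drift r Z i).1 - (drift r Z j).1
      = ((Z i).1 - (Z j).1) + r • ((Z i).2 - (Z j).2) := by
    intro r i j; simp only [drift_fst]; module
  have e2 : ∀ (r : ℝ) (i j : Fin s), (drift (-r) Z i).1 - (drift (-r) Z j).1
      = ((Z i).1 - (Z j).1) + r • -((Z i).2 - (Z j).2) := by
    intro r i j; simp only [drift_fst]; module
  apply scatter_eq_self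
  · intro i j hij hc
    apply le_antisymm
    · have := inner_nonneg_of_eventually_norm (v := -((Z i).2 - (Z j).2)) hc hε
        (hb.mono fun r hr => by rw [← e2]; exact hr.2 i j hij)
      rw [inner_neg_left] at this
      linarith
    · exact inner_nonneg_of_eventually_norm hc hε
        (hf.mono fun r hr => by rw [← e1]; exact hr.2 i j hij)
  · intro i hc
    apply le_antisymm
    · have := inner_nonneg_of_eventually_wall (v := -(Z i).2) hc
        (hb.mono fun r hr => by simpa using hr.1 i)
      rw [inner_neg_left] at this
      linarith
    · exact inner_nonneg_of_eventually_wall hc (hf.mono fun r hr => hr.1 i)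

end Scatter

/-! ### Trajectories as chains of free flights -/

section Reach

variable {d s : ℕ} [NeZero d] {ε : ℝ}

/-- Free motion from `Z` during the time interval `[0, a]` stays admissible. -/
def FreeArc (ε a : ℝ) (Z : Conf d s) : Prop := ∀ r ∈ Icc 0 a, Admissible ε (drift r Z)

/-- `Reach ε t Z W`: the hard sphere dynamics brings `Z` to `W` in time `t`, in finitely many free
flights each of which is followed by the jump law. -/
inductive Reach (ε : ℝ) : ℝ → Conf d s → Conf d s → Prop
  | nil (Z : Conf d s) : Reach ε 0 Z Z
  | cons {a t : ℝ} {Z W : Conf d s} (ha : 0 < a) (h : FreeArc ε a Z)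
      (h' : Reach ε t (scatter ε (drift a Z)) W) : Reach ε (a + t) Z W

lemma Reach.nonneg {t : ℝ} {Z W : Conf d s} (h : Reach ε t Z W) : 0 ≤ t := by
  induction h with
  | nil => exact le_rfl
  | cons ha _ _ ih => linarith

lemma Reach.flight {a : ℝ} {Z : Conf d s} (ha : 0 < a) (h : FreeArc ε a Z) :
    Reach ε a Z (scatter ε (drift a Z)) := by
  simpa using Reach.cons ha h (Reach.nil _)

lemma Reach.trans {t t' : ℝ} {Z Y W : Conf d s} (h : Reach ε t Z Y) (h' : Reach ε t' Y W) :
    Reach ε (t + t') Z W := by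
  induction h with
  | nil => simpa using h'
  | cons ha hf _ ih => rw [add_assoc]; exact Reach.cons ha hf (ih h')

lemma Reach.eq_of_zero {Z W : Conf d s} (h : Reach ε 0 Z W) : Z = W := by
  generalize ht : (0 : ℝ) = t at h
  cases h with
  | nil => rfl
  | cons ha hf h' => have := h'.nonneg; linarith

lemma Reach.admissible_left {t : ℝ} (ht : 0 < t) {Z W : Conf d s} (h : Reach ε t Z W) :
    Admissible ε Z := by
  cases h with
  | nil => exact absurd ht (lt_irrefl _)
  | cons ha hf _ => simpa using hf 0 ⟨le_rfl, ha.le⟩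

/-- At an interior time of a free flight the configuration can move freely in both directions, so
none of its contacts is transversal. Consequently a flight may be subdivided without changing the
dynamics. -/
lemma FreeArc.scatter_drift (hε : 0 < ε) {a b : ℝ} {Z : Conf d s} (h : FreeArc ε a Z) (hb : 0 < b)
    (hba : b < a) : scatter ε (drift b Z) = drift b Z := by
  apply scatter_eq_self_of_frequently hε
  · apply Eventually.frequently
    have : Ioo (0 : ℝ) (a - b) ∈ 𝓝[>] (0 : ℝ) := Ioo_mem_nhdsGT (by linarith)
    filter_upwards [this] with r hr
    rw [drift_drift]
    exact (h _ ⟨by linarith [hr.1], by linarith [hr.2]⟩).1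
  · apply Eventually.frequently
    have : Ioo (0 : ℝ) b ∈ 𝓝[>] (0 : ℝ) := Ioo_mem_nhdsGT hb
    filter_upwards [this] with r hr
    rw [drift_drift]
    exact (h _ ⟨by linarith [hr.2], by linarith [hr.1]⟩).1

lemma FreeArc.mono {a b : ℝ} {Z : Conf d s} (h : FreeArc ε a Z) (hba : b ≤ a) : FreeArc ε b Z :=
  fun r hr => h r ⟨hr.1, hr.2.trans hba⟩

lemma FreeArc.tail {a b : ℝ} {Z : Conf d s} (h : FreeArc ε a Z) (hb : 0 ≤ b) :
    FreeArc ε (a - b) (drift b Z) := fun r hr => by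
  rw [drift_drift]; exact h _ ⟨by linarith [hr.1], by linarith [hr.2]⟩

/-- Chains are not unique, since flights can be subdivided. An initial flight of any admissible
length can nevertheless be removed, whatever the subdivision of the given chain, because jumps at
interior times are trivial. Determinism rests on this. -/
lemma Reach.sub_flight (hε : 0 < ε) {t : ℝ} {Z W : Conf d s} (h : Reach ε t Z W) :
    ∀ {a : ℝ}, 0 < a → a ≤ t → FreeArc ε a Z → Reach ε (t - a) (scatter ε (drift a Z)) W := by
  induction h with
  | nil => intro a ha hat; linarith
  | @cons b t Z W hb hf h' ih =>
    intro a ha hat hfa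
    rcases lt_trichotomy a b with hab | rfl | hab
    · rw [hf.scatter_drift hε ha hab]
      have h1 := hf.tail (b := a) ha.le
      have : b + t - a = (b - a) + t := by ring
      rw [this]
      refine Reach.cons (by linarith) h1 ?_
      rw [drift_drift]
      simpa using h'
    · simpa using h'
    -- The removed flight outlasts the first flight of the chain, so the jump ending that first
    -- flight is trivial and the induction continues with the remaining length.
    · rw [hfa.scatter_drift hε hb hab] at ih
      have := ih (a := a - b) (by linarith) (by linarith) (hfa.tail hb.le)
      rw [drift_drift] at this
      convert this using 1
      · ring
      · simp

/-- The flights of the shorter chain are peeled off the longer one, one at a time. -/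
lemma Reach.det (hε : 0 < ε) {t t' : ℝ} {Z W W' : Conf d s} (h : Reach ε t Z W)
    (h' : Reach ε t' Z W') (htt : t ≤ t') : Reach ε (t' - t) W W' := by
  induction h generalizing t' with
  | nil => simpa using h'
  | @cons b t Z W hb hf h1 ih =>
    have := h1.nonneg
    have := ih (h'.sub_flight hε hb (by linarith) hf) (by linarith)
    convert this using 1
    ring

lemma Reach.unique (hε : 0 < ε) {t : ℝ} {Z W W' : Conf d s} (h : Reach ε t Z W)
    (h' : Reach ε t Z W') : W = W' := by
  have := h.det hε h' le_rfl
  rw [sub_self] at this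
  exact this.eq_of_zero

lemma Reach.split (hε : 0 < ε) {t : ℝ} {Z W : Conf d s} (h : Reach ε t Z W) :
    ∀ {a : ℝ}, 0 ≤ a → a ≤ t → ∃ Y, Reach ε a Z Y ∧ Reach ε (t - a) Y W := by
  induction h with
  | nil Z =>
    intro a h0 h1
    obtain rfl := le_antisymm h1 h0
    exact ⟨Z, Reach.nil _, by simpa using Reach.nil _⟩
  | @cons b t Z W hb hf h' ih =>
    intro a h0 h1
    rcases h0.eq_or_lt with rfl | h0
    · exact ⟨Z, Reach.nil _, by simpa using Reach.cons hb hf h'⟩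
    rcases le_total a b with hab | hab
    · exact ⟨_, Reach.flight h0 (hf.mono hab),
        (Reach.cons hb hf h').sub_flight hε h0 h1 (hf.mono hab)⟩
    · obtain ⟨Y, h2, h3⟩ := ih (a := a - b) (by linarith) (by linarith)
      refine ⟨Y, by simpa using Reach.cons hb hf h2, ?_⟩
      convert h3 using 1
      ring

lemma Reach.energy_eq (hε : 0 < ε) {t : ℝ} {Z W : Conf d s} (h : Reach ε t Z W) :
    energy W = energy Z := by
  induction h with
  | nil => rfl
  | @cons b t Z W hb hf h' ih =>
    rw [ih, energy_scatter hε (hf b ⟨hb.le, le_rfl⟩).2, energy_drift]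

lemma scatter_rev_scatter_rev (hε : 0 < ε) {Z : Conf d s} (hZ : Admissible ε Z) :
    scatter ε (rev (scatter ε (rev Z))) = Z := by
  rw [scatter_rev (scatter ε (rev Z)), scatter_scatter hε, rev_rev]
  exact nonPathological_congr (fun _ => rfl) hZ.2

/-- Time reversal. -/
lemma Reach.reverse (hε : 0 < ε) {t : ℝ} {Z W : Conf d s} (h : Reach ε t Z W) :
    Reach ε t (scatter ε (rev W)) (scatter ε (rev Z)) := by
  induction h with
  | nil => exact Reach.nil _
  | @cons b t Z W hb hf h' ih =>
    rw [add_comm]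
    refine ih.trans ?_
    have hadm := hf b ⟨hb.le, le_rfl⟩
    have h1 : scatter ε (rev (scatter ε (drift b Z))) = rev (drift b Z) := by
      rw [scatter_rev, scatter_scatter hε hadm.2]
    rw [h1]
    have h2 : FreeArc ε b (rev (drift b Z)) := by
      intro r hr
      rw [drift_rev, drift_drift]
      exact admissible_congr (fun _ => rfl) (hf (-r + b) ⟨by linarith [hr.2], by linarith [hr.1]⟩)
    have h3 := Reach.flight hb h2
    rw [drift_rev, drift_drift] at h3
    simpa using h3

/-- Backward determinism is forward determinism for the time-reversed chains. For positive time the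
starting configurations are admissible, so reversal can be undone. -/
lemma Reach.unique_left (hε : 0 < ε) {t : ℝ} {Z Z' W : Conf d s} (h : Reach ε t Z W)
    (h' : Reach ε t Z' W) : Z = Z' := by
  rcases h.nonneg.eq_or_lt with rfl | ht
  · rw [h.eq_of_zero, h'.eq_of_zero]
  · have := (h.reverse hε).unique hε (h'.reverse hε)
    rw [← scatter_rev_scatter_rev hε (h.admissible_left ht), this,
      scatter_rev_scatter_rev hε (h'.admissible_left ht)]

lemma Reach.last {t : ℝ} {Z W : Conf d s} (h : Reach ε t Z W) (ht : 0 < t) :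
    ∃ a Y, 0 < a ∧ a ≤ t ∧ FreeArc ε a Y ∧ Reach ε (t - a) Z Y ∧ W = scatter ε (drift a Y) := by
  induction h with
  | nil => exact absurd ht (lt_irrefl _)
  | @cons b t Z W hb hf h' ih =>
    rcases h'.nonneg.eq_or_lt with h0 | h0
    · subst h0
      exact ⟨b, Z, hb, by simp, hf, by simpa using Reach.nil Z, h'.eq_of_zero.symm⟩
    · obtain ⟨a, Y, h1, h2, h3, h4, h5⟩ := ih h0
      refine ⟨a, Y, h1, by linarith, h3, ?_, h5⟩
      have := Reach.cons hb hf h4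
      convert this using 1
      ring

/-- The flow relation determines trajectories. -/
lemma isTrajectory_of_reach (hε : 0 < ε) {γ : ℝ → Conf d s}
    (h : ∀ a b, a ≤ b → Reach ε (b - a) (γ a) (γ b)) : IsTrajectory ε γ := by
  refine ⟨fun t => ?_, fun t => ?_, fun t => ?_⟩
  · exact (h t (t + 1) (by linarith)).admissible_left (by linarith)
  · have h1 := h t (t + 1) (by linarith)
    generalize ht : t + 1 - t = u at h1
    generalize γ (t + 1) = W at h1
    generalize hZ : γ t = Z at h1
    cases h1 with
    | nil => linarith
    | @cons a t' _ _ ha hf h' =>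
      have : Ioo t (t + a) ∈ 𝓝[>] t := Ioo_mem_nhdsGT (by linarith)
      filter_upwards [this] with r hr
      have h2 := h t r hr.1.le
      rw [hZ] at h2
      have h3 := Reach.flight (ε := ε) (Z := Z) (a := r - t) (by linarith [hr.1])
        (hf.mono (by linarith [hr.2]))
      rw [h2.unique hε h3, hf.scatter_drift hε (by linarith [hr.1]) (by linarith [hr.2])]
  · obtain ⟨a, Y, ha, hat, hf, h1, h2⟩ := (h (t - 1) t (by linarith)).last (by linarith)
    refine ⟨drift a Y, h2, ?_⟩
    -- The start of the last flight is a point of `γ` by backward determinism; its free end `drift a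
    -- Y`, before the jump, is the incoming state at time t.
    have hY : γ (t - a) = Y := by
      refine (h (t - a) t (by linarith)).unique_left hε (Z' := Y) ?_
      have := Reach.flight ha hf
      rw [← h2] at this
      simpa using this
    have : Ioo (t - a) t ∈ 𝓝[<] t := Ioo_mem_nhdsLT (by linarith)
    filter_upwards [this] with r hr
    have h3 := h (t - a) r hr.1.le
    rw [hY] at h3
    have h4 := Reach.flight (ε := ε) (Z := Y) (a := r - (t - a)) (by linarith [hr.1])
        (hf.mono (by linarith [hr.2]))
    rw [h3.unique hε h4, hf.scatter_drift hε (by linarith [hr.1]) (by linarith [hr.2]), drift_drift]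
    congr 1
    ring

lemma IsTrajectory.left_state (hε : 0 < ε) {γ : ℝ → Conf d s} (h : IsTrajectory ε γ) (t : ℝ) :
    ∀ᶠ r in 𝓝[<] t, γ r = drift (r - t) (scatter ε (γ t)) := by
  obtain ⟨Z, h1, h2⟩ := h.2.2 t
  have hZ : NonPathological ε Z := by
    have := (h.1 t).2
    rw [h1] at this
    exact nonPathological_congr (fun _ => rfl) this
  rw [h1, scatter_scatter hε hZ]
  exact h2

lemma IsTrajectory.exists_radius (hε : 0 < ε) {γ : ℝ → Conf d s} (h : IsTrajectory ε γ) (t : ℝ) :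
    ∃ η > 0, (∀ r ∈ Ico t (t + η), γ r = drift (r - t) (γ t)) ∧
      ∀ r ∈ Ioo (t - η) t, γ r = drift (r - t) (scatter ε (γ t)) := by
  obtain ⟨b, hb, h1⟩ := mem_nhdsGT_iff_exists_Ioo_subset.1 (h.2.1 t)
  obtain ⟨a, ha, h2⟩ := mem_nhdsLT_iff_exists_Ioo_subset.1 (h.left_state hε t)
  have ha' : a < t := ha
  have hb' : t < b := hb
  refine ⟨min (b - t) (t - a), lt_min (by linarith) (by linarith), fun r hr => ?_, fun r hr => ?_⟩
  · rcases hr.1.eq_or_lt with rfl | h3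
    · simp
    · exact h1 ⟨h3, by linarith [hr.2, min_le_left (b - t) (t - a)]⟩
  · exact h2 ⟨by linarith [hr.1, min_le_right (b - t) (t - a)], hr.2⟩

/-- Every time has a neighbourhood in which motion is straight on each side, so jumps cannot
accumulate in a bounded interval. The supremum of the times joined to `a` by a finite chain is
itself joined, and it can be exceeded unless it equals `b`. -/
lemma IsTrajectory.reach (hε : 0 < ε) {γ : ℝ → Conf d s} (h : IsTrajectory ε γ) {a b : ℝ}
    (hab : a ≤ b) : Reach ε (b - a) (γ a) (γ b) := by
  -- short arcs starting or ending at a given time are free flights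
  have hR : ∀ c, ∃ η > 0, (∀ r ∈ Ioo c (c + η), Reach ε (r - c) (γ c) (γ r)) ∧
      ∀ r ∈ Ioo (c - η) c, Reach ε (c - r) (γ r) (γ c) := by
    intro c
    obtain ⟨η, hη, h1, h2⟩ := h.exists_radius hε c
    refine ⟨η, hη, fun r hr => ?_, fun r hr => ?_⟩
    · have hf : FreeArc ε (r - c) (γ c) := by
        intro x hx
        have := h1 (c + x) ⟨by linarith [hx.1], by linarith [hx.2, hr.2]⟩
        rw [add_sub_cancel_left] at this
        rw [← this]
        exact h.1 _
      have h3 := Reach.flight (by linarith [hr.1]) hf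
      convert h3 using 1
      -- The incoming state Z at time r and the straight motion from `γ c` describe the same
      -- configuration at a time x between c and r, which identifies Z.
      obtain ⟨Z, h4, h5⟩ := h.2.2 r
      have : Ioo c r ∈ 𝓝[<] r := Ioo_mem_nhdsLT hr.1
      obtain ⟨x, hx1, hx2⟩ := (h5.and this).exists
      have h6 := h1 x ⟨hx2.1.le, by linarith [hx2.2, hr.2]⟩
      rw [h6] at hx1
      rw [h4]
      congr 1
      have h7 := congrArg (drift (r - x)) hx1
      rw [drift_drift, drift_drift] at h7
      simpa using h7.symm
    · have hr0 := h2 r hr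
      have h0 : drift (c - r) (γ r) = scatter ε (γ c) := by
        rw [hr0, drift_drift]; simp
      have hf : FreeArc ε (c - r) (γ r) := by
        intro x hx
        rcases hx.2.eq_or_lt with h4 | h4
        · rw [h4, h0]
          exact admissible_congr (fun _ => rfl) (h.1 c)
        · have h5 := h2 (r + x) ⟨by linarith [hr.1, hx.1], by linarith⟩
          have : drift x (γ r) = γ (r + x) := by
            rw [h5, hr0, drift_drift]; congr 1; ring
          rw [this]
          exact h.1 _
      have h3 := Reach.flight (by linarith [hr.2]) hf
      rwa [h0, scatter_scatter hε (h.1 c).2] at h3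
  -- the supremum of the reached times
  let A : Set ℝ := {c | c ∈ Icc a b ∧ Reach ε (c - a) (γ a) (γ c)}
  have haA : a ∈ A := ⟨⟨le_rfl, hab⟩, by simpa using Reach.nil _⟩
  have hbd : BddAbove A := ⟨b, fun c hc => hc.1.2⟩
  set c := sSup A with hc
  have hac : a ≤ c := le_csSup hbd haA
  have hcb : c ≤ b := csSup_le ⟨a, haA⟩ fun c hc => hc.1.2
  obtain ⟨η, hη, h1, h2⟩ := hR c
  have hcA : c ∈ A := by
    obtain ⟨x, hx, hxc⟩ := exists_lt_of_lt_csSup ⟨a, haA⟩ (show c - η < sSup A by linarith)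
    rcases (le_csSup hbd hx).eq_or_lt with h3 | h3
    · rw [← hc] at h3
      rwa [← h3]
    · refine ⟨⟨hac, hcb⟩, ?_⟩
      have := hx.2.trans (h2 x ⟨hxc, h3⟩)
      convert this using 1
      ring
  rcases hcb.eq_or_lt with h3 | h3
  · rw [← h3]; exact hcA.2
  · exfalso
    have hm : c < min b (c + η / 2) := lt_min h3 (by linarith)
    have h4 : min b (c + η / 2) ∈ A := by
      refine ⟨⟨hac.trans hm.le, min_le_left _ _⟩, ?_⟩
      have := hcA.2.trans (h1 _ ⟨hm, by linarith [min_le_right b (c + η / 2)]⟩)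
      convert this using 1
      ring
    exact absurd (le_csSup hbd h4) (not_le.2 hm)

lemma IsTrajectory.ext (hε : 0 < ε) {γ γ' : ℝ → Conf d s} (h : IsTrajectory ε γ)
    (h' : IsTrajectory ε γ') {t : ℝ} (ht : γ t = γ' t) : γ = γ' := by
  funext r
  rcases le_total t r with htr | htr
  · have := h'.reach hε htr
    rw [← ht] at this
    exact (h.reach hε htr).unique hε this
  · have := h'.reach hε htr
    rw [← ht] at this
    exact (h.reach hε htr).unique_left hε this

/-- Integer times suffice because chains can be split and determinism makes the pieces coherent. The
existence of a global trajectory thus becomes a countable conjunction of conditions on `Reach`,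
which is what measurability requires. -/
lemma exists_isTrajectory_iff (hε : 0 < ε) {Z : Conf d s} :
    (∃ γ, IsTrajectory ε γ ∧ γ 0 = Z) ↔
      ∀ m : ℕ, (∃ W, Reach ε m Z W) ∧ ∃ W, Reach ε m W Z := by
  constructor
  · rintro ⟨γ, h, rfl⟩ m
    refine ⟨⟨γ m, ?_⟩, ⟨γ (-m), ?_⟩⟩
    · simpa using h.reach hε (show (0 : ℝ) ≤ m by positivity)
    · simpa using h.reach hε (show -(m : ℝ) ≤ 0 by simp)
  · intro h
    have hf : ∀ t : ℝ, 0 ≤ t → ∃ W, Reach ε t Z W := by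
      intro t ht
      obtain ⟨m, hm⟩ := exists_nat_ge t
      obtain ⟨W, hW⟩ := (h m).1
      obtain ⟨Y, hY, -⟩ := hW.split hε ht hm
      exact ⟨Y, hY⟩
    have hb : ∀ t : ℝ, 0 ≤ t → ∃ W, Reach ε t W Z := by
      intro t ht
      obtain ⟨m, hm⟩ := exists_nat_ge t
      obtain ⟨W, hW⟩ := (h m).2
      obtain ⟨Y, -, hY⟩ := hW.split hε (a := m - t) (by linarith) (by linarith)
      exact ⟨Y, by simpa using hY⟩
    have hγ : ∀ t : ℝ, ∃ W, (0 ≤ t → Reach ε t Z W) ∧ (t ≤ 0 → Reach ε (-t) W Z) := by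
      intro t
      rcases lt_trichotomy t 0 with ht | rfl | ht
      · obtain ⟨W, hW⟩ := hb (-t) (by linarith)
        exact ⟨W, fun h => absurd h (not_le.2 ht), fun _ => hW⟩
      · exact ⟨Z, fun _ => Reach.nil _, fun _ => by simpa using Reach.nil _⟩
      · obtain ⟨W, hW⟩ := hf t ht.le
        exact ⟨W, fun _ => hW, fun h => absurd h (not_le.2 ht)⟩
    choose γ h1 h2 using hγ
    refine ⟨γ, isTrajectory_of_reach hε fun a b hab => ?_, ?_⟩
    · rcases le_total 0 a with ha | ha
      · exact (h1 a ha).det hε (h1 b (ha.trans hab)) hab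
      · rcases le_total 0 b with hb' | hb'
        · have := (h2 a ha).trans (h1 b hb')
          convert this using 1
          ring
        · obtain ⟨Y, hY1, hY2⟩ := (h2 a ha).split hε (a := b - a) (by linarith) (by linarith)
          have : Y = γ b := by
            refine hY2.unique_left hε ?_
            convert h2 b hb' using 1
            ring
          rwa [← this]
    · exact (h1 0 le_rfl).eq_of_zero.symm

/-- Configurations through which a global trajectory passes. -/
def globalSet (d s : ℕ) [NeZero d] (ε : ℝ) : Set (Conf d s) := {Z | ∃ γ, IsTrajectory ε γ ∧ γ 0 = Z}

lemma exists_isTrajectoryFrom_iff (hε : 0 < ε) {Z : Conf d s} :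
    (∃ γ, IsTrajectoryFrom ε Z γ) ↔ Z ∈ globalSet d s ε ∨ scatter ε Z ∈ globalSet d s ε := by
  constructor
  · rintro ⟨γ, h, h' | h'⟩
    · exact Or.inl ⟨γ, h, h'⟩
    · right
      refine ⟨γ, h, ?_⟩
      obtain ⟨r, h1, h2⟩ := (h'.and (h.left_state hε 0)).exists
      rw [h1, sub_zero] at h2
      have := congrArg (drift (-r)) h2
      rw [drift_drift, drift_drift] at this
      simp only [neg_add_cancel, drift_zero] at this
      rw [this, scatter_scatter hε (h.1 0).2]
  · rintro (⟨γ, h, h'⟩ | ⟨γ, h, h'⟩)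
    · exact ⟨γ, h, Or.inl h'⟩
    · refine ⟨γ, h, Or.inr ?_⟩
      have := h.left_state hε 0
      have hZ : NonPathological ε Z := nonPathological_congr (fun i => by rw [h']; rfl) (h.1 0).2
      rw [h', scatter_scatter hε hZ] at this
      simpa using this

lemma IsTrajectoryFrom.eq_or (hε : 0 < ε) {Z : Conf d s} {γ : ℝ → Conf d s}
    (h : IsTrajectoryFrom ε Z γ) : Admissible ε Z ∧ (γ 0 = Z ∨ γ 0 = scatter ε Z) := by
  obtain ⟨h, h' | h'⟩ := h
  · exact ⟨h' ▸ h.1 0, Or.inl h'⟩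
  · obtain ⟨r, h1, h2⟩ := (h'.and (h.left_state hε 0)).exists
    rw [h1, sub_zero] at h2
    have := congrArg (drift (-r)) h2
    rw [drift_drift, drift_drift] at this
    simp only [neg_add_cancel, drift_zero] at this
    rw [this, scatter_scatter hε (h.1 0).2]
    exact ⟨admissible_congr (fun _ => rfl) (h.1 0), Or.inr rfl⟩

/-- The first trajectory lets `Z` move freely forwards; the second has `Z` as its incoming state,
since the jump is an involution, so `Z` also moves freely backwards. Hence no contact is
transversal. This removes the only possible ambiguity in the trajectory attached to `Z`. -/
lemma scatter_eq_of_mem_of_mem (hε : 0 < ε) {Z : Conf d s} (h1 : Z ∈ globalSet d s ε)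
    (h2 : scatter ε Z ∈ globalSet d s ε) : scatter ε Z = Z := by
  obtain ⟨γ, h, h'⟩ := h1
  obtain ⟨δ, k, k'⟩ := h2
  have hZ : NonPathological ε Z := h' ▸ (h.1 0).2
  apply scatter_eq_self_of_frequently hε
  · have := h.2.1 0
    rw [h'] at this
    apply Eventually.frequently
    filter_upwards [this] with r hr
    rw [sub_zero] at hr
    rw [← hr]
    exact (h.1 r).1
  · have := k.left_state hε 0
    rw [k', scatter_scatter hε hZ] at this
    apply Eventually.frequently
    have ht : Tendsto (fun r : ℝ => -r) (𝓝[>] 0) (𝓝[<] 0) := by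
      have := tendsto_neg_nhdsGT (a := (0 : ℝ))
      simpa using this
    filter_upwards [ht.eventually this] with r hr
    rw [sub_zero] at hr
    rw [← hr]
    exact (k.1 _).1

lemma IsTrajectoryFrom.ext (hε : 0 < ε) {Z : Conf d s} {γ γ' : ℝ → Conf d s}
    (h : IsTrajectoryFrom ε Z γ) (h' : IsTrajectoryFrom ε Z γ') : γ = γ' := by
  apply h.1.ext hε h'.1 (t := 0)
  have a1 : γ 0 ∈ globalSet d s ε := ⟨γ, h.1, rfl⟩
  have a2 : γ' 0 ∈ globalSet d s ε := ⟨γ', h'.1, rfl⟩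
  obtain ⟨-, h1⟩ := h.eq_or hε
  obtain ⟨-, h2⟩ := h'.eq_or hε
  rcases h1 with h1 | h1 <;> rcases h2 with h2 | h2 <;> rw [h1] at a1 ⊢ <;> rw [h2] at a2 ⊢
  · exact (scatter_eq_of_mem_of_mem hε a1 a2).symm
  · exact (scatter_eq_of_mem_of_mem hε a2 a1)

lemma hsFlow_eq (hε : 0 < ε) {Z : Conf d s} {γ : ℝ → Conf d s} (h : IsTrajectoryFrom ε Z γ)
    (t : ℝ) : hsFlow ε t Z = γ t := by
  have h' : ∃ γ, IsTrajectoryFrom ε Z γ := ⟨γ, h⟩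
  rw [hsFlow, dif_pos h', h'.choose_spec.ext hε h]

lemma IsTrajectory.energy_eq (hε : 0 < ε) {γ : ℝ → Conf d s} (h : IsTrajectory ε γ) (t r : ℝ) :
    energy (γ t) = energy (γ r) := by
  rcases le_total t r with htr | htr
  · exact ((h.reach hε htr).energy_eq hε).symm
  · exact (h.reach hε htr).energy_eq hε

lemma energy_hsFlow (hε : 0 < ε) (t : ℝ) (Z : Conf d s) : energy (hsFlow ε t Z) = energy Z := by
  by_cases h : ∃ γ, IsTrajectoryFrom ε Z γ
  · obtain ⟨γ, h⟩ := h
    rw [hsFlow_eq hε h, h.1.energy_eq hε t 0]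
    obtain ⟨h1, h2 | h2⟩ := h.eq_or hε
    · rw [h2]
    · rw [h2, energy_scatter hε h1.2]
  · rw [hsFlow, dif_neg h]

end Reach

/-! ### Measurability of the hard sphere flow -/

section SigmaCompact

variable {X Y : Type*} [TopologicalSpace X] [TopologicalSpace Y]

lemma isSigmaCompact_of_isClosed [SigmaCompactSpace X] {A : Set X} (h : IsClosed A) :
    IsSigmaCompact A := isSigmaCompact_univ.of_isClosed_subset h (subset_univ _)

lemma isSigmaCompact_of_isOpen {X : Type*} [PseudoMetricSpace X] [SigmaCompactSpace X] {A : Set X}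
    (h : IsOpen A) : IsSigmaCompact A := by
  obtain ⟨F, h1, -, h2, -⟩ := h.exists_iUnion_isClosed
  rw [← h2]
  exact isSigmaCompact_iUnion _ fun n => isSigmaCompact_of_isClosed (h1 n)

lemma isSigmaCompact_inter [T2Space X] {A B : Set X} (hA : IsSigmaCompact A)
    (hB : IsSigmaCompact B) : IsSigmaCompact (A ∩ B) := by
  obtain ⟨K, hK, rfl⟩ := hA
  obtain ⟨L, hL, rfl⟩ := hB
  rw [iUnion_inter_iUnion]
  exact isSigmaCompact_iUnion _ fun m => isSigmaCompact_iUnion _ fun n =>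
    ((hK m).inter (hL n)).isSigmaCompact

lemma isSigmaCompact_preimage [SigmaCompactSpace X] [T2Space Y] {f : X → Y} (hf : Continuous f)
    {A : Set Y} (hA : IsSigmaCompact A) : IsSigmaCompact (f ⁻¹' A) := by
  obtain ⟨K, hK, rfl⟩ := hA
  rw [preimage_iUnion]
  exact isSigmaCompact_iUnion _ fun n =>
    isSigmaCompact_of_isClosed ((hK n).isClosed.preimage hf)

/-- Projections of Borel sets need not be Borel, whereas σ-compact sets are stable under continuous
images. For this reason the graph of the flow, defined by existential quantifiers over flight times,
is treated through σ-compactness. -/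
lemma measurableSet_of_isSigmaCompact [T2Space X] [MeasurableSpace X] [OpensMeasurableSpace X]
    {A : Set X} (hA : IsSigmaCompact A) : MeasurableSet A := by
  obtain ⟨K, hK, rfl⟩ := hA
  exact MeasurableSet.iUnion fun n => (hK n).measurableSet

end SigmaCompact

/-! ### Contact patterns and σ-compactness of the graph of the flow -/

section Flow

variable {d s : ℕ} [NeZero d] {ε : ℝ}

/-- Possible sets of contacts: pairs of particles, and particles at the wall. -/
abbrev ContactPattern (s : ℕ) : Type := (Fin s → Fin s → Bool) × (Fin s → Bool)

/-- The contacts of `Z` are those of the pattern `c`. -/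
def HasPattern (ε : ℝ) (c : ContactPattern s) (Z : Conf d s) : Prop :=
  (∀ i j, c.1 i j = true ↔ i ≠ j ∧ ‖(Z i).1 - (Z j).1‖ = ε) ∧
    ∀ i, c.2 i = true ↔ inner ℝ (Z i).1 (e₁ d) = ε / 2

/-- The jump law for a prescribed set of contacts. -/
def scatterPattern (ε : ℝ) (c : ContactPattern s) (Z : Conf d s) : Conf d s := fun i =>
  ((Z i).1, (Z i).2
      - (∑ j, if c.1 i j then
          ((1 / ε ^ 2) * inner ℝ ((Z i).2 - (Z j).2) ((Z i).1 - (Z j).1)) • ((Z i).1 - (Z j).1)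
          else 0)
      - (if c.2 i then (2 * inner ℝ (Z i).2 (e₁ d)) • e₁ d else 0))

lemma HasPattern.scatter_eq {c : ContactPattern s} {Z : Conf d s} (h : HasPattern ε c Z) :
    scatter ε Z = scatterPattern ε c Z := by
  classical
  funext i
  ext1
  · rfl
  · rw [scatter_snd]
    simp only [scatterPattern]
    congr 1
    · congr 1
      refine Finset.sum_congr rfl fun j _ => ?_
      by_cases hc : i ≠ j ∧ ‖(Z i).1 - (Z j).1‖ = ε
      · rw [if_pos hc, if_pos ((h.1 i j).2 hc)]
      · rw [if_neg hc, if_neg (fun h' => hc ((h.1 i j).1 h'))]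
    · by_cases hc : inner ℝ (Z i).1 (e₁ d) = ε / 2
      · simp [hc, (h.2 i).2 hc]
      · simp [hc, (h.2 i)]

lemma exists_hasPattern (Z : Conf d s) : ∃ c, HasPattern ε c Z := by
  classical
  exact ⟨(fun i j => decide (i ≠ j ∧ ‖(Z i).1 - (Z j).1‖ = ε),
    fun i => decide (inner ℝ (Z i).1 (e₁ d) = ε / 2)), by simp, by simp⟩

lemma contDiff_scatterPattern (c : ContactPattern s) :
    ContDiff ℝ 1 (scatterPattern ε c : Conf d s → Conf d s) := by
  have h1 : ∀ i : Fin s, ContDiff ℝ 1 fun Z : Conf d s => (Z i).1 := fun i =>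
    contDiff_fst.comp (contDiff_apply ℝ (E d × E d) i)
  have h2 : ∀ i : Fin s, ContDiff ℝ 1 fun Z : Conf d s => (Z i).2 := fun i =>
    contDiff_snd.comp (contDiff_apply ℝ (E d × E d) i)
  refine contDiff_pi.2 fun i => (h1 i).prodMk (ContDiff.sub (ContDiff.sub (h2 i) ?_) ?_)
  · refine ContDiff.sum fun j _ => ?_
    split_ifs
    · exact (contDiff_const.mul (((h2 i).sub (h2 j)).inner ℝ ((h1 i).sub (h1 j)))).smul
        ((h1 i).sub (h1 j))
    · exact contDiff_const
  · split_ifs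
    · exact (contDiff_const.mul ((h2 i).inner ℝ contDiff_const)).smul contDiff_const
    · exact contDiff_const

@[fun_prop]
lemma continuous_drift : Continuous fun p : ℝ × Conf d s => drift p.1 p.2 := by
  unfold drift
  fun_prop

lemma contDiff_drift : ContDiff ℝ 1 fun p : ℝ × Conf d s => drift p.1 p.2 := by
  have h1 : ∀ i : Fin s, ContDiff ℝ 1 fun p : ℝ × Conf d s => p.2 i := fun i =>
    (contDiff_apply ℝ (E d × E d) i).comp contDiff_snd
  refine contDiff_pi.2 fun i => ContDiff.prodMk ?_ (contDiff_snd.comp (h1 i))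
  exact (contDiff_fst.comp (h1 i)).add (contDiff_fst.smul (contDiff_snd.comp (h1 i)))

/-- Prescribing the contacts that occur is a closed condition and prescribing those that do not is
an open one; both are σ-compact in a finite-dimensional space. -/
lemma isSigmaCompact_hasPattern (c : ContactPattern s) :
    IsSigmaCompact {Z : Conf d s | HasPattern ε c Z} := by
  have : {Z : Conf d s | HasPattern ε c Z} =
      ({Z | ∀ i j, c.1 i j = true → i ≠ j ∧ ‖(Z i).1 - (Z j).1‖ = ε} ∩
        {Z | ∀ i, c.2 i = true → inner ℝ (Z i).1 (e₁ d) = ε / 2}) ∩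
      ({Z | ∀ i j, i ≠ j → c.1 i j = false → ‖(Z i).1 - (Z j).1‖ ≠ ε} ∩
        {Z | ∀ i, c.2 i = false → inner ℝ (Z i).1 (e₁ d) ≠ ε / 2}) := by
    ext Z
    simp only [HasPattern, mem_ofPred_eq, mem_inter_iff]
    constructor
    · rintro ⟨h1, h2⟩
      refine ⟨⟨fun i j => (h1 i j).1, fun i => (h2 i).1⟩, fun i j hij hc h => ?_, fun i hc h => ?_⟩
      · rw [(h1 i j).2 ⟨hij, h⟩] at hc; simp at hc
      · rw [(h2 i).2 h] at hc; simp at hc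
    · rintro ⟨⟨h1, h2⟩, h3, h4⟩
      refine ⟨fun i j => ⟨h1 i j, fun h => ?_⟩, fun i => ⟨h2 i, fun h => ?_⟩⟩
      · by_contra hc; exact h3 i j h.1 (by simpa using hc) h.2
      · by_contra hc; exact h4 i (by simpa using hc) h
  rw [this]
  refine isSigmaCompact_inter (isSigmaCompact_of_isClosed (IsClosed.inter ?_ ?_))
    (isSigmaCompact_of_isOpen (IsOpen.inter ?_ ?_))
  · simp only [ofPred_forall]
    refine isClosed_iInter fun i => isClosed_iInter fun j => isClosed_iInter fun _ => ?_
    by_cases hij : i ≠ j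
    · simp only [hij, ne_eq, not_false_eq_true, true_and]
      exact isClosed_eq (by fun_prop) continuous_const
    · simp only [hij, false_and]
      exact isClosed_empty
  · simp only [ofPred_forall]
    refine isClosed_iInter fun i => isClosed_iInter fun _ => isClosed_eq (by fun_prop)
      continuous_const
  · simp only [ofPred_forall]
    refine isOpen_iInter_of_finite fun i => isOpen_iInter_of_finite fun j =>
      isOpen_iInter_of_finite fun _ => isOpen_iInter_of_finite fun _ =>
      isOpen_ne_fun (by fun_prop) continuous_const
  · simp only [ofPred_forall]
    exact isOpen_iInter_of_finite fun i => isOpen_iInter_of_finite fun _ =>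
      isOpen_ne_fun (by fun_prop) continuous_const

lemma isClosed_phaseSpace (ε : ℝ) : IsClosed (phaseSpace d ε s) := by
  have : phaseSpace d ε s = {Z | ∀ i, ε / 2 ≤ inner ℝ (Z i).1 (e₁ d)} ∩
      {Z | ∀ i j, i ≠ j → ε ≤ ‖(Z i).1 - (Z j).1‖} := rfl
  rw [this]
  simp only [ofPred_forall]
  refine IsClosed.inter ?_ ?_
  · exact isClosed_iInter fun i => isClosed_le continuous_const (by fun_prop)
  · exact isClosed_iInter fun i => isClosed_iInter fun j => isClosed_iInter fun _ =>
      isClosed_le continuous_const (by fun_prop)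

lemma isOpen_nonPathological (ε : ℝ) : IsOpen {Z : Conf d s | NonPathological ε Z} := by
  have : {Z : Conf d s | NonPathological ε Z} = ⋂ i, ⋂ j, ⋂ (_ : i ≠ j),
      ({Z | ‖(Z i).1 - (Z j).1‖ = ε} ∩ ({Z | inner ℝ (Z i).1 (e₁ d) = ε / 2} ∪
        ⋃ k, ⋃ (_ : i ≠ k ∧ k ≠ j), {Z | ‖(Z i).1 - (Z k).1‖ = ε}))ᶜ := by
    ext Z
    simp only [NonPathological, mem_ofPred_eq, mem_iInter, mem_compl_iff, mem_inter_iff, mem_union,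
      mem_iUnion, not_and, not_or, not_exists, exists_prop]
    refine forall_congr' fun i => forall_congr' fun j => forall_congr' fun _ =>
      forall_congr' fun _ => and_congr_right fun _ => forall_congr' fun k => ?_
    tauto
  rw [this]
  refine isOpen_iInter_of_finite fun i => isOpen_iInter_of_finite fun j =>
    isOpen_iInter_of_finite fun _ => IsClosed.isOpen_compl (self := ?_)
  refine IsClosed.inter (isClosed_eq (by fun_prop) continuous_const) (IsClosed.union
    (isClosed_eq (by fun_prop) continuous_const) ?_)
  exact isClosed_iUnion_of_finite fun k => isClosed_iUnion_of_finite fun _ =>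
    isClosed_eq (by fun_prop) continuous_const

/-- Rescaling time to [0,1] makes the time parameter compact. Staying in the phase space is then an
intersection of closed conditions, while the arcs meeting a pathological configuration form the
projection, along a compact factor, of a closed set, hence a closed set. -/
lemma isSigmaCompact_freeArc (ε : ℝ) :
    IsSigmaCompact {p : ℝ × Conf d s | 0 < p.1 ∧ FreeArc ε p.1 p.2} := by
  let F : Icc (0 : ℝ) 1 × (ℝ × Conf d s) → Conf d s := fun q => drift (q.1 * q.2.1) q.2.2
  have hF : Continuous F :=
    continuous_drift.comp (g := fun p : ℝ × Conf d s => drift p.1 p.2)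
      (f := fun q : Icc (0 : ℝ) 1 × (ℝ × Conf d s) => ((q.1 : ℝ) * q.2.1, q.2.2)) (by fun_prop)
  have : {p : ℝ × Conf d s | 0 < p.1 ∧ FreeArc ε p.1 p.2} = {p | 0 < p.1} ∩
      ({p | ∀ x : Icc (0 : ℝ) 1, F (x, p) ∈ phaseSpace d ε s} ∩
        (Prod.snd '' (F ⁻¹' {Z | NonPathological ε Z}ᶜ))ᶜ) := by
    ext p
    simp only [mem_ofPred_eq, mem_inter_iff, mem_compl_iff, mem_image, mem_preimage, not_exists]
    refine and_congr_right fun hp => ?_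
    constructor
    · intro h
      refine ⟨fun x => (h _ ⟨mul_nonneg x.2.1 hp.le, ?_⟩).1, ?_⟩
      · nlinarith [x.2.2]
      · rintro ⟨x, q⟩ ⟨h1, rfl⟩
        refine h1 (h _ ⟨mul_nonneg x.2.1 hp.le, ?_⟩).2
        nlinarith [x.2.2]
    · rintro ⟨h1, h2⟩ r hr
      have hx : r / p.1 ∈ Icc (0 : ℝ) 1 := ⟨div_nonneg hr.1 hp.le, (div_le_one hp).2 hr.2⟩
      have hF' : F (⟨r / p.1, hx⟩, p) = drift r p.2 := by
        simp only [F]; rw [div_mul_cancel₀ _ hp.ne']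
      refine ⟨hF' ▸ h1 ⟨r / p.1, hx⟩, ?_⟩
      by_contra h3
      exact h2 (⟨r / p.1, hx⟩, p) ⟨by rw [hF']; exact h3, rfl⟩
  rw [this]
  refine isSigmaCompact_inter (isSigmaCompact_of_isOpen (isOpen_lt continuous_const continuous_fst))
    (isSigmaCompact_inter (isSigmaCompact_of_isClosed ?_) (isSigmaCompact_of_isOpen
      (IsClosed.isOpen_compl (self := ?_))))
  · simp only [ofPred_forall]
    exact isClosed_iInter fun x => (isClosed_phaseSpace ε).preimage
      (hF.comp (Continuous.prodMk continuous_const continuous_id))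
  · exact isClosedMap_snd_of_compactSpace _
      ((isOpen_nonPathological ε).isClosed_compl.preimage hF)

/-- The graph of the flow with at most `n` free flights. -/
def reachSet (d s : ℕ) [NeZero d] (ε : ℝ) : ℕ → Set (ℝ × Conf d s × Conf d s)
  | 0 => {p | p.1 = 0 ∧ p.2.1 = p.2.2}
  | n + 1 => {p | ∃ a, (0 < a ∧ FreeArc ε a p.2.1) ∧
      (p.1 - a, scatter ε (drift a p.2.1), p.2.2) ∈ reachSet d s ε n}

lemma setOf_reach (ε : ℝ) : {p : ℝ × Conf d s × Conf d s | Reach ε p.1 p.2.1 p.2.2} =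
    ⋃ n, reachSet d s ε n := by
  ext ⟨t, Z, W⟩
  simp only [mem_ofPred_eq, mem_iUnion]
  constructor
  · intro h
    induction h with
    | nil => exact ⟨0, by simp [reachSet]⟩
    | @cons a t Z W ha hf _ ih =>
      obtain ⟨n, hn⟩ := ih
      exact ⟨n + 1, a, ⟨ha, hf⟩, by simpa using hn⟩
  · rintro ⟨n, hn⟩
    induction n generalizing t Z with
    | zero =>
      obtain ⟨h1, h2⟩ := hn
      simp only at h1 h2
      rw [h1, h2]
      exact Reach.nil _
    | succ n ih =>
      obtain ⟨a, ⟨ha, hf⟩, h⟩ := hn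
      have := Reach.cons ha hf (ih _ _ h)
      simpa using this

/-- The jump law is discontinuous, but on each of the finitely many contact patterns it coincides
with the continuous `scatterPattern`. Adding a flight is then a finite union of projections along
the flight time. -/
lemma isSigmaCompact_reachSet (ε : ℝ) (n : ℕ) : IsSigmaCompact (reachSet d s ε n) := by
  induction n with
  | zero =>
    apply isSigmaCompact_of_isClosed
    exact (isClosed_eq continuous_fst continuous_const).inter
      (isClosed_eq (by fun_prop) (by fun_prop))
  | succ n ih =>
    let Q : ContactPattern s → Set (ℝ × ℝ × Conf d s × Conf d s) := fun c =>
      ((fun q => (q.1, q.2.2.1)) ⁻¹' {p : ℝ × Conf d s | 0 < p.1 ∧ FreeArc ε p.1 p.2}) ∩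
        (((fun q => drift q.1 q.2.2.1) ⁻¹' {Z : Conf d s | HasPattern ε c Z}) ∩
        ((fun q => (q.2.1 - q.1, scatterPattern ε c (drift q.1 q.2.2.1), q.2.2.2)) ⁻¹'
          reachSet d s ε n))
    have h : reachSet d s ε (n + 1) = ⋃ c, Prod.snd '' Q c := by
      ext p
      simp only [reachSet, mem_ofPred_eq, mem_iUnion, mem_image]
      constructor
      · rintro ⟨a, h1, h2⟩
        obtain ⟨c, hc⟩ := exists_hasPattern (ε := ε) (drift a p.2.1)
        refine ⟨c, (a, p), ⟨h1, hc, ?_⟩, rfl⟩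
        rw [hc.scatter_eq] at h2
        exact h2
      · rintro ⟨c, ⟨a, p⟩, ⟨h1, h2, h3⟩, rfl⟩
        refine ⟨a, h1, ?_⟩
        have h2' : HasPattern ε c (drift a p.2.1) := h2
        rw [h2'.scatter_eq]
        exact h3
    rw [h]
    have hd : Continuous fun q : ℝ × ℝ × Conf d s × Conf d s => drift q.1 q.2.2.1 :=
      continuous_drift.comp (g := fun p : ℝ × Conf d s => drift p.1 p.2)
        (f := fun q : ℝ × ℝ × Conf d s × Conf d s => (q.1, q.2.2.1)) (by fun_prop)
    refine isSigmaCompact_iUnion _ fun c => IsSigmaCompact.image continuous_snd ?_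
    refine isSigmaCompact_inter (isSigmaCompact_preimage (by fun_prop) (isSigmaCompact_freeArc ε))
      (isSigmaCompact_inter (isSigmaCompact_preimage hd (isSigmaCompact_hasPattern c))
        (isSigmaCompact_preimage ?_ ih))
    have hs := (contDiff_scatterPattern (d := d) (ε := ε) c).continuous.comp hd
    exact Continuous.prodMk (by fun_prop) (Continuous.prodMk hs (by fun_prop))

lemma isSigmaCompact_reach (ε : ℝ) :
    IsSigmaCompact {p : ℝ × Conf d s × Conf d s | Reach ε p.1 p.2.1 p.2.2} := by
  rw [setOf_reach]
  exact isSigmaCompact_iUnion _ fun n => isSigmaCompact_reachSet ε n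

lemma measurableSet_reach_forward (ε : ℝ) {C : Set (Conf d s)} (hC : IsClosed C) :
    MeasurableSet {p : ℝ × Conf d s | ∃ W ∈ C, Reach ε p.1 p.2 W} := by
  apply measurableSet_of_isSigmaCompact
  have : {p : ℝ × Conf d s | ∃ W ∈ C, Reach ε p.1 p.2 W} =
      (fun q : ℝ × Conf d s × Conf d s => (q.1, q.2.1)) ''
        ({q | Reach ε q.1 q.2.1 q.2.2} ∩ {q | q.2.2 ∈ C}) := by
    ext ⟨t, Z⟩
    simp only [mem_ofPred_eq, mem_image, mem_inter_iff, Prod.exists, Prod.mk.injEq]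
    constructor
    · rintro ⟨W, h1, h2⟩; exact ⟨t, Z, W, ⟨h2, h1⟩, rfl, rfl⟩
    · rintro ⟨t', Z', W, ⟨h2, h1⟩, rfl, rfl⟩; exact ⟨W, h1, h2⟩
  rw [this]
  exact (isSigmaCompact_inter (isSigmaCompact_reach ε) (isSigmaCompact_of_isClosed
    (hC.preimage (f := fun q : ℝ × Conf d s × Conf d s => q.2.2) (by fun_prop)))).image
      (by fun_prop)

lemma measurableSet_reach_backward (ε : ℝ) {C : Set (Conf d s)} (hC : IsClosed C) :
    MeasurableSet {p : ℝ × Conf d s | ∃ W ∈ C, Reach ε p.1 W p.2} := by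
  apply measurableSet_of_isSigmaCompact
  have : {p : ℝ × Conf d s | ∃ W ∈ C, Reach ε p.1 W p.2} =
      (fun q : ℝ × Conf d s × Conf d s => (q.1, q.2.2)) ''
        ({q | Reach ε q.1 q.2.1 q.2.2} ∩ {q | q.2.1 ∈ C}) := by
    ext ⟨t, Z⟩
    simp only [mem_ofPred_eq, mem_image, mem_inter_iff, Prod.exists, Prod.mk.injEq]
    constructor
    · rintro ⟨W, h1, h2⟩; exact ⟨t, W, Z, ⟨h2, h1⟩, rfl, rfl⟩
    · rintro ⟨t', Z', W, ⟨h2, h1⟩, rfl, rfl⟩; exact ⟨Z', h1, h2⟩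
  rw [this]
  exact (isSigmaCompact_inter (isSigmaCompact_reach ε) (isSigmaCompact_of_isClosed
    (hC.preimage (f := fun q : ℝ × Conf d s × Conf d s => q.2.1) (by fun_prop)))).image
      (by fun_prop)

lemma measurableSet_globalSet (hε : 0 < ε) : MeasurableSet (globalSet d s ε) := by
  have : globalSet d s ε = ⋂ m : ℕ,
      ((fun Z => ((m : ℝ), Z)) ⁻¹' {p : ℝ × Conf d s | ∃ W ∈ univ, Reach ε p.1 p.2 W}) ∩
      ((fun Z => ((m : ℝ), Z)) ⁻¹' {p : ℝ × Conf d s | ∃ W ∈ univ, Reach ε p.1 W p.2}) := by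
    ext Z
    have := exists_isTrajectory_iff hε (Z := Z)
    simp only [globalSet, mem_ofPred_eq, this, mem_iInter, mem_inter_iff, mem_preimage, mem_univ,
      true_and]
  rw [this]
  exact MeasurableSet.iInter fun m =>
    ((measurableSet_reach_forward ε isClosed_univ).preimage (by fun_prop)).inter
      ((measurableSet_reach_backward ε isClosed_univ).preimage (by fun_prop))

lemma measurable_scatter (ε : ℝ) : Measurable (scatter ε : Conf d s → Conf d s) := by
  refine measurable_of_isClosed fun C hC => ?_
  have : scatter ε ⁻¹' C = ⋃ c : ContactPattern s,
      {Z : Conf d s | HasPattern ε c Z} ∩ scatterPattern ε c ⁻¹' C := by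
    ext Z
    simp only [mem_preimage, mem_iUnion, mem_inter_iff, mem_ofPred_eq]
    constructor
    · intro h
      obtain ⟨c, hc⟩ := exists_hasPattern (ε := ε) Z
      exact ⟨c, hc, by rwa [← hc.scatter_eq]⟩
    · rintro ⟨c, hc, h⟩
      rwa [hc.scatter_eq]
  rw [this]
  exact MeasurableSet.iUnion fun c =>
    (measurableSet_of_isSigmaCompact (isSigmaCompact_hasPattern c)).inter
      (hC.preimage (contDiff_scatterPattern c).continuous).measurableSet

/-- The set of configurations on which the hard sphere flow is defined. -/
def flowDomain (d s : ℕ) [NeZero d] (ε : ℝ) : Set (Conf d s) := {Z | ∃ γ, IsTrajectoryFrom ε Z γ}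

lemma flowDomain_eq (hε : 0 < ε) :
    flowDomain d s ε = globalSet d s ε ∪ scatter ε ⁻¹' globalSet d s ε := by
  ext Z
  exact exists_isTrajectoryFrom_iff hε

lemma measurableSet_flowDomain (hε : 0 < ε) : MeasurableSet (flowDomain d s ε) := by
  rw [flowDomain_eq hε]
  exact (measurableSet_globalSet hε).union ((measurableSet_globalSet hε).preimage
    (measurable_scatter ε))

/-- `Reach` is empty for negative times, so at most one alternative is effective when t ≠ 0.
Determinism in both directions identifies the reached configuration with the value of the flow, and
preimages under the flow become statements about `Reach`. -/
lemma hsFlow_of_mem (hε : 0 < ε) {Z Y : Conf d s} (hY : Y ∈ globalSet d s ε)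
    (h : Z = Y ∨ scatter ε Z = Y) (t : ℝ) (C : Set (Conf d s)) : hsFlow ε t Z ∈ C ↔
      (∃ W ∈ C, Reach ε t Y W) ∨ ∃ W ∈ C, Reach ε (-t) W Y := by
  obtain ⟨γ, h1, rfl⟩ := hY
  have h2 : IsTrajectoryFrom ε Z γ := by
    rcases h with h | h
    · exact ⟨h1, Or.inl h.symm⟩
    · refine ⟨h1, Or.inr ?_⟩
      have := h1.left_state hε 0
      have hZ : NonPathological ε Z := nonPathological_congr (fun i => by rw [← h]; rfl) (h1.1 0).2
      rw [← h, scatter_scatter hε hZ] at this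
      simpa using this
  rw [hsFlow_eq hε h2]
  constructor
  · intro h3
    rcases le_total 0 t with ht | ht
    · exact Or.inl ⟨_, h3, by simpa using h1.reach hε ht⟩
    · exact Or.inr ⟨_, h3, by simpa using h1.reach hε ht⟩
  · rintro (⟨W, h3, h4⟩ | ⟨W, h3, h4⟩)
    · have h5 := h1.reach hε h4.nonneg
      rw [sub_zero] at h5
      rwa [h5.unique hε h4]
    · have h5 := h1.reach hε (show t ≤ 0 by linarith [h4.nonneg])
      rw [zero_sub] at h5
      rwa [h5.unique_left hε h4]

lemma measurable_hsFlow (hε : 0 < ε) :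
    Measurable fun p : ℝ × Conf d s => hsFlow ε p.1 p.2 := by
  classical
  refine measurable_of_isClosed fun C hC => ?_
  let S : Set (ℝ × Conf d s) := {p | ∃ W ∈ C, Reach ε p.1 p.2 W} ∪
    (fun p : ℝ × Conf d s => (-p.1, p.2)) ⁻¹' {p | ∃ W ∈ C, Reach ε p.1 W p.2}
  have hS : MeasurableSet S := (measurableSet_reach_forward ε hC).union
    ((measurableSet_reach_backward ε hC).preimage (by fun_prop))
  let G : Set (ℝ × Conf d s) := Prod.snd ⁻¹' globalSet d s ε
  have hG : MeasurableSet G := (measurableSet_globalSet hε).preimage measurable_snd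
  let φ : ℝ × Conf d s → ℝ × Conf d s := fun p => (p.1, scatter ε p.2)
  have hφ : Measurable φ := measurable_fst.prodMk ((measurable_scatter ε).comp measurable_snd)
  -- Three regions: configurations through which a trajectory passes, those that are only incoming
  -- states of a trajectory, and those outside the domain, where the flow is the identity by
  -- convention.
  have : (fun p : ℝ × Conf d s => hsFlow ε p.1 p.2) ⁻¹' C =
      (G ∩ S) ∪ (Gᶜ ∩ (φ ⁻¹' G ∩ φ ⁻¹' S)) ∪ (Gᶜ ∩ ((φ ⁻¹' G)ᶜ ∩ Prod.snd ⁻¹' C)) := by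
    ext ⟨t, Z⟩
    by_cases h1 : Z ∈ globalSet d s ε
    · have := hsFlow_of_mem hε h1 (Or.inl rfl) t C
      simp [G, S, φ, h1, this]
    · by_cases h2 : scatter ε Z ∈ globalSet d s ε
      · have := hsFlow_of_mem hε h2 (Or.inr rfl) t C
        simp [G, S, φ, h1, h2, this]
      · have h3 : ¬∃ γ, IsTrajectoryFrom ε Z γ := by
          rw [exists_isTrajectoryFrom_iff hε]; tauto
        simp [G, S, φ, h1, h2, hsFlow, h3]
  rw [this]
  exact ((hG.inter hS).union (hG.compl.inter ((hφ hG).inter (hφ hS)))).union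
    (hG.compl.inter ((hφ hG).compl.inter (hC.measurableSet.preimage measurable_snd)))

end Flow

/-! ### The hard sphere flow preserves null sets -/

section NullSets

instance isAddHaarMeasure_volume_prod {X Y : Type*} [AddGroup X] [TopologicalSpace X]
    [MeasureSpace X] [AddGroup Y] [TopologicalSpace Y] [MeasureSpace Y] [MeasurableAdd X]
    [MeasurableAdd Y] [SFinite (volume : Measure X)] [SFinite (volume : Measure Y)]
    [(volume : Measure X).IsAddHaarMeasure] [(volume : Measure Y).IsAddHaarMeasure] :
    (volume : Measure (X × Y)).IsAddHaarMeasure :=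
  Measure.prod.instIsAddHaarMeasure volume volume

instance sigmaFinite_volume_conf (d s : ℕ) : SigmaFinite (volume : Measure (Conf d s)) :=
  @Measure.pi.sigmaFinite (Fin s) (fun _ => E d × E d) _ _ (fun _ => volume)
    (fun _ => Measure.prod.instSigmaFinite)

instance isAddHaarMeasure_volume_conf (d s : ℕ) : (volume : Measure (Conf d s)).IsAddHaarMeasure :=
  @Measure.pi.isAddHaarMeasure (Fin s) (fun _ => E d × E d) _ _ (fun _ => volume)
    (fun _ => inferInstance) _ _ (fun _ => isAddHaarMeasure_volume_prod) _

instance isLocallyFiniteMeasure_volume_conf (d s : ℕ) :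
    IsLocallyFiniteMeasure (volume : Measure (Conf d s)) :=
  isLocallyFiniteMeasure_of_isFiniteMeasureOnCompacts

lemma isAddHaarMeasure_conf_prod (d s : ℕ) : ((volume : Measure (ℝ × Conf d s)).prod
    (volume : Measure (E d × E d))).IsAddHaarMeasure := by
  have h1 : (volume : Measure (ℝ × Conf d s)).IsAddHaarMeasure := inferInstance
  have h2 : (volume : Measure (E d × E d)).IsAddHaarMeasure := inferInstance
  have h3 : SFinite (volume : Measure (ℝ × Conf d s)) := inferInstance
  have h4 : SFinite (volume : Measure (E d × E d)) := inferInstance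
  have h5 : MeasurableAdd (ℝ × Conf d s) := inferInstance
  have h6 : MeasurableAdd (E d × E d) := inferInstance
  exact @Measure.prod.instIsAddHaarMeasure _ _ _ _ _ _ _ _ _ _ h1 h2 h3 h4 h5 h6

instance sFinite_phaseMeasure (d : ℕ) [NeZero d] (ε : ℝ) (s : ℕ) : SFinite (phaseMeasure d ε s) := by
  unfold phaseMeasure; infer_instance

instance isLocallyFiniteMeasure_phaseMeasure (d : ℕ) [NeZero d] (ε : ℝ) (s : ℕ) :
    IsLocallyFiniteMeasure (phaseMeasure d ε s) := by
  unfold phaseMeasure; infer_instance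

/-- A linear identification of the two spaces reduces this to the fact that differentiable maps of a
finite-dimensional space into itself send null sets to null sets. No injectivity is needed. -/
lemma null_image {F G : Type*} [NormedAddCommGroup F] [NormedSpace ℝ F] [FiniteDimensional ℝ F]
    [MeasurableSpace F] [BorelSpace F] [NormedAddCommGroup G] [NormedSpace ℝ G]
    [FiniteDimensional ℝ G] [MeasurableSpace G] [BorelSpace G] (μ : Measure F) [μ.IsAddHaarMeasure]
    (ν : Measure G) [ν.IsAddHaarMeasure] (hFG : Module.finrank ℝ F = Module.finrank ℝ G)
    {f : F → G} {A : Set F} (hf : ∀ x ∈ A, DifferentiableAt ℝ f x) (hA : μ A = 0) :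
    ν (f '' A) = 0 := by
  let e : G ≃L[ℝ] F := ContinuousLinearEquiv.ofFinrankEq hFG.symm
  have h1 : μ ((e ∘ f) '' A) = 0 :=
    addHaar_image_eq_zero_of_differentiableOn_of_addHaar_eq_zero μ (fun x hx =>
      (e.differentiableAt.comp x (hf x hx)).differentiableWithinAt) hA
  have h2 : ν.map e ≪ μ := Measure.absolutelyContinuous_isAddHaarMeasure _ _
  have h3 := h2 h1
  rw [show (⇑e) = e.toHomeomorph.toMeasurableEquiv from rfl, MeasurableEquiv.map_apply] at h3
  convert h3 using 2
  rw [image_comp]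
  exact (preimage_image_eq _ e.injective).symm

/-! ### Contact times as roots of a quadratic equation -/

section Roots

variable {V : Type*} [NormedAddCommGroup V] [InnerProductSpace ℝ V] {ε : ℝ}

/-- The discriminant of the equation `‖x + τ w‖ = ε` for `τ`. -/
def hitDisc (ε : ℝ) (x w : V) : ℝ := inner ℝ w x ^ 2 - ‖w‖ ^ 2 * (‖x‖ ^ 2 - ε ^ 2)

/-- The roots `τ` of `‖x + τ w‖ = ε`, for `σ = ±1`. -/
def hitTime (ε σ : ℝ) (x w : V) : ℝ := (-inner ℝ w x + σ * √(hitDisc ε x w)) / ‖w‖ ^ 2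

lemma norm_pos_of_hitDisc_pos {x w : V} (h : 0 < hitDisc ε x w) : ‖w‖ ^ 2 ≠ 0 := by
  intro h0
  have hw : w = 0 := by simpa using h0
  simp [hitDisc, hw] at h

/-- At a solution c the discriminant is the square of ⟨w, x + c w⟩, so transversality makes it
positive, and the sign of that inner product selects the root. Positivity is also what makes the
root a differentiable function of x and w. -/
lemma eq_hitTime {x w : V} {c : ℝ} (h1 : ‖x + c • w‖ = ε) (h2 : inner ℝ w (x + c • w) ≠ (0 : ℝ)) :
    0 < hitDisc ε x w ∧ ∃ b : Bool, c = hitTime ε (if b then 1 else -1) x w := by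
  have h3 : ‖x‖ ^ 2 + 2 * (c * inner ℝ w x) + c ^ 2 * ‖w‖ ^ 2 = ε ^ 2 := by
    rw [← h1, norm_add_sq_real, inner_smul_right, real_inner_comm x w, norm_smul, mul_pow,
      Real.norm_eq_abs, sq_abs]
  rw [inner_add_right, inner_smul_right, real_inner_self_eq_norm_sq] at h2
  have h4 : hitDisc ε x w = (inner ℝ w x + c * ‖w‖ ^ 2) ^ 2 := by
    rw [hitDisc, ← h3]; ring
  have hD : 0 < hitDisc ε x w := by rw [h4]; positivity
  have hw := norm_pos_of_hitDisc_pos hD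
  refine ⟨hD, ?_⟩
  rcases lt_or_gt_of_ne h2 with h5 | h5
  · refine ⟨false, ?_⟩
    rw [hitTime, h4, Real.sqrt_sq_eq_abs, abs_of_neg h5, eq_div_iff hw]
    simp
  · refine ⟨true, ?_⟩
    rw [hitTime, h4, Real.sqrt_sq_eq_abs, abs_of_pos h5, eq_div_iff hw]
    simp

lemma differentiableAt_hitTime {F : Type*} [NormedAddCommGroup F] [NormedSpace ℝ F] {f g : F → V}
    {z : F} (hf : DifferentiableAt ℝ f z) (hg : DifferentiableAt ℝ g z) (σ : ℝ)
    (h : 0 < hitDisc ε (f z) (g z)) : DifferentiableAt ℝ (fun y => hitTime ε σ (f y) (g y)) z := by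
  have h1 : DifferentiableAt ℝ (fun y => hitDisc ε (f y) (g y)) z :=
    ((hg.inner ℝ hf).pow 2).sub ((hg.norm_sq ℝ).mul ((hf.norm_sq ℝ).sub_const _))
  have h2 : DifferentiableAt ℝ (fun y => ‖g y‖ ^ 2) z := hg.norm_sq ℝ
  have h4 : (fun y => ‖g y‖ ^ 2) z ≠ 0 := norm_pos_of_hitDisc_pos h
  have h3 : DifferentiableAt ℝ (fun y => -inner ℝ (g y) (f y) + σ * √(hitDisc ε (f y) (g y))) z :=
    ((hg.inner ℝ hf).neg).add ((h1.sqrt h.ne').const_mul σ)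
  have h5 := h3.fun_mul (h2.fun_inv h4)
  simpa only [hitTime, div_eq_mul_inv] using h5

end Roots

variable {d s : ℕ} [NeZero d] {ε : ℝ}

/-- The configurations reached in time `δ` from `N` with at most one jump. -/
def jumpImage (ε δ : ℝ) (N : Set (Conf d s)) : Set (Conf d s) :=
  {Z | ∃ W ∈ N, Z = drift δ W ∨ ∃ c, Z = drift (δ - c) (scatter ε (drift c W))}

lemma differentiable_fst_apply (i : Fin s) : Differentiable ℝ fun Z : Conf d s => (Z i).1 :=
  differentiable_fst.comp (differentiable_apply i)

lemma differentiable_snd_apply (i : Fin s) : Differentiable ℝ fun Z : Conf d s => (Z i).2 :=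
  differentiable_snd.comp (differentiable_apply i)

lemma differentiableAt_drift {F : Type*} [NormedAddCommGroup F] [NormedSpace ℝ F] {f : F → ℝ}
    {g : F → Conf d s} {z : F} (hf : DifferentiableAt ℝ f z) (hg : DifferentiableAt ℝ g z) :
    DifferentiableAt ℝ (fun y => drift (f y) (g y)) z := by
  have h1 : Differentiable ℝ fun p : ℝ × Conf d s => drift p.1 p.2 :=
    contDiff_drift.differentiable one_ne_zero
  exact (h1 (f z, g z)).comp z (hf.prodMk hg)

lemma differentiable_scatterPattern (c : ContactPattern s) :
    Differentiable ℝ (scatterPattern ε c : Conf d s → Conf d s) :=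
  (contDiff_scatterPattern c).differentiable one_ne_zero

lemma drift_sub (c : ℝ) (W : Conf d s) (i j : Fin s) : (drift c W i).1 - (drift c W j).1 =
    ((W i).1 - (W j).1) + c • ((W i).2 - (W j).2) := by
  simp only [drift_fst]; module

/-- A nontrivial jump occurs at a transversal contact, whose time is one of finitely many
differentiable functions of the starting configuration: a root of a quadratic for a pair, a quotient
for the wall. With the finitely many contact patterns this covers the set by finitely many
differentiable images of null sets. -/
lemma volume_jumpImage (δ : ℝ) {N : Set (Conf d s)} (hN : volume N = 0) :
    volume (jumpImage ε δ N) = 0 := by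
  classical
  let f1 : ContactPattern s → Fin s → Fin s → Bool → Conf d s → Conf d s := fun c i j b W =>
    drift (δ - hitTime ε (if b then 1 else -1) ((W i).1 - (W j).1) ((W i).2 - (W j).2))
      (scatterPattern ε c (drift (hitTime ε (if b then 1 else -1) ((W i).1 - (W j).1)
        ((W i).2 - (W j).2)) W))
  let f2 : ContactPattern s → Fin s → Conf d s → Conf d s := fun c i W =>
    drift (δ - (ε / 2 - inner ℝ (W i).1 (e₁ d)) / inner ℝ (W i).2 (e₁ d))
      (scatterPattern ε c (drift ((ε / 2 - inner ℝ (W i).1 (e₁ d)) / inner ℝ (W i).2 (e₁ d)) W))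
  have hsub : jumpImage ε δ N ⊆ (drift δ '' N) ∪
      ((⋃ c, ⋃ i, ⋃ j, ⋃ b, f1 c i j b ''
        (N ∩ {W | 0 < hitDisc ε ((W i).1 - (W j).1) ((W i).2 - (W j).2)})) ∪
      (⋃ c, ⋃ i, f2 c i '' (N ∩ {W | inner ℝ (W i).2 (e₁ d) ≠ (0 : ℝ)}))) := by
    rintro Z ⟨W, hW, rfl | ⟨t, rfl⟩⟩
    · exact Or.inl ⟨W, hW, rfl⟩
    by_cases hs : scatter ε (drift t W) = drift t W
    · left
      refine ⟨W, hW, ?_⟩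
      rw [hs, drift_drift, sub_add_cancel]
    right
    obtain ⟨c, hc⟩ := exists_hasPattern (ε := ε) (drift t W)
    -- Without a transversal contact the jump would be the identity, a case already settled.
    have h : (∃ i j, ‖(drift t W i).1 - (drift t W j).1‖ = ε ∧
        inner ℝ ((drift t W i).2 - (drift t W j).2) ((drift t W i).1 - (drift t W j).1) ≠ (0 : ℝ)) ∨
        ∃ i, inner ℝ (drift t W i).1 (e₁ d) = ε / 2 ∧
          inner ℝ (drift t W i).2 (e₁ d) ≠ (0 : ℝ) := by
      by_contra! h
      exact hs (scatter_eq_self (fun i j _ => h.1 i j) h.2)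
    rcases h with ⟨i, j, h1, h2⟩ | ⟨i, h1, h2⟩
    · left
      rw [drift_sub] at h1 h2
      obtain ⟨h3, b, h4⟩ := eq_hitTime h1 h2
      simp only [mem_iUnion]
      refine ⟨c, i, j, b, W, ⟨hW, h3⟩, ?_⟩
      simp only [f1]
      rw [← h4, hc.scatter_eq]
    · right
      simp only [mem_iUnion]
      refine ⟨c, i, W, ⟨hW, h2⟩, ?_⟩
      simp only [f2]
      simp only [drift_fst, drift_snd, inner_add_left, inner_smul_left, conj_trivial] at h1 h2
      have h4 : t = (ε / 2 - inner ℝ (W i).1 (e₁ d)) / inner ℝ (W i).2 (e₁ d) := by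
        rw [eq_div_iff h2]; linarith
      rw [← h4, hc.scatter_eq]
  refine measure_mono_null hsub (measure_union_null ?_ (measure_union_null ?_ ?_))
  · exact null_image (F := Conf d s) (G := Conf d s) volume volume rfl (fun W _ => differentiableAt_drift (by fun_prop)
      differentiableAt_id) hN
  · simp only [measure_iUnion_null_iff]
    intro c i j b
    refine null_image (F := Conf d s) (G := Conf d s) volume volume rfl (fun W hW => ?_) (measure_mono_null inter_subset_left hN)
    have h := differentiableAt_hitTime (ε := ε) (z := W)
      ((differentiable_fst_apply i W).sub (differentiable_fst_apply j W))
      ((differentiable_snd_apply i W).sub (differentiable_snd_apply j W)) (if b then 1 else -1) hW.2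
    exact differentiableAt_drift (h.const_sub δ) ((differentiable_scatterPattern c _).comp W
      (differentiableAt_drift h differentiableAt_id))
  · simp only [measure_iUnion_null_iff]
    intro c i
    refine null_image (F := Conf d s) (G := Conf d s) volume volume rfl (fun W hW => ?_) (measure_mono_null inter_subset_left hN)
    have h : DifferentiableAt ℝ (fun W : Conf d s =>
        (ε / 2 - inner ℝ (W i).1 (e₁ d)) / inner ℝ (W i).2 (e₁ d)) W := by
      simp only [div_eq_mul_inv]
      have h2 : (fun W : Conf d s => inner ℝ (W i).2 (e₁ d)) W ≠ (0 : ℝ) := hW.2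
      exact (((differentiable_fst_apply i W).inner ℝ (differentiableAt_const _)).const_sub _).fun_mul
        (((differentiable_snd_apply i W).inner ℝ (differentiableAt_const _)).fun_inv h2)
    exact differentiableAt_drift (h.const_sub δ) ((differentiable_scatterPattern c _).comp W
      (differentiableAt_drift h differentiableAt_id))

/-- On the ball around `c` the only possible jump is at time `c`. If it separates `a` from `b` in
the backward direction, the incoming and outgoing states exchange roles, which is legitimate because
the jump is an involution. -/
lemma IsTrajectory.mem_jumpImage (hε : 0 < ε) {γ : ℝ → Conf d s} (h : IsTrajectory ε γ) {c η : ℝ}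
    (h1 : ∀ r ∈ Ico c (c + η), γ r = drift (r - c) (γ c))
    (h2 : ∀ r ∈ Ioo (c - η) c, γ r = drift (r - c) (scatter ε (γ c))) {a b : ℝ}
    (ha : a ∈ Metric.ball c η) (hb : b ∈ Metric.ball c η) {N : Set (Conf d s)} (hN : γ a ∈ N) :
    γ b ∈ jumpImage ε (b - a) N := by
  rw [Real.ball_eq_Ioo] at ha hb
  refine ⟨γ a, hN, ?_⟩
  rcases lt_or_ge a c with hac | hac <;> rcases lt_or_ge b c with hbc | hbc
  · left
    rw [h2 a ⟨ha.1, hac⟩, h2 b ⟨hb.1, hbc⟩, drift_drift]; congr 1; ring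
  · right
    refine ⟨c - a, ?_⟩
    rw [h2 a ⟨ha.1, hac⟩, h1 b ⟨hbc, hb.2⟩, drift_drift]
    simp only [sub_add_sub_cancel, sub_self, drift_zero]
    rw [scatter_scatter hε (h.1 c).2]
    congr 1; ring
  · right
    refine ⟨c - a, ?_⟩
    rw [h1 a ⟨hac, ha.2⟩, h2 b ⟨hb.1, hbc⟩, drift_drift]
    simp only [sub_add_sub_cancel, sub_self, drift_zero]
    congr 1; ring
  · left
    rw [h1 a ⟨hac, ha.2⟩, h1 b ⟨hbc, hb.2⟩, drift_drift]; congr 1; ring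

/-- By a Lebesgue number argument, sufficiently short equal steps from time t to time 0 each stay in
a ball containing at most one jump. The number of steps depends on the trajectory, but it ranges
over a countable set, and this is all that the null set argument needs. -/
lemma IsTrajectory.mem_iterate_jumpImage (hε : 0 < ε) {γ : ℝ → Conf d s} (h : IsTrajectory ε γ)
    (t : ℝ) {N : Set (Conf d s)} (hN : γ t ∈ N) :
    ∃ n : ℕ, γ 0 ∈ (jumpImage ε (-t / (n + 1)))^[n + 1] N := by
  choose η hη h1 h2 using fun c => h.exists_radius hε c
  obtain ⟨δ, hδ, hball⟩ := lebesgue_number_lemma_of_metric (s := Icc (-|t|) |t|)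
    (c := fun c => Metric.ball c (η c)) isCompact_Icc (fun c => Metric.isOpen_ball)
    (fun c _ => mem_iUnion.2 ⟨c, Metric.mem_ball_self (hη c)⟩)
  obtain ⟨n, hn⟩ := exists_nat_gt (|t| / δ)
  refine ⟨n, ?_⟩
  have hn0 : (0 : ℝ) < n + 1 := by positivity
  have hstep : |-t / ((n : ℝ) + 1)| < δ := by
    rw [abs_div, abs_neg, abs_of_pos hn0, div_lt_iff₀ hn0]
    rw [div_lt_iff₀ hδ] at hn
    nlinarith
  have key : ∀ k : ℕ, k ≤ n + 1 →
      γ (t + k * (-t / (n + 1))) ∈ (jumpImage ε (-t / ((n : ℝ) + 1)))^[k] N := by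
    intro k
    induction k with
    | zero => intro _; simpa using hN
    | succ k ih =>
      intro hk
      rw [Function.iterate_succ_apply']
      have hmem : t + k * (-t / (n + 1)) ∈ Icc (-|t|) |t| := by
        rw [mem_Icc, ← abs_le]
        have hk' : (k : ℝ) ≤ n + 1 := by exact_mod_cast (Nat.le_succ k).trans hk
        -- The intermediate times lie between t and 0, hence in the interval covered by the Lebesgue
        -- number.
        have : t + k * (-t / (n + 1)) = t * ((n + 1 - k) / (n + 1)) := by field_simp; ring
        rw [this, abs_mul]
        refine mul_le_of_le_one_right (abs_nonneg _) ?_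
        rw [abs_of_nonneg (div_nonneg (by linarith) hn0.le), div_le_one hn0]
        linarith [show (0 : ℝ) ≤ k by positivity]
      obtain ⟨c, hc⟩ := hball _ hmem
      have h3 := h.mem_jumpImage hε (h1 c) (h2 c) (hc (Metric.mem_ball_self hδ))
        (b := t + (k + 1 : ℕ) * (-t / (n + 1))) (hc ?_) (ih (by omega))
      · convert h3 using 2
        push_cast; ring
      · rw [Metric.mem_ball, Real.dist_eq]
        convert hstep using 2
        push_cast; ring
  have := key (n + 1) le_rfl
  convert this using 2
  push_cast; field_simp; ring

lemma volume_trajectory_null (hε : 0 < ε) (t : ℝ) {N : Set (Conf d s)} (hN : volume N = 0) :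
    volume {Z : Conf d s | ∃ γ, IsTrajectory ε γ ∧ γ 0 = Z ∧ γ t ∈ N} = 0 := by
  have hk : ∀ (δ : ℝ) (k : ℕ), volume ((jumpImage ε δ)^[k] N) = 0 := by
    intro δ k
    induction k with
    | zero => exact hN
    | succ k ih => rw [Function.iterate_succ_apply']; exact volume_jumpImage _ ih
  refine measure_mono_null (t := ⋃ n : ℕ, (jumpImage ε (-t / (n + 1)))^[n + 1] N) ?_
    (measure_iUnion_null fun n => hk _ _)
  rintro Z ⟨γ, h, rfl, ht⟩
  obtain ⟨n, hn⟩ := h.mem_iterate_jumpImage hε t ht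
  exact mem_iUnion.2 ⟨n, hn⟩

end NullSets

/-! ### Traces on the collision surface -/

section Trace

variable {d s : ℕ} [NeZero d] {ε : ℝ}

@[simp] lemma adjoin_castSucc (Z : Conf d s) (x v : E d) (j : Fin s) :
    adjoin Z x v j.castSucc = Z j := by
  simp [adjoin]

@[simp] lemma adjoin_last (Z : Conf d s) (x v : E d) : adjoin Z x v (Fin.last s) = (x, v) := by
  simp [adjoin]

lemma ae_volumeIoiPow_neBot (n : ℕ) : NeBot (ae (Measure.volumeIoiPow n)) := by
  rw [ae_neBot]
  intro h
  have := Measure.volumeIoiPow_apply_Iio n ⟨1, by simp⟩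
  rw [h] at this
  simp only [Measure.coe_zero, Pi.zero_apply] at this
  have h2 := this.symm
  rw [ENNReal.ofReal_eq_zero] at h2
  have h3 : (0 : ℝ) < 1 ^ (n + 1) / (n + 1) := by positivity
  exact absurd h2 (not_le.2 h3)

/-- The sphere is a null set, so an almost sure property does not restrict to it. In polar
coordinates, Fubini gives for almost every direction a property valid for almost every radius, and
hence for at least one positive radius. -/
lemma ae_adjunction_of_ae {P : E d × E d → Prop} (h : ∀ᵐ z : E d × E d, P z) :
    ∀ᵐ p ∂(adjunctionMeasure d), ∃ ρ : ℝ, 0 < ρ ∧ P (ρ • (p.1 : E d), p.2) := by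
  -- polar coordinates in the first variable
  let n := Module.finrank ℝ (E d) - 1
  have h1 := Measure.measurePreserving_homeomorphUnitSphereProd (volume : Measure (E d))
  have h1' : MeasurePreserving (homeomorphUnitSphereProd (E d)).symm
      ((volume : Measure (E d)).toSphere.prod (Measure.volumeIoiPow n))
      (Measure.comap Subtype.val volume) :=
    h1.symm (homeomorphUnitSphereProd (E d)).toMeasurableEquiv
  have h2 : MeasurePreserving (Subtype.val : ({0}ᶜ : Set (E d)) → E d)
      (Measure.comap Subtype.val volume) (volume.restrict {0}ᶜ) :=
    measurePreserving_subtype_coe (measurableSet_singleton _).compl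
  have h3 : MeasurePreserving (Prod.map (Subtype.val ∘ (homeomorphUnitSphereProd (E d)).symm)
      (id : E d → E d))
      ((((volume : Measure (E d)).toSphere.prod (Measure.volumeIoiPow n))).prod volume)
      ((volume.restrict {0}ᶜ).prod volume) :=
    (h2.comp h1').prod (MeasurePreserving.id _)
  have h4 : ∀ᵐ z ∂((volume : Measure (E d)).restrict {0}ᶜ).prod (volume : Measure (E d)), P z :=
    (Measure.AbsolutelyContinuous.prod Measure.restrict_le_self.absolutelyContinuous
      Measure.AbsolutelyContinuous.rfl).ae_le h
  have h5 := h3.quasiMeasurePreserving.ae h4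
  -- reordering of the variables
  have h6 : MeasurePreserving
      (fun y : (Metric.sphere (0 : E d) 1 × E d) × Ioi (0 : ℝ) => ((y.1.1, y.2), y.1.2))
      (((volume : Measure (E d)).toSphere.prod (volume : Measure (E d))).prod
        (Measure.volumeIoiPow n))
      ((((volume : Measure (E d)).toSphere.prod (Measure.volumeIoiPow n))).prod volume) := by
    have a1 := measurePreserving_prodAssoc (volume : Measure (E d)).toSphere
      (volume : Measure (E d)) (Measure.volumeIoiPow n)
    have a2 := (MeasurePreserving.id (volume : Measure (E d)).toSphere).prod
      (Measure.measurePreserving_swap (μ := (volume : Measure (E d)))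
        (ν := Measure.volumeIoiPow n))
    have a3 := (measurePreserving_prodAssoc (volume : Measure (E d)).toSphere
      (Measure.volumeIoiPow n) (volume : Measure (E d))).symm MeasurableEquiv.prodAssoc
    exact a3.comp (a2.comp a1)
  have h7 := Measure.ae_ae_of_ae_prod (h6.quasiMeasurePreserving.ae h5)
  have := ae_volumeIoiPow_neBot n
  filter_upwards [h7] with p hp
  obtain ⟨ρ, hρ⟩ := hp.exists
  refine ⟨ρ, ρ.2, ?_⟩
  simpa using hρ

lemma finrank_conf (d s : ℕ) : Module.finrank ℝ (Conf d (s + 1) × ℝ) =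
    Module.finrank ℝ ((ℝ × Conf d s) × (E d × E d)) := by
  simp [Conf, Module.finrank_pi_fintype]; ring

/-- Off grazing contacts, the time is a root attached to `V`, so the time, the configuration and the
added particle are differentiable functions of `V` ∈ Q. An impact direction on the sphere lacks one
dimension; a dummy radius restores it, and both sides then have dimension 2d(s+1) + 1. The
exceptional data lie in the image of the null set Q × ℝ. -/
lemma ae_adjoin_ne (hε : 0 < ε) (i : Fin s) {Q : Set (Conf d (s + 1))} (hQ : volume Q = 0)
    {S : Conf d (s + 1) → Conf d (s + 1)} (hS : Differentiable ℝ S) :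
    ∀ᵐ q : ℝ × Conf d s, ∀ᵐ p ∂(adjunctionMeasure d), ∀ V ∈ Q,
      adjoin q.2 ((q.2 i).1 + ε • (p.1 : E d)) p.2 = S (drift q.1 V) →
      ‖(drift q.1 V i.castSucc).1 - (drift q.1 V (Fin.last s)).1‖ = ε →
      inner ℝ ((V i.castSucc).2 - (V (Fin.last s)).2)
        ((drift q.1 V i.castSucc).1 - (drift q.1 V (Fin.last s)).1) = (0 : ℝ) := by
  let D : Conf d (s + 1) → ℝ := fun V => hitDisc ε ((V i.castSucc).1 - (V (Fin.last s)).1)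
    ((V i.castSucc).2 - (V (Fin.last s)).2)
  let τ : Bool → Conf d (s + 1) → ℝ := fun b V => hitTime ε (if b then 1 else -1)
    ((V i.castSucc).1 - (V (Fin.last s)).1) ((V i.castSucc).2 - (V (Fin.last s)).2)
  -- At contact the last particle sits at ε ω from particle i, so the third component is ρ ω with ρ
  -- the dummy radius.
  let Ψ : Bool → Conf d (s + 1) × ℝ → (ℝ × Conf d s) × (E d × E d) := fun b z =>
    ((τ b z.1, fun j => S (drift (τ b z.1) z.1) j.castSucc),
      ((z.2 * ε⁻¹) • ((S (drift (τ b z.1) z.1) (Fin.last s)).1 -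
        (S (drift (τ b z.1) z.1) i.castSucc).1), (S (drift (τ b z.1) z.1) (Fin.last s)).2))
  let B : Set (Conf d (s + 1) × ℝ) := (Q ×ˢ univ) ∩ {z | 0 < D z.1}
  have hB : volume B = 0 := by
    refine measure_mono_null inter_subset_left ?_
    rw [Measure.volume_eq_prod, Measure.prod_prod, hQ, zero_mul]
  have := isAddHaarMeasure_conf_prod d s
  have hA : ∀ b, ((volume : Measure (ℝ × Conf d s)).prod (volume : Measure (E d × E d)))
      (Ψ b '' B) = 0 := by
    intro b
    refine null_image volume _ (finrank_conf d s) (fun z hz => ?_) hB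
    have e1 : DifferentiableAt ℝ (fun z : Conf d (s + 1) × ℝ => τ b z.1) z :=
      (differentiableAt_hitTime (ε := ε) (z := z.1)
        ((differentiable_fst_apply i.castSucc _).sub (differentiable_fst_apply (Fin.last s) _))
        ((differentiable_snd_apply i.castSucc _).sub (differentiable_snd_apply (Fin.last s) _))
        (if b then 1 else -1) hz.2).comp z differentiableAt_fst
    have e2 : DifferentiableAt ℝ (fun z : Conf d (s + 1) × ℝ => S (drift (τ b z.1) z.1)) z :=
      (hS _).comp z (differentiableAt_drift e1 differentiableAt_fst)
    have e3 : ∀ j, DifferentiableAt ℝ (fun z : Conf d (s + 1) × ℝ => S (drift (τ b z.1) z.1) j) z :=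
      fun j => differentiableAt_pi.1 e2 j
    refine (e1.prodMk (differentiableAt_pi.2 fun j => e3 _)).prodMk
      (DifferentiableAt.prodMk ?_ (e3 _).snd)
    exact (differentiableAt_snd.mul_const _).smul ((e3 _).fst.sub (e3 _).fst)
  have hA' : ∀ᵐ z ∂((volume : Measure (ℝ × Conf d s)).prod (volume : Measure (E d × E d))),
      ∀ b, z ∉ Ψ b '' B := ae_all_iff.2 fun b => measure_eq_zero_iff_ae_notMem.1 (hA b)
  filter_upwards [Measure.ae_ae_of_ae_prod hA'] with q hq
  filter_upwards [ae_adjunction_of_ae hq] with p ⟨ρ, hρ, hp⟩ V hV h1 h2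
  by_contra h3
  rw [drift_sub] at h2 h3
  obtain ⟨h4, b, h5⟩ := eq_hitTime h2 h3
  refine hp b ⟨(V, ρ), ⟨⟨hV, mem_univ _⟩, h4⟩, ?_⟩
  have h6 : τ b V = q.1 := h5.symm
  simp only [Ψ, h6, ← h1, adjoin_castSucc, adjoin_last, add_sub_cancel_left]
  rw [smul_smul, mul_assoc, inv_mul_cancel₀ hε.ne', mul_one]

lemma inner_scatter_pair (hε : 0 < ε) {Z : Conf d s} (hZ : NonPathological ε Z) {i j : Fin s}
    (hij : i ≠ j) (hc : ‖(Z i).1 - (Z j).1‖ = ε) :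
    inner ℝ ((scatter ε Z i).2 - (scatter ε Z j).2) ((Z i).1 - (Z j).1) =
      -inner ℝ ((Z i).2 - (Z j).2) ((Z i).1 - (Z j).1) := by
  have hj := scatter_of_pair hZ hij.symm (norm_sub_comm_contact hc)
  rw [scatter_of_pair hZ hij hc, hj]
  set n := (Z i).1 - (Z j).1 with hn
  have hn' : (Z j).1 - (Z i).1 = -n := by rw [hn]; abel
  have hnn : inner ℝ n n = ε ^ 2 := by rw [real_inner_self_eq_norm_sq, hc]
  rw [hn']
  have : ε ^ 2 ≠ 0 := by positivity
  simp only [inner_sub_left, inner_smul_left, inner_neg_right, smul_neg, inner_neg_left, hnn,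
    conj_trivial]
  field_simp
  ring

lemma IsTrajectory.shift (hε : 0 < ε) {γ : ℝ → Conf d s} (h : IsTrajectory ε γ) (a : ℝ) :
    IsTrajectory ε fun t => γ (t + a) := by
  refine isTrajectory_of_reach hε fun b c hbc => ?_
  have := h.reach hε (show b + a ≤ c + a by linarith)
  convert this using 1
  ring

/-- The whole trajectory need not be parametrised. Some rational r lies inside the last free flight
before the contact; the configurations which a further backward time r carries into N form a null
set `Q r`. Only the flight of duration q.1 - r from `Q r` remains, and `ae_adjoin_ne` handles it,
with countably many choices of r. -/
lemma ae_adjoin_hsFlow_notMem (hε : 0 < ε) (i : Fin s) {N : Set (Conf d (s + 1))}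
    (hN : volume N = 0) : ∀ᵐ q : ℝ × Conf d s, ∀ᵐ p ∂(adjunctionMeasure d), 0 < q.1 →
      inner ℝ (p.1 : E d) (p.2 - (q.2 i).2) ≠ (0 : ℝ) →
      adjoin q.2 ((q.2 i).1 + ε • (p.1 : E d)) p.2 ∈ flowDomain d (s + 1) ε →
      hsFlow ε (-q.1) (adjoin q.2 ((q.2 i).1 + ε • (p.1 : E d)) p.2) ∉ N := by
  let Q : ℚ → Set (Conf d (s + 1)) := fun r =>
    {V | ∃ γ, IsTrajectory ε γ ∧ γ 0 = V ∧ γ (-(r : ℝ)) ∈ N}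
  have hQ : ∀ r, volume (Q r) = 0 := fun r => volume_trajectory_null hε _ hN
  have hshift : ∀ (r : ℚ) {P : ℝ × Conf d s → Prop}, (∀ᵐ q, P q) →
      ∀ᵐ q : ℝ × Conf d s, P (q.1 - r, q.2) := by
    intro r P hP
    have := (measurePreserving_add_right (volume : Measure (ℝ × Conf d s))
      (-(r : ℝ), 0)).quasiMeasurePreserving.ae hP
    filter_upwards [this] with q hq
    convert hq using 1
    ext1
    · simp [sub_eq_add_neg]
    · simp
  have h1 := ae_all_iff.2 fun r => hshift r (ae_adjoin_ne hε i (hQ r) differentiable_id)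
  have h2 := ae_all_iff.2 fun r : ℚ => ae_all_iff.2 fun c : ContactPattern (s + 1) =>
    hshift r (ae_adjoin_ne hε i (hQ r) (differentiable_scatterPattern (ε := ε) c))
  filter_upwards [h1, h2] with q h1 h2
  have h2' := ae_all_iff.2 fun r => ae_all_iff.2 fun c => h2 r c
  filter_upwards [ae_all_iff.2 h1, h2'] with p hp1 hp2 hq hw hdom hmem
  obtain ⟨γ, hγ⟩ := hdom
  rw [hsFlow_eq hε hγ] at hmem
  set W := adjoin q.2 ((q.2 i).1 + ε • (p.1 : E d)) p.2 with hW
  obtain ⟨hadm, h0⟩ := hγ.eq_or hε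
  obtain ⟨η, hη, -, hleft⟩ := hγ.1.exists_radius hε 0
  -- The lower bound q.1 - η keeps the time -(q.1 - r) within the flight that ends at time 0.
  obtain ⟨r, hr1, hr2⟩ := exists_rat_btwn (show max 0 (q.1 - η) < q.1 from
    max_lt hq (by linarith))
  have hr3 := (le_max_left _ _).trans_lt hr1
  have hr4 := (le_max_right _ _).trans_lt hr1
  have hV := hleft (-(q.1 - r)) ⟨by linarith, by linarith⟩
  rw [sub_zero] at hV
  have hVQ : γ (-(q.1 - r)) ∈ Q r := by
    refine ⟨fun t => γ (t + -(q.1 - r)), hγ.1.shift hε _, by simp, ?_⟩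
    convert hmem using 2
    ring
  have hdr : drift (q.1 - r) (γ (-(q.1 - r))) = scatter ε (γ 0) := by
    rw [hV, drift_drift]; simp
  have hvel : ∀ j, (γ (-(q.1 - r)) j).2 = (scatter ε (γ 0) j).2 := fun j => by
    rw [← hdr]; rfl
  have hne : (i.castSucc : Fin (s + 1)) ≠ Fin.last s := (Fin.castSucc_lt_last i).ne
  have hn : (W i.castSucc).1 - (W (Fin.last s)).1 = -(ε • (p.1 : E d)) := by
    simp [hW]
  have hp : ‖(p.1 : E d)‖ = 1 := by simp
  have hcontact : ‖(W i.castSucc).1 - (W (Fin.last s)).1‖ = ε := by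
    rw [hn, norm_neg, norm_smul, hp, mul_one, Real.norm_of_nonneg hε.le]
  have htrans : inner ℝ ((W i.castSucc).2 - (W (Fin.last s)).2)
      ((W i.castSucc).1 - (W (Fin.last s)).1) ≠ (0 : ℝ) := by
    rw [hn, inner_neg_right, ← inner_neg_left, inner_smul_right, real_inner_comm]
    refine mul_ne_zero hε.ne' ?_
    convert hw using 2
    simp [hW]
  -- If `W` is the outgoing state, the flight ends at `scatter ε W` and a fixed pattern of the jump
  -- law carries it to `W`. Otherwise `W` is the incoming state and the flight ends at `W` itself.
  -- Either way a zero normal velocity would contradict transversality.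
  rcases h0 with h0 | h0
  · rw [h0] at hdr hvel
    obtain ⟨c, hc⟩ := exists_hasPattern (ε := ε) (scatter ε W)
    have h5 := hp2 r c _ hVQ
    rw [hdr] at h5
    refine htrans ?_
    have h6 := h5 (by rw [← hc.scatter_eq, scatter_scatter hε hadm.2]) hcontact
    rw [hvel, hvel] at h6
    have h7 := inner_scatter_pair hε hadm.2 hne hcontact
    simp only [scatter_fst] at h6
    rw [h6] at h7
    linarith
  · rw [h0, scatter_scatter hε hadm.2] at hdr hvel
    have h5 := hp1 r _ hVQ
    rw [hdr] at h5
    have h6 := h5 rfl hcontact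
    rw [hvel, hvel] at h6
    exact htrans h6

end Trace

/-! ### Left-continuous families -/

section LeftCont

/-- Rational times approaching `u` from the left. -/
def leftTime (n : ℕ) (u : ℝ) : ℚ := ((⌈((n : ℝ) + 1) * u⌉ : ℚ) - 1) / (n + 1)

lemma measurable_leftTime (n : ℕ) : Measurable (leftTime n) := by
  have h : Measurable fun u : ℝ => ⌈((n : ℝ) + 1) * u⌉ :=
    Int.measurable_ceil.comp (measurable_const.mul measurable_id)
  exact (measurable_from_top (f := fun k : ℤ => ((k : ℚ) - 1) / (n + 1))).comp h

lemma leftTime_lt (n : ℕ) (u : ℝ) : (leftTime n u : ℝ) < u := by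
  have hn : (0 : ℝ) < (n : ℝ) + 1 := by positivity
  have := Int.ceil_lt_add_one (((n : ℝ) + 1) * u)
  simp only [leftTime]
  push_cast
  rw [div_lt_iff₀ hn]
  linarith

lemma le_leftTime (n : ℕ) (u : ℝ) : u - 1 / ((n : ℝ) + 1) ≤ leftTime n u := by
  have hn : (0 : ℝ) < (n : ℝ) + 1 := by positivity
  have := Int.le_ceil (((n : ℝ) + 1) * u)
  simp only [leftTime]
  push_cast
  rw [le_div_iff₀ hn, sub_mul, one_div_mul_cancel hn.ne']
  linarith

lemma tendsto_leftTime (u : ℝ) : Tendsto (fun n => (leftTime n u : ℝ)) atTop (𝓝[<] u) := by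
  refine tendsto_nhdsWithin_iff.2 ⟨?_, Eventually.of_forall fun n => leftTime_lt n u⟩
  refine tendsto_of_tendsto_of_tendsto_of_le_of_le ?_ tendsto_const_nhds
    (fun n => le_leftTime n u) (fun n => (leftTime_lt n u).le)
  simpa using tendsto_const_nhds.sub (tendsto_one_div_add_atTop_nhds_zero_nat (𝕜 := ℝ))

/-- A function that is left-continuous on `(0, T]` is measurable there. -/
lemma aemeasurable_of_leftCont {f : ℝ → ℝ} {T : ℝ}
    (hf : ∀ u ∈ Ioc 0 T, Tendsto f (𝓝[<] u) (𝓝 (f u))) :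
    AEMeasurable f (volume.restrict (Ioc 0 T)) := by
  have h1 : ∀ n, AEMeasurable (fun u => f (leftTime n u)) (volume.restrict (Ioc 0 T)) := fun n =>
    ((measurable_from_top (f := fun q : ℚ => f q)).comp (measurable_leftTime n)).aemeasurable
  refine aemeasurable_of_tendsto_metrizable_ae atTop h1 ?_
  filter_upwards [ae_restrict_mem measurableSet_Ioc] with u hu
  exact (hf u hu).comp (tendsto_leftTime u)

variable {d s : ℕ} [NeZero d] {ε : ℝ}

/-- The average of `h` over a ball of the phase space. -/
def ballAverage (h : Linf d ε s) (Z : Conf d s) (r : ℝ) : ℝ :=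
  ⨍ W in Metric.closedBall Z r, h W ∂(phaseMeasure d ε s)

lemma lebesgueValue_eq {h : Linf d ε s} {Z : Conf d s} {a : ℝ}
    (ha : Tendsto (ballAverage h Z) (𝓝[>] 0) (𝓝 a)) : lebesgueValue h Z = a :=
  ha.limUnder_eq

lemma ae_tendsto_ballAverage (h : Linf d ε s) : ∀ᵐ Z ∂(phaseMeasure d ε s),
    Tendsto (ballAverage h Z) (𝓝[>] 0) (𝓝 (h Z)) := by
  have h1 : LocallyIntegrable h (phaseMeasure d ε s) := (Lp.memLp h).locallyIntegrable (by simp)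
  filter_upwards [(Besicovitch.vitaliFamily (phaseMeasure d ε s)).ae_tendsto_average h1] with Z hZ
  exact hZ.comp (Besicovitch.tendsto_filterAt _ Z)

lemma ae_abs_sub_le (h h' : Linf d ε s) :
    ∀ᵐ Z ∂(phaseMeasure d ε s), |h Z - h' Z| ≤ ‖h - h'‖ := by
  have h1 := Lp.coeFn_sub h h'
  have h2 : ∀ᵐ Z ∂(phaseMeasure d ε s), ‖(h - h') Z‖ₑ ≤
      eLpNorm (h - h' : Linf d ε s) ∞ (phaseMeasure d ε s) := by
    rw [eLpNorm_exponent_top]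
    exact ae_le_eLpNormEssSup
  filter_upwards [h1, h2] with Z hZ1 hZ2
  rw [hZ1] at hZ2
  have h3 := ENNReal.toReal_mono (Lp.eLpNorm_ne_top (h - h')) hZ2
  rw [Lp.norm_def]
  simpa using h3

/-- The bound holds at every centre and radius, with no exceptional set. This uniformity allows the
limit r → 0 to be exchanged with left limits in time. -/
lemma abs_ballAverage_sub_le (h h' : Linf d ε s) (Z : Conf d s) (r : ℝ) :
    |ballAverage h Z r - ballAverage h' Z r| ≤ ‖h - h'‖ := by
  have hfin : phaseMeasure d ε s (Metric.closedBall Z r) ≠ ∞ :=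
    (isCompact_closedBall Z r).measure_lt_top.ne
  have hint : ∀ k : Linf d ε s, IntegrableOn k (Metric.closedBall Z r) (phaseMeasure d ε s) :=
    fun k => ((Lp.memLp k).locallyIntegrable (by simp)).integrableOn_isCompact
      (isCompact_closedBall Z r)
  set ν := phaseMeasure d ε s with hν
  by_cases h0 : ν (Metric.closedBall Z r) = 0
  · have : ∀ k : Linf d ε s, ballAverage k Z r = 0 := by
      intro k
      simp only [ballAverage, ← hν]
      rw [Measure.restrict_eq_zero.2 h0, average_zero_measure]
    rw [this, this]
    simp
  · have hr : ν.real (Metric.closedBall Z r) ≠ 0 := by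
      rw [measureReal_def]; exact (ENNReal.toReal_pos h0 hfin).ne'
    have hr' : 0 < ν.real (Metric.closedBall Z r) := lt_of_le_of_ne measureReal_nonneg hr.symm
    simp only [ballAverage, ← hν]
    rw [setAverage_eq, setAverage_eq, ← smul_sub, ← integral_sub (hint h) (hint h'), smul_eq_mul,
      abs_mul, abs_of_pos (inv_pos.2 hr')]
    have h1 : ‖∫ W in Metric.closedBall Z r, (h W - h' W) ∂ν‖ ≤
        ‖h - h'‖ * ν.real (Metric.closedBall Z r) := by
      refine norm_setIntegral_le_of_norm_le_const_ae' hfin.lt_top ?_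
      filter_upwards [ae_abs_sub_le h h'] with W hW _
      exact hW
    rw [Real.norm_eq_abs] at h1
    rw [inv_mul_le_iff₀ hr', mul_comm]
    exact h1

/-- A left-continuous bounded family in `L^∞` has Lebesgue values that are, off a fixed null set,
jointly measurable and bounded. -/
lemma exists_measurable_lebesgueValue {T M : ℝ} {β : ℝ → ℝ} (hβ : Continuous β)
    {h : ℝ → Linf d ε s} (hlc : ∀ t ∈ Ioc 0 T, Tendsto (fun u => ‖h t - h u‖) (𝓝[<] t) (𝓝 0))
    (hbd : ∀ t ∈ Icc 0 T, ∀ᵐ Z ∂(phaseMeasure d ε s), |h t Z| * gaussWeight (β t) Z ≤ M) :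
    ∃ (g : ℝ → Conf d s → ℝ) (N : Set (Conf d s)), Measurable (Function.uncurry g) ∧
      phaseMeasure d ε s N = 0 ∧
      (∀ u ∈ Ioc 0 T, ∀ Z, 0 ≤ M → |g u Z| * gaussWeight (β u) Z ≤ M) ∧
      ∀ u ∈ Ioc 0 T, ∀ Z ∉ N, lebesgueValue (h u) Z = g u Z := by
  classical
  -- Only rational times are considered, so that the exceptional sets form a countable family. Other
  -- times are reached through `leftTime`.
  have a1 : ∀ᵐ Z ∂(phaseMeasure d ε s), ∀ q : ℚ,
      Tendsto (ballAverage (h q) Z) (𝓝[>] 0) (𝓝 (h q Z)) :=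
    ae_all_iff.2 fun q => ae_tendsto_ballAverage _
  have a2 : ∀ᵐ Z ∂(phaseMeasure d ε s), ∀ q q' : ℚ, |h q Z - h q' Z| ≤ ‖h q - h q'‖ :=
    ae_all_iff.2 fun q => ae_all_iff.2 fun q' => ae_abs_sub_le _ _
  have a3 : ∀ᵐ Z ∂(phaseMeasure d ε s), ∀ q : ℚ, (q : ℝ) ∈ Icc 0 T →
      |h q Z| * gaussWeight (β q) Z ≤ M := by
    refine ae_all_iff.2 fun q => ?_
    by_cases hq : (q : ℝ) ∈ Icc 0 T
    · filter_upwards [hbd q hq] with Z hZ _ using hZ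
    · exact Eventually.of_forall fun Z h => absurd h hq
  obtain ⟨N, hN1, hN2, hN3⟩ := exists_measurable_superset_of_null (a1.and (a2.and a3))
  have hmem : ∀ u ∈ Ioc 0 T, ∀ᶠ n in atTop, (leftTime n u : ℝ) ∈ Icc 0 T := by
    intro u hu
    have : Ioo 0 u ∈ 𝓝[<] u := Ioo_mem_nhdsLT hu.1
    filter_upwards [(tendsto_leftTime u).eventually this] with n hn
    exact ⟨hn.1.le, hn.2.le.trans hu.2⟩
  have hN : ∀ Z ∉ N, (∀ q : ℚ, Tendsto (ballAverage (h q) Z) (𝓝[>] 0) (𝓝 (h q Z))) ∧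
      (∀ q q' : ℚ, |h q Z - h q' Z| ≤ ‖h q - h q'‖) ∧
      ∀ q : ℚ, (q : ℝ) ∈ Icc 0 T → |h q Z| * gaussWeight (β q) Z ≤ M := by
    intro Z hZ
    by_contra hc
    exact hZ (hN1 hc)
  have key : ∀ u ∈ Ioc 0 T, ∀ Z ∉ N, Tendsto (fun n => h (leftTime n u) Z) atTop
      (𝓝 (lebesgueValue (h u) Z)) := by
    intro u hu Z hZ
    obtain ⟨b1, b2, -⟩ := hN Z hZ
    have c1 : Tendsto (fun n => ‖h u - h (leftTime n u)‖) atTop (𝓝 0) :=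
      (hlc u hu).comp (tendsto_leftTime u)
    have c2 : CauchySeq fun n => h (leftTime n u) Z := by
      rw [Metric.cauchySeq_iff]
      intro δ hδ
      obtain ⟨n₀, hn₀⟩ := eventually_atTop.1 (c1.eventually_lt_const (half_pos hδ))
      refine ⟨n₀, fun m hm n hn => ?_⟩
      rw [Real.dist_eq]
      calc |h (leftTime m u) Z - h (leftTime n u) Z|
          ≤ ‖h (leftTime m u) - h (leftTime n u)‖ := b2 _ _
        _ ≤ ‖h u - h (leftTime m u)‖ + ‖h u - h (leftTime n u)‖ := by
            rw [norm_sub_rev (h u) (h (leftTime m u))]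
            exact norm_sub_le_norm_sub_add_norm_sub _ _ _
        _ < δ := by linarith [hn₀ m hm, hn₀ n hn]
    obtain ⟨L, hL⟩ := cauchySeq_tendsto_of_complete c2
    -- Ball averages at time u are limits, uniform in the radius, of those at rational times, whose
    -- limits as r → 0 are known. The exchange of limits gives the Lebesgue value at u and its
    -- approximation from the left.
    have c3 : TendstoUniformlyOnFilter (fun n r => ballAverage (h (leftTime n u)) Z r)
        (ballAverage (h u) Z) atTop (𝓝[>] 0) := by
      rw [Metric.tendstoUniformlyOnFilter_iff]
      intro δ hδ
      have := (c1.eventually_lt_const hδ).prod_inl (𝓝[>] (0 : ℝ))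
      filter_upwards [this] with x hx
      rw [Real.dist_eq]
      exact (abs_ballAverage_sub_le _ _ _ _).trans_lt hx
    have c4 := c3.tendsto_of_eventually_tendsto (Eventually.of_forall fun n => b1 (leftTime n u)) hL
    rw [lebesgueValue_eq c4]
    exact hL
  let g : ℝ → Conf d s → ℝ := fun u Z =>
    if u ∈ Ioc 0 T ∧ Z ∉ N then lebesgueValue (h u) Z else 0
  refine ⟨g, N, ?_, hN3, fun u hu Z hM => ?_, fun u hu Z hZ => ?_⟩
  · have hS : MeasurableSet {p : ℝ × Conf d s | p.1 ∈ Ioc 0 T ∧ p.2 ∉ N} :=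
      (measurable_fst measurableSet_Ioc).inter (measurable_snd hN2.compl)
    -- The approximants depend on time only through a rational, so they are measurable jointly by
    -- countability of the rationals.
    refine measurable_of_tendsto_metrizable (f := fun n (p : ℝ × Conf d s) =>
      if p.1 ∈ Ioc 0 T ∧ p.2 ∉ N then h (leftTime n p.1) p.2 else 0) (fun n => ?_) ?_
    · refine Measurable.ite hS ?_ measurable_const
      have h1 : Measurable fun p : ℚ × Conf d s => h p.1 p.2 :=
        measurable_from_prod_countable_right fun q => (Lp.stronglyMeasurable (h q)).measurable
      exact h1.comp (((measurable_leftTime n).comp measurable_fst).prodMk measurable_snd)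
    · rw [tendsto_pi_nhds]
      rintro ⟨u, Z⟩
      simp only [Function.uncurry, g]
      split_ifs with hc
      · exact key u hc.1 Z hc.2
      · exact tendsto_const_nhds
  · simp only [g]
    split_ifs with hc
    · refine le_of_tendsto (((key u hu Z hc.2).abs).mul ?_ :
        Tendsto (fun n => |h (leftTime n u) Z| * gaussWeight (β (leftTime n u)) Z) _ _) ?_
      · have : Continuous fun t => gaussWeight (β t) Z := by unfold gaussWeight; fun_prop
        exact (this.tendsto u).comp ((tendsto_leftTime u).mono_right nhdsWithin_le_nhds)
      · filter_upwards [hmem u hu] with n hn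
        exact (hN Z hc.2).2.2 _ hn
    · simpa using hM
  · simp only [g]
    rw [if_pos ⟨hu, hZ⟩]

end LeftCont

/-! ### Bounds for the collision integrals -/

section Bounds

variable {d s : ℕ} [NeZero d] {ε : ℝ}

lemma gaussWeight_eq (β : ℝ) (Z : Conf d s) : gaussWeight β Z = Real.exp (β / 2 * energy Z) := rfl

lemma gaussWeight_pos (β : ℝ) (Z : Conf d s) : 0 < gaussWeight β Z := Real.exp_pos _

lemma energy_nonneg (Z : Conf d s) : 0 ≤ energy Z := Finset.sum_nonneg fun _ _ => by positivity

lemma norm_snd_le (Z : Conf d s) (i : Fin s) : ‖(Z i).2‖ ≤ √(energy Z) := by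
  apply Real.le_sqrt_of_sq_le
  exact Finset.single_le_sum (f := fun i => ‖(Z i).2‖ ^ 2) (fun _ _ => by positivity)
    (Finset.mem_univ i)

lemma energy_adjoin (Z : Conf d s) (x v : E d) : energy (adjoin Z x v) = energy Z + ‖v‖ ^ 2 := by
  simp [energy, Fin.sum_univ_castSucc]

instance isFiniteMeasure_toSphere (d : ℕ) :
    IsFiniteMeasure (volume : Measure (E d)).toSphere := inferInstance

instance sFinite_adjunctionMeasure (d : ℕ) : SFinite (adjunctionMeasure d) := by
  unfold adjunctionMeasure; infer_instance

/-- Velocity weight dominating the collision integrands. -/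
def velWeight (b : ℝ) (v : E d) : ℝ := (1 + ‖v‖) * Real.exp (-(b / 2 * ‖v‖ ^ 2))

lemma velWeight_nonneg (b : ℝ) (v : E d) : 0 ≤ velWeight b v := by unfold velWeight; positivity

/-- Half of the Gaussian exponent absorbs the factor 1 + ‖v‖ and the other half is integrable; the
sphere has finite measure. -/
lemma integrable_velWeight {b : ℝ} (hb : 0 < b) :
    Integrable (fun p : Metric.sphere (0 : E d) 1 × E d => velWeight b p.2)
      (adjunctionMeasure d) := by
  have h1 : Integrable (fun v : E d => Real.exp (-(b / 4 * ‖v‖ ^ 2))) := by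
    have := (GaussianFourier.integrable_cexp_neg_mul_sq_norm_add (V := E d)
      (b := ((b / 4 : ℝ) : ℂ)) (by simpa using by positivity) 0 0).norm
    refine this.congr (Eventually.of_forall fun v => ?_)
    simp only [Complex.norm_exp]
    congr 1
    simp [← Complex.ofReal_pow]
  have h2 : Integrable (fun v : E d => velWeight b v) := by
    refine (h1.const_mul (1 + (1 + 4 / b))).mono' ?_ (Eventually.of_forall fun v => ?_)
    · unfold velWeight
      exact Continuous.aestronglyMeasurable (by fun_prop)
    · rw [Real.norm_of_nonneg (velWeight_nonneg _ _), velWeight]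
      have e1 : Real.exp (-(b / 2 * ‖v‖ ^ 2)) =
          Real.exp (-(b / 4 * ‖v‖ ^ 2)) * Real.exp (-(b / 4 * ‖v‖ ^ 2)) := by
        rw [← Real.exp_add]; congr 1; ring
      have e2 : (1 + ‖v‖) * Real.exp (-(b / 4 * ‖v‖ ^ 2)) ≤ 1 + (1 + 4 / b) := by
        have h3 : Real.exp (-(b / 4 * ‖v‖ ^ 2)) ≤ 1 := Real.exp_le_one_iff.2 (by
          have : 0 ≤ b / 4 * ‖v‖ ^ 2 := by positivity
          linarith)
        have h4 : ‖v‖ ^ 2 * Real.exp (-(b / 4 * ‖v‖ ^ 2)) ≤ 4 / b := by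
          have h5 := Real.add_one_le_exp (b / 4 * ‖v‖ ^ 2)
          rw [Real.exp_neg, ← div_eq_mul_inv, div_le_div_iff₀ (Real.exp_pos _) hb]
          nlinarith
        nlinarith [norm_nonneg v, sq_nonneg (‖v‖ - 1), Real.exp_pos (-(b / 4 * ‖v‖ ^ 2))]
      rw [e1, ← mul_assoc]
      exact mul_le_mul_of_nonneg_right e2 (Real.exp_pos _).le
  exact h2.comp_snd _

/-- The total mass of the velocity weight. -/
def velMass (d : ℕ) [NeZero d] (b : ℝ) : ℝ :=
  ∫ p : Metric.sphere (0 : E d) 1 × E d, velWeight b p.2 ∂(adjunctionMeasure d)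

lemma velMass_nonneg (d : ℕ) [NeZero d] (b : ℝ) : 0 ≤ velMass d b :=
  integral_nonneg fun _ => velWeight_nonneg _ _

lemma abs_inner_sphere_le (ω : Metric.sphere (0 : E d) 1) (v w : E d) :
    |inner ℝ (ω : E d) (v - w)| ≤ (1 + ‖w‖) * (1 + ‖v‖) := by
  have h1 : ‖(ω : E d)‖ = 1 := by simp
  have h2 := abs_real_inner_le_norm (ω : E d) (v - w)
  rw [h1, one_mul] at h2
  have := norm_sub_le v w
  nlinarith [norm_nonneg v, norm_nonneg w]

lemma exp_adjoin_le {b β : ℝ} (hb : b ≤ β) (Z : Conf d s) (v : E d) :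
    Real.exp (-(β / 2 * (energy Z + ‖v‖ ^ 2))) ≤
      Real.exp (-(β / 2 * energy Z)) * Real.exp (-(b / 2 * ‖v‖ ^ 2)) := by
  rw [← Real.exp_add]
  apply Real.exp_le_exp.2
  have : b / 2 * ‖v‖ ^ 2 ≤ β / 2 * ‖v‖ ^ 2 := by gcongr
  linarith

lemma integral_exp_decay {a r t : ℝ} (ha : a ≠ 0) :
    ∫ u in r..t, Real.exp (-(a * (t - u))) = (1 - Real.exp (-(a * (t - r)))) / a := by
  have h : ∀ u ∈ uIcc r t, HasDerivAt (fun u => Real.exp (-(a * (t - u))) / a)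
      (Real.exp (-(a * (t - u)))) u := by
    intro u _
    have h1 : HasDerivAt (fun u => -(a * (t - u))) a u := by
      have := (((hasDerivAt_id u).const_sub t).const_mul a).fun_neg
      simpa using this
    have := h1.exp.div_const a
    rwa [mul_div_assoc, div_self ha, mul_one] at this
  rw [intervalIntegral.integral_eq_sub_of_hasDerivAt h
    (Continuous.intervalIntegrable (by fun_prop) _ _)]
  simp [sub_div]

/-- The interpolation between the bounds 1 and y. Its square root compensates the factor √x by which
the collision operator grows with the energy x. -/
lemma one_sub_exp_neg_le_sqrt {y : ℝ} (hy : 0 ≤ y) : 1 - Real.exp (-y) ≤ √y := by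
  rcases le_total 1 y with h | h
  · have : 1 ≤ √y := Real.one_le_sqrt.2 h
    linarith [Real.exp_pos (-y)]
  · have h1 : y ≤ √y := Real.le_sqrt_of_sq_le (by nlinarith)
    linarith [Real.add_one_le_exp (-y)]

/-- Gain of integrability in time from the decay of the weights. -/
lemma integral_sqrt_exp_le {lam x r t : ℝ} (hlam : 0 < lam) (hx : 0 ≤ x) (hrt : r ≤ t) :
    ∫ u in r..t, (1 + √x) * Real.exp (-(lam * x / 2 * (t - u))) ≤
      (t - r) + √(2 * (t - r) / lam) := by
  rcases hx.eq_or_lt with rfl | hx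
  · simp only [Real.sqrt_zero, mul_zero, zero_div, zero_mul, neg_zero, Real.exp_zero, mul_one,
      add_zero, intervalIntegral.integral_const, smul_eq_mul]
    linarith [Real.sqrt_nonneg (2 * (t - r) / lam)]
  · have ha : 0 < lam * x / 2 := by positivity
    set a := lam * x / 2 with ha'
    set τ := t - r with hτ
    have hτ0 : 0 ≤ τ := by linarith
    rw [intervalIntegral.integral_const_mul, integral_exp_decay ha.ne', add_mul, one_mul]
    have h1 : (1 - Real.exp (-(a * τ))) / a ≤ τ := by
      rw [div_le_iff₀ ha]
      linarith [Real.add_one_le_exp (-(a * τ))]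
    -- Since a = lam x / 2, the quotient √x √(a τ) / a no longer depends on x.
    have h2 : √x * ((1 - Real.exp (-(a * τ))) / a) ≤ √(2 * τ / lam) := by
      have h3 : √x * ((1 - Real.exp (-(a * τ))) / a) ≤ √x * (√(a * τ) / a) := by
        gcongr
        exact one_sub_exp_neg_le_sqrt (by positivity)
      refine h3.trans (le_of_eq ?_)
      rw [← mul_div_assoc, ← Real.sqrt_mul hx.le, div_eq_iff ha.ne', ← Real.sqrt_sq ha.le,
        ← Real.sqrt_mul (by positivity), Real.sqrt_sq ha.le]
      congr 1
      rw [ha']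
      field_simp
    linarith

end Bounds

/-! ### The transport-collision operator on hard sphere configurations -/

section Transport

variable {d s : ℕ} [NeZero d] {ε : ℝ}

lemma hsTransport_of_mem {Z : Conf d s} (hZ : Z ∈ flowDomain d s ε) (t : ℝ) (f : Conf d s → ℝ) :
    hsTransport ε t f Z = f (hsFlow ε (-t) Z) := if_pos hZ

lemma hsTransport_of_notMem {Z : Conf d s} (hZ : Z ∉ flowDomain d s ε) (t : ℝ)
    (f : Conf d s → ℝ) : hsTransport ε t f Z = 0 := if_neg hZ

lemma hsFlow_of_notMem {Z : Conf d s} (hZ : Z ∉ flowDomain d s ε) (t : ℝ) :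
    hsFlow ε t Z = Z := dif_neg hZ

lemma hsFlow_mem_phaseSpace (hε : 0 < ε) {Z : Conf d s} (hZ : Z ∈ flowDomain d s ε) (t : ℝ) :
    hsFlow ε t Z ∈ phaseSpace d ε s := by
  obtain ⟨γ, hγ⟩ := hZ
  rw [hsFlow_eq hε hγ]
  exact (hγ.1.1 t).1

/-- Three sources: points of trajectories ending in N, incoming states of such points (one jump with
no elapsed time, hence `jumpImage` with duration 0), and points outside the flow domain, which do
not move. -/
lemma volume_hsFlow_preimage (hε : 0 < ε) (t : ℝ) {N : Set (Conf d s)} (hN : volume N = 0) :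
    volume {Z : Conf d s | hsFlow ε t Z ∈ N} = 0 := by
  let N₁ : Set (Conf d s) := {Z | ∃ γ, IsTrajectory ε γ ∧ γ 0 = Z ∧ γ t ∈ N}
  have h1 : volume N₁ = 0 := volume_trajectory_null hε t hN
  refine measure_mono_null (t := (N₁ ∪ jumpImage ε 0 N₁) ∪ N) ?_
    (measure_union_null (measure_union_null h1 (volume_jumpImage 0 h1)) hN)
  intro Z hZ
  by_cases h : Z ∈ flowDomain d s ε
  · left
    obtain ⟨γ, hγ⟩ := h
    have hZ' : hsFlow ε t Z ∈ N := hZ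
    rw [hsFlow_eq hε hγ] at hZ'
    obtain ⟨hadm, h0 | h0⟩ := hγ.eq_or hε
    · exact Or.inl ⟨γ, hγ.1, h0, hZ'⟩
    · refine Or.inr ⟨scatter ε Z, ⟨γ, hγ.1, h0, hZ'⟩, Or.inr ⟨0, ?_⟩⟩
      simp [scatter_scatter hε hadm.2]
  · right
    have hZ' : hsFlow ε t Z ∈ N := hZ
    rwa [hsFlow_of_notMem h] at hZ'

lemma measurable_hsTransport (hε : 0 < ε) {g : ℝ → Conf d s → ℝ}
    (hg : Measurable (Function.uncurry g)) (c : ℝ) :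
    Measurable fun p : ℝ × Conf d s => hsTransport ε (c * p.1) (g p.1) p.2 := by
  classical
  have h1 : MeasurableSet {p : ℝ × Conf d s | p.2 ∈ flowDomain d s ε} :=
    measurable_snd (measurableSet_flowDomain hε)
  have h2 : Measurable fun p : ℝ × Conf d s => hsFlow ε (-(c * p.1)) p.2 :=
    (measurable_hsFlow hε).comp (f := fun p : ℝ × Conf d s => (-(c * p.1), p.2)) (by fun_prop)
  exact Measurable.ite h1 (hg.comp (measurable_fst.prodMk h2)) measurable_const

lemma continuous_adjoin : Continuous fun z : Conf d s × E d × E d => adjoin z.1 z.2.1 z.2.2 := by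
  refine continuous_pi fun j => ?_
  refine Fin.lastCases ?_ (fun j => ?_) j
  · simp only [adjoin_last]; fun_prop
  · simp only [adjoin_castSucc]; fun_prop

lemma measurable_collisionIntegrand {f : ℝ → Conf d (s + 1) → ℝ}
    (hf : Measurable (Function.uncurry f)) (i : Fin s) :
    Measurable fun z : (ℝ × Conf d s) × (Metric.sphere (0 : E d) 1 × E d) =>
      collisionIntegrand ε (f z.1.1) z.1.2 i z.2 := by
  have h1 : Continuous fun z : (ℝ × Conf d s) × (Metric.sphere (0 : E d) 1 × E d) =>
      adjoin z.1.2 ((z.1.2 i).1 + ε • (z.2.1 : E d)) z.2.2 :=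
    continuous_adjoin.comp (f := fun z : (ℝ × Conf d s) × (Metric.sphere (0 : E d) 1 × E d) =>
      (z.1.2, (z.1.2 i).1 + ε • (z.2.1 : E d), z.2.2)) (by fun_prop)
  have h2 : Measurable fun z : ℝ × Conf d (s + 1) =>
      (phaseSpace d ε (s + 1)).indicator (f z.1) z.2 := by
    have : (fun z : ℝ × Conf d (s + 1) => (phaseSpace d ε (s + 1)).indicator (f z.1) z.2) =
        (Prod.snd ⁻¹' phaseSpace d ε (s + 1)).indicator (Function.uncurry f) := by
      funext z
      rfl
    rw [this]
    exact hf.indicator (measurable_snd (isClosed_phaseSpace ε).measurableSet)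
  have h3 : Continuous fun z : (ℝ × Conf d s) × (Metric.sphere (0 : E d) 1 × E d) =>
      inner ℝ (z.2.1 : E d) (z.2.2 - (z.1.2 i).2) := by fun_prop
  have h4 : Measurable fun z : (ℝ × Conf d s) × (Metric.sphere (0 : E d) 1 × E d) =>
      (z.1.1, adjoin z.1.2 ((z.1.2 i).1 + ε • (z.2.1 : E d)) z.2.2) :=
    Measurable.prodMk (by fun_prop) h1.measurable
  have h5 := h2.comp h4
  unfold collisionIntegrand
  exact Measurable.mul h3.measurable h5

lemma measurable_collision (N : ℕ) {f : ℝ → Conf d (s + 1) → ℝ}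
    (hf : Measurable (Function.uncurry f)) :
    Measurable fun z : ℝ × Conf d s => collision N ε (f z.1) z.2 := by
  refine Finset.measurable_sum _ fun i _ => Measurable.const_mul ?_ _
  exact ((measurable_collisionIntegrand hf i).stronglyMeasurable.integral_prod_right).measurable

lemma abs_collisionIntegrand_le {M b β : ℝ} (hM : 0 ≤ M) (hb : b ≤ β) {f : Conf d (s + 1) → ℝ}
    (hf : ∀ W, |f W| ≤ M * Real.exp (-(β / 2 * energy W))) (Z : Conf d s) (i : Fin s)
    (p : Metric.sphere (0 : E d) 1 × E d) : |collisionIntegrand ε f Z i p| ≤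
      (M * (1 + √(energy Z)) * Real.exp (-(β / 2 * energy Z))) * velWeight b p.2 := by
  rw [collisionIntegrand, abs_mul]
  have h1 := abs_inner_sphere_le p.1 p.2 (Z i).2
  have h2 : |(phaseSpace d ε (s + 1)).indicator f (adjoin Z ((Z i).1 + ε • (p.1 : E d)) p.2)| ≤
      M * (Real.exp (-(β / 2 * energy Z)) * Real.exp (-(b / 2 * ‖p.2‖ ^ 2))) := by
    refine le_trans ?_ (mul_le_mul_of_nonneg_left (exp_adjoin_le hb Z p.2) hM)
    rw [← energy_adjoin Z ((Z i).1 + ε • (p.1 : E d)) p.2]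
    by_cases h : adjoin Z ((Z i).1 + ε • (p.1 : E d)) p.2 ∈ phaseSpace d ε (s + 1)
    · rw [indicator_of_mem h]; exact hf _
    · rw [indicator_of_notMem h, abs_zero]; positivity
  have h3 := norm_snd_le Z i
  calc _ ≤ ((1 + ‖(Z i).2‖) * (1 + ‖p.2‖)) *
        (M * (Real.exp (-(β / 2 * energy Z)) * Real.exp (-(b / 2 * ‖p.2‖ ^ 2)))) :=
        mul_le_mul h1 h2 (abs_nonneg _) (by positivity)
    _ ≤ ((1 + √(energy Z)) * (1 + ‖p.2‖)) *
        (M * (Real.exp (-(β / 2 * energy Z)) * Real.exp (-(b / 2 * ‖p.2‖ ^ 2)))) := by gcongr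
    _ = _ := by unfold velWeight; ring

/-- The scaling N ε^(d-1) = 1 bounds the prefactor by 1, so the constant does not depend on N or ε.
-/
lemma abs_collision_le {N : ℕ} (hε : 0 < ε) (hNε : (N : ℝ) * ε ^ (d - 1) = 1)
    (hs : s ≤ N) {M b β : ℝ} (hM : 0 ≤ M) (hb0 : 0 < b) (hb : b ≤ β) {f : Conf d (s + 1) → ℝ}
    (hf : ∀ W, |f W| ≤ M * Real.exp (-(β / 2 * energy W))) (Z : Conf d s) :
    |collision N ε f Z| ≤ (s * M * velMass d b) * ((1 + √(energy Z)) *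
      Real.exp (-(β / 2 * energy Z))) := by
  have h1 : ∀ i : Fin s, |((N : ℝ) - s) * ε ^ (d - 1) *
      ∫ p, collisionIntegrand ε f Z i p ∂(adjunctionMeasure d)| ≤
      (M * (1 + √(energy Z)) * Real.exp (-(β / 2 * energy Z))) * velMass d b := by
    intro i
    rw [abs_mul]
    have e1 : |((N : ℝ) - s) * ε ^ (d - 1)| ≤ 1 := by
      have hs' : (s : ℝ) ≤ N := by exact_mod_cast hs
      have : 0 < ε ^ (d - 1) := by positivity
      rw [abs_of_nonneg (mul_nonneg (by linarith) this.le), ← hNε]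
      gcongr
      linarith [show (0 : ℝ) ≤ s by positivity]
    have e2 : |∫ p, collisionIntegrand ε f Z i p ∂(adjunctionMeasure d)| ≤
        (M * (1 + √(energy Z)) * Real.exp (-(β / 2 * energy Z))) * velMass d b := by
      rw [velMass, ← integral_const_mul, ← Real.norm_eq_abs]
      refine norm_integral_le_of_norm_le ((integrable_velWeight hb0).const_mul _)
        (Eventually.of_forall fun p => ?_)
      rw [Real.norm_eq_abs]
      exact abs_collisionIntegrand_le hM hb hf Z i p
    calc _ ≤ 1 * ((M * (1 + √(energy Z)) * Real.exp (-(β / 2 * energy Z))) * velMass d b) :=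
          mul_le_mul e1 e2 (abs_nonneg _) zero_le_one
      _ = _ := one_mul _
  refine (Finset.abs_sum_le_sum_abs _ _).trans ((Finset.sum_le_sum fun i _ => h1 i).trans ?_)
  rw [Finset.sum_const, Finset.card_univ, Fintype.card_fin, nsmul_eq_mul]
  apply le_of_eq
  ring

/-- The flow conserves energy, so a bound expressed through the energy alone survives transport. -/
lemma abs_hsTransport_le (hε : 0 < ε) {M : ℝ} {F : ℝ → ℝ} (hF : ∀ x, 0 ≤ x → 0 ≤ F x)
    {f : Conf d s → ℝ} (hf : ∀ W, |f W| ≤ M * F (energy W)) (hM : 0 ≤ M) (t : ℝ) (Z : Conf d s) :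
    |hsTransport ε t f Z| ≤ M * F (energy Z) := by
  by_cases hZ : Z ∈ flowDomain d s ε
  · rw [hsTransport_of_mem hZ, ← energy_hsFlow hε (-t) Z]
    exact hf _
  · rw [hsTransport_of_notMem hZ, abs_zero]
    exact mul_nonneg hM (hF _ (energy_nonneg Z))

/-- For almost every configuration and time the collision integrals only involve the values of the
integrand outside a given null set. -/
lemma ae_ae_collisionIntegrand_congr (hε : 0 < ε) {T : ℝ} {f g : ℝ → Conf d (s + 1) → ℝ}
    {N : Set (Conf d (s + 1))} (hN : phaseMeasure d ε (s + 1) N = 0)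
    (hfg : ∀ u ∈ Ioc 0 T, ∀ W ∉ N, f u W = g u W) :
    ∀ᵐ Z : Conf d s, ∀ᵐ u ∂(volume.restrict (Ioc 0 T)), ∀ i,
      collisionIntegrand ε (hsTransport ε u (f u)) (hsFlow ε u Z) i =ᵐ[adjunctionMeasure d]
        collisionIntegrand ε (hsTransport ε u (g u)) (hsFlow ε u Z) i := by
  have hN' : volume (N ∩ phaseSpace d ε (s + 1)) = 0 := by
    rw [phaseMeasure, Measure.restrict_apply' (isClosed_phaseSpace ε).measurableSet] at hN
    exact hN
  have h1 : ∀ᵐ q : ℝ × Conf d s, q.1 ∈ Ioc 0 T → ∀ i,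
      collisionIntegrand ε (hsTransport ε q.1 (f q.1)) q.2 i =ᵐ[adjunctionMeasure d]
        collisionIntegrand ε (hsTransport ε q.1 (g q.1)) q.2 i := by
    filter_upwards [ae_all_iff.2 fun i => ae_adjoin_hsFlow_notMem hε i hN'] with q hq hqT i
    filter_upwards [hq i] with p hp
    simp only [collisionIntegrand]
    -- Grazing contacts, excluded from the trace result, carry the factor zero in the integrand.
    by_cases hw : inner ℝ (p.1 : E d) (p.2 - (q.2 i).2) = (0 : ℝ)
    · rw [hw, zero_mul, zero_mul]
    congr 1
    set W := adjoin q.2 ((q.2 i).1 + ε • (p.1 : E d)) p.2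
    by_cases h2 : W ∈ phaseSpace d ε (s + 1)
    · rw [indicator_of_mem h2, indicator_of_mem h2]
      by_cases h3 : W ∈ flowDomain d (s + 1) ε
      · rw [hsTransport_of_mem h3, hsTransport_of_mem h3]
        refine hfg _ hqT _ fun h4 => ?_
        exact hp hqT.1 hw h3 ⟨h4, hsFlow_mem_phaseSpace hε h3 _⟩
      · rw [hsTransport_of_notMem h3, hsTransport_of_notMem h3]
    · rw [indicator_of_notMem h2, indicator_of_notMem h2]
  obtain ⟨B, hB1, hB2, hB3⟩ := exists_measurable_superset_of_null h1
  -- The collision is evaluated at the configuration moved by the flow. Almost every time slice of B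
  -- is null and is pulled back by the flow to a null set; Fubini then exchanges time and
  -- configuration, which requires A measurable.
  let A : Set (ℝ × Conf d s) := {q | (q.1, hsFlow ε q.1 q.2) ∈ B}
  have hA : MeasurableSet A := (measurable_fst.prodMk (measurable_hsFlow hε)) hB2
  have h2 : ∀ᵐ u : ℝ, ∀ᵐ Z : Conf d s, (u, Z) ∉ A := by
    have h3 := Measure.measure_ae_null_of_prod_null
      (μ := (volume : Measure ℝ)) (ν := (volume : Measure (Conf d s))) hB3
    filter_upwards [h3] with u hu
    exact measure_eq_zero_iff_ae_notMem.1
      (volume_hsFlow_preimage hε u (N := Prod.mk u ⁻¹' B) hu)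
  have h3 : ∀ᵐ Z : Conf d s, ∀ᵐ u : ℝ, (u, Z) ∉ A :=
    (Measure.ae_ae_comm (p := fun u Z => (u, Z) ∉ A) hA.compl).1 h2
  filter_upwards [h3] with Z hZ
  filter_upwards [ae_restrict_of_ae hZ, ae_restrict_mem measurableSet_Ioc] with u hu huT
  by_contra hc
  refine hu (hB1 ?_)
  simp only [mem_compl_iff, mem_ofPred_eq]
  intro h
  exact hc (h huT)

/-- The transport-collision term of a left-continuous family, in a measurable version. -/
lemma exists_measurable_conjugatedCollision {N : ℕ} (hε : 0 < ε)
    (hNε : (N : ℝ) * ε ^ (d - 1) = 1) (hs : s ≤ N) {T M b : ℝ} (hM : 0 ≤ M) (hb0 : 0 < b)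
    {β : ℝ → ℝ} (hβ : Continuous β) (hb : ∀ t ∈ Icc 0 T, b ≤ β t) {h : ℝ → Linf d ε (s + 1)}
    (hlc : ∀ t ∈ Ioc 0 T, Tendsto (fun u => ‖h t - h u‖) (𝓝[<] t) (𝓝 0))
    (hbd : ∀ t ∈ Icc 0 T, ∀ᵐ Z ∂(phaseMeasure d ε (s + 1)), |h t Z| * gaussWeight (β t) Z ≤ M) :
    ∃ J : ℝ → Conf d s → ℝ, Measurable (Function.uncurry J) ∧
      (∀ u ∈ Ioc 0 T, ∀ Z, |J u Z| ≤ (s * M * velMass d b) * ((1 + √(energy Z)) *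
        Real.exp (-(β u / 2 * energy Z)))) ∧
      ∀ᵐ Z ∂(phaseMeasure d ε s), ∀ᵐ u ∂(volume.restrict (Ioc 0 T)),
        conjugatedCollision N u (h u) Z = J u Z ∧
        ∀ i, Integrable (collisionIntegrand ε (hsTransport ε u (lebesgueValue (h u)))
          (hsFlow ε u Z) i) (adjunctionMeasure d) := by
  obtain ⟨g, N₀, hg, hN₀, hgb, hgN⟩ := exists_measurable_lebesgueValue hβ hlc hbd
  have hT : Measurable (Function.uncurry fun u => hsTransport ε u (g u)) := by
    have := measurable_hsTransport hε hg 1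
    simp only [one_mul] at this
    exact this
  have hgb' : ∀ u ∈ Ioc 0 T, ∀ W, |hsTransport ε u (g u) W| ≤
      M * Real.exp (-(β u / 2 * energy W)) := by
    intro u hu W
    refine abs_hsTransport_le hε (F := fun x => Real.exp (-(β u / 2 * x)))
      (fun _ _ => (Real.exp_pos _).le) (fun W => ?_) hM u W
    have := hgb u hu W hM
    rw [gaussWeight_eq] at this
    rw [Real.exp_neg, ← div_eq_mul_inv, le_div_iff₀ (Real.exp_pos _)]
    exact this
  refine ⟨fun u => hsTransport ε (-u) (collision N ε (hsTransport ε u (g u))), ?_,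
    fun u hu Z => ?_, ?_⟩
  · have h1 := measurable_collision (ε := ε) N hT
    have := measurable_hsTransport hε (g := fun u => collision N ε (hsTransport ε u (g u))) h1 (-1)
    simp only [neg_one_mul] at this
    exact this
  · refine abs_hsTransport_le hε (F := fun x => (1 + √x) * Real.exp (-(β u / 2 * x)))
      (fun _ _ => by positivity) (fun W => ?_) (mul_nonneg (by positivity) (velMass_nonneg d b)) _ Z
    exact abs_collision_le hε hNε hs hM hb0 (hb u ⟨hu.1.le, hu.2⟩) (hgb' u hu) W
  · have h1 := ae_ae_collisionIntegrand_congr (s := s) hε hN₀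
      (f := fun u => lebesgueValue (h u)) hgN
    filter_upwards [ae_restrict_of_ae h1] with Z hZ
    filter_upwards [hZ, ae_restrict_mem measurableSet_Ioc] with u hu huT
    refine ⟨?_, fun i => ?_⟩
    · rw [conjugatedCollision]
      by_cases h2 : Z ∈ flowDomain d s ε
      · rw [hsTransport_of_mem h2, hsTransport_of_mem h2, neg_neg]
        simp only [collision]
        refine Finset.sum_congr rfl fun i _ => ?_
        rw [integral_congr_ae (hu i)]
      · rw [hsTransport_of_notMem h2, hsTransport_of_notMem h2]
    · refine Integrable.congr ?_ (hu i).symm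
      refine ((integrable_velWeight hb0).const_mul (M * (1 + √(energy (hsFlow ε u Z))) *
        Real.exp (-(β u / 2 * energy (hsFlow ε u Z))))).mono' ?_ (Eventually.of_forall fun p => ?_)
      · exact ((measurable_collisionIntegrand hT i).comp
          (measurable_const (a := (u, hsFlow ε u Z)).prodMk measurable_id)).aestronglyMeasurable
      · exact abs_collisionIntegrand_le hM (hb u ⟨huT.1.le, huT.2⟩) (hgb' u huT) _ i p

end Transport

/-! ### Solution of the BBGKY hierarchy -/

section BBGKY

variable {d s : ℕ} [NeZero d] {ε : ℝ}

lemma gaussWeight_mono {β β' : ℝ} (h : β ≤ β') (Z : Conf d s) :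
    gaussWeight β Z ≤ gaussWeight β' Z := by
  rw [gaussWeight_eq, gaussWeight_eq]
  apply Real.exp_le_exp.2
  have := energy_nonneg Z
  gcongr

lemma one_le_gaussWeight {β : ℝ} (h : 0 ≤ β) (Z : Conf d s) : 1 ≤ gaussWeight β Z :=
  Real.one_le_exp (mul_nonneg (by positivity) (energy_nonneg Z))

lemma normEps_le_ofReal_iff {β M : ℝ} (hM : 0 ≤ M) (h : Linf d ε s) :
    normEps β h ≤ ENNReal.ofReal M ↔
      ∀ᵐ Z ∂(phaseMeasure d ε s), |h Z| * gaussWeight β Z ≤ M := by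
  have key : ∀ Z : Conf d s, ‖h Z * gaussWeight β Z‖ₑ ≤ ENNReal.ofReal M ↔
      |h Z| * gaussWeight β Z ≤ M := by
    intro Z
    rw [← ofReal_norm, ENNReal.ofReal_le_ofReal_iff hM, norm_mul, Real.norm_eq_abs,
      Real.norm_of_nonneg (gaussWeight_pos β Z).le]
  rw [normEps, eLpNorm_exponent_top]
  constructor
  · intro h1
    filter_upwards [ae_le_eLpNormEssSup (f := fun Z => h Z * gaussWeight β Z)
      (μ := phaseMeasure d ε s)] with Z hZ
    exact (key Z).1 (hZ.trans h1)
  · intro h1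
    refine essSup_le_of_ae_le _ ?_
    filter_upwards [h1] with Z hZ
    exact (key Z).2 hZ

lemma ofReal_norm_le_normEps {β : ℝ} (hβ : 0 ≤ β) (h : Linf d ε s) :
    ENNReal.ofReal ‖h‖ ≤ normEps β h := by
  rw [Lp.norm_def, ENNReal.ofReal_toReal (Lp.eLpNorm_ne_top h), normEps]
  refine eLpNorm_mono fun Z => ?_
  rw [norm_mul, Real.norm_of_nonneg (gaussWeight_pos β Z).le]
  exact le_mul_of_one_le_right (norm_nonneg _) (one_le_gaussWeight hβ Z)

/-- Time-dependent classes in the weighted space, at one level of the hierarchy. -/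
structure WeightedPath (T : ℝ) (β : ℝ → ℝ) (h : ℝ → Linf d ε s) : Prop where
  bound : ∃ M, 0 ≤ M ∧ ∀ t ∈ Icc 0 T, ∀ᵐ Z ∂(phaseMeasure d ε s), |h t Z| * gaussWeight (β t) Z ≤ M
  left_cont : ∀ t ∈ Ioc 0 T, Tendsto (fun u => normEps (β t) (h t - h u)) (𝓝[<] t) (𝓝 0)

lemma WeightedPath.tendsto_norm {T : ℝ} {β : ℝ → ℝ} {h : ℝ → Linf d ε s}
    (hh : WeightedPath T β h) (hβ : ∀ t ∈ Icc 0 T, 0 ≤ β t) {t : ℝ} (ht : t ∈ Ioc 0 T) :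
    Tendsto (fun u => ‖h t - h u‖) (𝓝[<] t) (𝓝 0) := by
  have h1 : Tendsto (fun u => ENNReal.ofReal ‖h t - h u‖) (𝓝[<] t) (𝓝 0) :=
    tendsto_of_tendsto_of_tendsto_of_le_of_le tendsto_const_nhds (hh.left_cont t ht)
      (fun _ => zero_le) (fun u => ofReal_norm_le_normEps (hβ t ⟨ht.1.le, ht.2⟩) _)
  have h2 := (ENNReal.tendsto_toReal ENNReal.zero_ne_top).comp h1
  simpa [Function.comp_def] using h2

/-- Between times u and t the Gaussian weight loses exp(-lam E (t - u) / 2), which feeds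
`integral_sqrt_exp_le`. The resulting modulus vanishes as r → t and so also gives left-continuity.
-/
lemma abs_integral_mul_gaussWeight_le {lam β₀ C r t : ℝ} (hlam : 0 < lam) (hC : 0 ≤ C)
    (hrt : r ≤ t) {J : ℝ → ℝ} {Z : Conf d s} (hJ : ∀ u ∈ Ioc r t, |J u| ≤ C * ((1 + √(energy Z)) *
      Real.exp (-((β₀ - lam * u) / 2 * energy Z)))) :
    |∫ u in r..t, J u| * gaussWeight (β₀ - lam * t) Z ≤ C * ((t - r) + √(2 * (t - r) / lam)) := by
  have hw := gaussWeight_pos (β₀ - lam * t) Z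
  rw [← abs_of_pos hw, ← abs_mul, ← intervalIntegral.integral_mul_const, ← Real.norm_eq_abs]
  refine (intervalIntegral.norm_integral_le_of_norm_le hrt (g := fun u => C * ((1 + √(energy Z)) *
    Real.exp (-(lam * energy Z / 2 * (t - u))))) (Eventually.of_forall fun u hu => ?_)
    (Continuous.intervalIntegrable (by fun_prop) _ _)).trans ?_
  · rw [norm_mul, Real.norm_eq_abs, Real.norm_of_nonneg hw.le]
    refine (mul_le_mul_of_nonneg_right (hJ u hu) hw.le).trans (le_of_eq ?_)
    rw [gaussWeight_eq, mul_assoc, mul_assoc, ← Real.exp_add]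
    congr 3
    ring
  · rw [intervalIntegral.integral_const_mul]
    exact mul_le_mul_of_nonneg_left (integral_sqrt_exp_le hlam (energy_nonneg Z) hrt) hC

/-- One step of the hierarchy: integrating in time the transport-collision term. -/
lemma exists_weightedPath_integral {N : ℕ} (hε : 0 < ε) (hNε : (N : ℝ) * ε ^ (d - 1) = 1)
    (hs : s ≤ N) {T lam β₀ : ℝ} (hT : 0 < T) (hlam : 0 < lam) (hβ : 0 < β₀ - lam * T)
    {f : Linf d ε s} (hf : normEps β₀ f < ∞) {h : ℝ → Linf d ε (s + 1)}
    (hh : WeightedPath T (fun t => β₀ - lam * t) h) :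
    (∃ g : ℝ → Linf d ε s, WeightedPath T (fun t => β₀ - lam * t) g ∧
      ∀ t ∈ Icc 0 T, g t =ᵐ[phaseMeasure d ε s] fun Z =>
        f Z + ∫ u in (0 : ℝ)..t, conjugatedCollision N u (h u) Z) ∧
    ∀ t ∈ Icc 0 T, ∀ᵐ Z ∂(phaseMeasure d ε s),
      IntervalIntegrable (fun u => conjugatedCollision N u (h u) Z) volume 0 t ∧
      ∀ᵐ u ∂(volume.restrict (Ioc 0 t)), ∀ i,
        Integrable (collisionIntegrand ε (hsTransport ε u (lebesgueValue (h u)))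
          (hsFlow ε u Z) i) (adjunctionMeasure d) := by
  have hb : ∀ t ∈ Icc 0 T, β₀ - lam * T ≤ β₀ - lam * t := fun t ht => by
    have := mul_le_mul_of_nonneg_left ht.2 hlam.le
    linarith
  obtain ⟨M, hM, hMb⟩ := hh.bound
  obtain ⟨J, hJm, hJb, hJae⟩ := exists_measurable_conjugatedCollision hε hNε hs hM hβ
    (β := fun t => β₀ - lam * t) (by fun_prop) hb
    (fun t ht => hh.tendsto_norm (fun t ht => hβ.le.trans (hb t ht)) ht) hMb
  set C := s * M * velMass d (β₀ - lam * T) with hC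
  have hC0 : 0 ≤ C := mul_nonneg (by positivity) (velMass_nonneg d _)
  have hJint : ∀ t ∈ Icc 0 T, ∀ Z, IntervalIntegrable (fun u => J u Z) volume 0 t := by
    intro t ht Z
    rw [intervalIntegrable_iff_integrableOn_Ioc_of_le ht.1]
    refine Measure.integrableOn_of_bounded (M := C * (1 + √(energy Z))) (by simp)
      (hJm.comp (measurable_id.prodMk measurable_const)).aestronglyMeasurable ?_
    filter_upwards [ae_restrict_mem measurableSet_Ioc] with u hu
    have hu' : u ∈ Ioc 0 T := ⟨hu.1, hu.2.trans ht.2⟩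
    refine (hJb u hu' Z).trans ?_
    gcongr
    refine mul_le_of_le_one_right (by positivity) (Real.exp_le_one_iff.2 ?_)
    have := mul_nonneg (hβ.le.trans (hb u ⟨hu'.1.le, hu'.2⟩)) (energy_nonneg Z)
    linarith
  have hJae' : ∀ t ∈ Icc 0 T, ∀ᵐ Z ∂(phaseMeasure d ε s), ∀ᵐ u ∂(volume.restrict (Ioc 0 t)),
      conjugatedCollision N u (h u) Z = J u Z ∧
        ∀ i, Integrable (collisionIntegrand ε (hsTransport ε u (lebesgueValue (h u)))
          (hsFlow ε u Z) i) (adjunctionMeasure d) := by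
    intro t ht
    filter_upwards [hJae] with Z hZ
    exact ae_restrict_of_ae_restrict_of_subset (Ioc_subset_Ioc_right ht.2) hZ
  refine ⟨?_, fun t ht => ?_⟩
  swap
  · filter_upwards [hJae' t ht] with Z hZ
    refine ⟨?_, hZ.mono fun u hu => hu.2⟩
    have h1 := hJint t ht Z
    rw [intervalIntegrable_iff_integrableOn_Ioc_of_le ht.1] at h1 ⊢
    exact Integrable.congr h1 (hZ.mono fun u hu => hu.1.symm)
  let G : ℝ → Conf d s → ℝ := fun t Z => f Z + ∫ u in (0 : ℝ)..t, J u Z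
  have hGm : ∀ t, AEStronglyMeasurable (G t) (phaseMeasure d ε s) := by
    intro t
    refine (Lp.aestronglyMeasurable f).add ?_
    have h1 : StronglyMeasurable fun p : Conf d s × ℝ => J p.2 p.1 :=
      (hJm.comp (measurable_snd.prodMk measurable_fst)).stronglyMeasurable
    simp only [intervalIntegral]
    exact (h1.integral_prod_right.sub h1.integral_prod_right).aestronglyMeasurable
  obtain ⟨M₀, hM₀, hfM⟩ : ∃ M₀ : ℝ, 0 ≤ M₀ ∧ ∀ᵐ Z ∂(phaseMeasure d ε s),
      |f Z| * gaussWeight β₀ Z ≤ M₀ := by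
    refine ⟨(normEps β₀ f).toReal, ENNReal.toReal_nonneg, ?_⟩
    rw [← normEps_le_ofReal_iff ENNReal.toReal_nonneg, ENNReal.ofReal_toReal hf.ne]
  let B := M₀ + C * (T + √(2 * T / lam))
  have hGb : ∀ t ∈ Icc 0 T, ∀ᵐ Z ∂(phaseMeasure d ε s),
      |G t Z| * gaussWeight (β₀ - lam * t) Z ≤ B := by
    intro t ht
    filter_upwards [hfM] with Z hZ
    have h1 := abs_integral_mul_gaussWeight_le hlam hC0 ht.1 (J := fun u => J u Z)
      (fun u hu => hJb u ⟨hu.1, hu.2.trans ht.2⟩ Z)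
    have h2 : |f Z| * gaussWeight (β₀ - lam * t) Z ≤ M₀ := by
      refine le_trans ?_ hZ
      gcongr
      exact gaussWeight_mono (by have := mul_nonneg hlam.le ht.1; linarith) Z
    have h3 : C * ((t - 0) + √(2 * (t - 0) / lam)) ≤ C * (T + √(2 * T / lam)) := by
      rw [sub_zero]
      have := ht.2
      gcongr
    have h4 := mul_le_mul_of_nonneg_right (abs_add_le (f Z) (∫ u in (0 : ℝ)..t, J u Z))
      (gaussWeight_pos (β₀ - lam * t) Z).le
    simp only [G, B]
    linarith
  have hGp : ∀ t ∈ Icc 0 T, MemLp (G t) ∞ (phaseMeasure d ε s) := by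
    intro t ht
    refine memLp_top_of_bound (hGm t) B ?_
    filter_upwards [hGb t ht] with Z hZ
    refine le_trans ?_ hZ
    exact le_mul_of_one_le_right (norm_nonneg _) (one_le_gaussWeight (hβ.le.trans (hb t ht)) Z)
  classical
  let g : ℝ → Linf d ε s := fun t => if ht : t ∈ Icc 0 T then (hGp t ht).toLp (G t) else 0
  have hg : ∀ t ∈ Icc 0 T, g t =ᵐ[phaseMeasure d ε s] G t := by
    intro t ht
    simp only [g, dif_pos ht]
    exact MemLp.coeFn_toLp _
  refine ⟨g, ⟨⟨B, by positivity, fun t ht => ?_⟩, fun t ht => ?_⟩, fun t ht => ?_⟩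
  · filter_upwards [hg t ht, hGb t ht] with Z hZ1 hZ2
    rwa [hZ1]
  · have h1 : Tendsto (fun u => ENNReal.ofReal (C * ((t - u) + √(2 * (t - u) / lam)))) (𝓝[<] t)
        (𝓝 0) := by
      have h2 : Continuous fun u => C * ((t - u) + √(2 * (t - u) / lam)) := by fun_prop
      have h3 := ENNReal.tendsto_ofReal ((h2.tendsto t).mono_left (nhdsWithin_le_nhds (s := Iio t)))
      simpa using h3
    refine tendsto_of_tendsto_of_tendsto_of_le_of_le' tendsto_const_nhds h1
      (Eventually.of_forall fun _ => zero_le) ?_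
    filter_upwards [Ioo_mem_nhdsLT ht.1] with u hu
    have ht' : t ∈ Icc 0 T := ⟨ht.1.le, ht.2⟩
    have hu' : u ∈ Icc 0 T := ⟨hu.1.le, hu.2.le.trans ht.2⟩
    have hut : 0 ≤ t - u := by linarith [hu.2]
    rw [normEps_le_ofReal_iff (mul_nonneg hC0 (by positivity))]
    filter_upwards [hg t ht', hg u hu', Lp.coeFn_sub (g t) (g u)] with Z h1 h2 h3
    rw [h3, Pi.sub_apply, h1, h2]
    simp only [G]
    -- In the conjugated formulation the datum is constant in time, so only the integral over [u, t]
    -- is left.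
    rw [add_sub_add_left_eq_sub, intervalIntegral.integral_interval_sub_left (hJint t ht' Z)
      (hJint u hu' Z)]
    exact abs_integral_mul_gaussWeight_le hlam hC0 hu.2.le (J := fun u => J u Z)
      (fun r hr => hJb r ⟨hu.1.trans hr.1, hr.2.trans ht.2⟩ Z)
  · filter_upwards [hg t ht, hJae' t ht] with Z h1 h2
    rw [h1]
    simp only [G]
    congr 1
    refine intervalIntegral.integral_congr_ae_restrict ?_
    rw [uIoc_of_le ht.1]
    exact h2.mono fun u hu => hu.1.symm

variable {N : ℕ}

/-- There are finitely many levels, so bounds that depend on the level can be summed; the weight in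
μ is largest at time 0. -/
lemma inXTilde_of_weightedPath {T lam β₀ μ₀ : ℝ} (hlam : 0 ≤ lam) {H : ℝ → BBGKYSeq d ε N}
    (hH : ∀ k, WeightedPath T (fun t => β₀ - lam * t) fun t => H t k) :
    InXTildeBBGKY T (fun t => β₀ - lam * t) (fun t => μ₀ - lam * t) H := by
  choose M hM hMb using fun k => (hH k).bound
  have h1 : ∀ t ∈ Icc 0 T, ∀ k, normEps (β₀ - lam * t) (H t k) ≤ ENNReal.ofReal (M k) :=
    fun t ht k => (normEps_le_ofReal_iff (hM k) _).2 (hMb k t ht)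
  have h2 : ∀ t ∈ Icc 0 T, normBBGKY (β₀ - lam * t) (μ₀ - lam * t) (H t) ≤
      ∑ k, ENNReal.ofReal (M k) * ENNReal.ofReal (Real.exp (((k : ℕ) + 1 : ℝ) * μ₀)) := by
    intro t ht
    refine iSup_le fun k => ?_
    refine le_trans ?_ (Finset.single_le_sum (f := fun k : Fin N => ENNReal.ofReal (M k) *
      ENNReal.ofReal (Real.exp (((k : ℕ) + 1 : ℝ) * μ₀))) (fun _ _ => zero_le)
      (Finset.mem_univ k))
    refine mul_le_mul' (h1 t ht k) (ENNReal.ofReal_le_ofReal (Real.exp_le_exp.2 ?_))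
    have := mul_nonneg hlam ht.1
    gcongr
    linarith
  have h3 : ∑ k, ENNReal.ofReal (M k) * ENNReal.ofReal (Real.exp (((k : ℕ) + 1 : ℝ) * μ₀)) < ∞ :=
    ENNReal.sum_lt_top.2 fun k _ => ENNReal.mul_lt_top ENNReal.ofReal_lt_top ENNReal.ofReal_lt_top
  exact ⟨fun t ht => ⟨fun k => (h1 t ht k).trans_lt ENNReal.ofReal_lt_top, (h2 t ht).trans_lt h3⟩,
    (iSup₂_le h2).trans_lt h3, fun t ht k => (hH k).left_cont t ht⟩

/-- The equation, the bounds and the convergence of the integrals at one level of the BBGKY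
hierarchy. -/
def SolvesBBGKYAt (T : ℝ) (β : ℝ → ℝ) (F₀ : BBGKYSeq d ε N) (H : ℝ → BBGKYSeq d ε N)
    (k : Fin N) : Prop :=
  WeightedPath T β (fun t => H t k) ∧
  (∀ t ∈ Icc 0 T, H t k =ᵐ[phaseMeasure d ε (k + 1)] bbgkyOperator F₀ H t k) ∧
  ∀ t ∈ Icc 0 T, ∀ hk : (k : ℕ) + 1 < N, ∀ᵐ Z ∂(phaseMeasure d ε (k + 1)),
    IntervalIntegrable (fun u => conjugatedCollision N u (H u ⟨k + 1, hk⟩) Z) volume 0 t ∧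
    ∀ᵐ u ∂(volume.restrict (Ioc 0 t)), ∀ i,
      Integrable (collisionIntegrand ε
        (hsTransport ε u (lebesgueValue (H u ⟨k + 1, hk⟩))) (hsFlow ε u Z) i)
        (adjunctionMeasure d)

/-- The equation at level k involves only levels k and k + 1, so lower levels may be filled in later
without disturbing it. -/
lemma SolvesBBGKYAt.congr {T : ℝ} {β : ℝ → ℝ} {F₀ : BBGKYSeq d ε N} {H H' : ℝ → BBGKYSeq d ε N}
    {k : Fin N} (h : SolvesBBGKYAt T β F₀ H k) (hH : ∀ j, k ≤ j → ∀ t, H' t j = H t j) :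
    SolvesBBGKYAt T β F₀ H' k := by
  have h1 : ∀ hk : (k : ℕ) + 1 < N, ∀ t, H' t ⟨k + 1, hk⟩ = H t ⟨k + 1, hk⟩ :=
    fun hk => hH _ (Fin.le_def.2 (Nat.le_succ _))
  have h2 : ∀ t, H' t k = H t k := hH k le_rfl
  unfold SolvesBBGKYAt bbgkyOperator at h ⊢
  simp only [h1, h2]
  exact h

/-- The induction constructs the m highest levels. Each new level is an explicit integral of the one
above it, so neither smallness of T nor a fixed point is involved. -/
lemma exists_solvesBBGKYAt (hε : 0 < ε) (hNε : (N : ℝ) * ε ^ (d - 1) = 1)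
    {T lam β₀ : ℝ} (hT : 0 < T) (hlam : 0 < lam) (hβ : 0 < β₀ - lam * T)
    {F₀ : BBGKYSeq d ε N} (hF : ∀ k, normEps β₀ (F₀ k) < ∞) (m : ℕ) :
    ∃ H : ℝ → BBGKYSeq d ε N, ∀ k : Fin N, N ≤ k + m →
      SolvesBBGKYAt T (fun t => β₀ - lam * t) F₀ H k := by
  classical
  induction m with
  | zero => exact ⟨0, fun k hk => absurd k.2 (by omega)⟩
  | succ m ih =>
    obtain ⟨H, hH⟩ := ih
    by_cases hm : m + 1 ≤ N
    swap
    · exact ⟨H, fun k hk => hH k (by omega)⟩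
    -- The highest index not yet treated; it stands for s = N - m particles.
    let k₀ : Fin N := ⟨N - (m + 1), by omega⟩
    have extend : ∀ g : ℝ → Linf d ε (k₀ + 1),
        SolvesBBGKYAt T (fun t => β₀ - lam * t) F₀ (fun t => Function.update (H t) k₀ (g t)) k₀ →
        ∃ H : ℝ → BBGKYSeq d ε N, ∀ k : Fin N, N ≤ k + (m + 1) →
          SolvesBBGKYAt T (fun t => β₀ - lam * t) F₀ H k := by
      intro g hg
      refine ⟨fun t => Function.update (H t) k₀ (g t), fun k hk => ?_⟩
      by_cases hkk : k = k₀
      · rw [hkk]; exact hg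
      · have hk' : N ≤ k + m := by
          have : (k : ℕ) ≠ N - (m + 1) := fun h => hkk (Fin.ext h)
          omega
        refine (hH k hk').congr fun j hj t => Function.update_of_ne ?_ _ _
        rintro rfl
        have : (k : ℕ) ≤ N - (m + 1) := hj
        omega
    by_cases hk : (k₀ : ℕ) + 1 < N
    · have hs : (k₀ : ℕ) + 1 ≤ N := hk.le
      have hnext := hH ⟨k₀ + 1, hk⟩ (by simp only [k₀]; omega)
      obtain ⟨⟨g, hg1, hg2⟩, hg3⟩ := exists_weightedPath_integral hε hNε hs hT hlam hβ (hF k₀)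
        hnext.1
      have hne : (⟨k₀ + 1, hk⟩ : Fin N) ≠ k₀ := by
        intro h
        have := congrArg Fin.val h
        simp at this
      refine extend g ⟨?_, fun t ht => ?_, fun t ht hk' => ?_⟩
      · simpa using hg1
      · simp only [Function.update_self]
        filter_upwards [hg2 t ht] with Z hZ
        rw [hZ]
        simp only [bbgkyOperator, dif_pos hk, Function.update_of_ne hne]
      · simp only [Function.update_of_ne hne]
        exact hg3 t ht
    -- Here k₀ stands for s = N: there is no collision term and the solution keeps its datum.
    · refine extend (fun _ => F₀ k₀) ⟨?_, fun t ht => ?_, fun t ht hk' => absurd hk' hk⟩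
      · simp only [Function.update_self]
        refine ⟨⟨(normEps β₀ (F₀ k₀)).toReal, ENNReal.toReal_nonneg, fun t ht => ?_⟩, fun t ht => ?_⟩
        · have h1 := (normEps_le_ofReal_iff (β := β₀) ENNReal.toReal_nonneg (F₀ k₀)).1
            (ENNReal.ofReal_toReal (hF k₀).ne).ge
          filter_upwards [h1] with Z hZ
          refine le_trans ?_ hZ
          gcongr
          exact gaussWeight_mono (by have := mul_nonneg hlam.le ht.1; linarith) Z
        · have h1 : normEps (β₀ - lam * t) (F₀ k₀ - F₀ k₀) = 0 := by
            rw [← nonpos_iff_eq_zero, ← ENNReal.ofReal_zero, normEps_le_ofReal_iff le_rfl, sub_self]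
            filter_upwards [Lp.coeFn_zero ℝ ∞ (phaseMeasure d ε (k₀ + 1))] with Z hZ
            rw [hZ]; simp
          simp only [h1]
          exact tendsto_const_nhds
      · simp only [Function.update_self]
        refine Eventually.of_forall fun Z => ?_
        simp only [bbgkyOperator, dif_neg hk, add_zero]

/-- The top level is prescribed, and equality of classes at level k + 1 for all times makes the
integrands at level k identical. No estimate is needed. -/
lemma bbgky_unique {T : ℝ} {β μ : ℝ → ℝ} {F₀ : BBGKYSeq d ε N} {H H' : ℝ → BBGKYSeq d ε N}
    (hH : IsBBGKYSolution T β μ F₀ H) (hH' : IsBBGKYSolution T β μ F₀ H') (m : ℕ) :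
    ∀ k : Fin N, N ≤ k + m → ∀ t ∈ Icc 0 T, H' t k = H t k := by
  induction m with
  | zero => exact fun k hk => absurd k.2 (by omega)
  | succ m ih =>
    intro k hk t ht
    refine Lp.ext ?_
    filter_upwards [hH.fixed t ht k, hH'.fixed t ht k] with Z h1 h2
    rw [h1, h2, bbgkyOperator, bbgkyOperator]
    congr 1
    by_cases hk' : (k : ℕ) + 1 < N
    · rw [dif_pos hk', dif_pos hk']
      refine intervalIntegral.integral_congr fun u hu => ?_
      rw [uIcc_of_le ht.1] at hu
      simp only
      rw [ih ⟨k + 1, hk'⟩ (by simp only; omega) u ⟨hu.1, hu.2.trans ht.2⟩]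
    · rw [dif_neg hk', dif_neg hk']

/-- Existence and uniqueness for the BBGKY hierarchy. -/
theorem exists_unique_bbgky (hε : 0 < ε) (hNε : (N : ℝ) * ε ^ (d - 1) = 1)
    {T lam β₀ μ₀ : ℝ} (hT : 0 < T) (hlam : 0 < lam) (hβ : 0 < β₀ - lam * T)
    {F₀ : BBGKYSeq d ε N} (hF : F₀ ∈ XBBGKY d ε N β₀ μ₀) :
    ∃ H : ℝ → BBGKYSeq d ε N,
      IsBBGKYSolution T (fun t => β₀ - lam * t) (fun t => μ₀ - lam * t) F₀ H ∧
      BBGKYConverges T H ∧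
      ∀ H' : ℝ → BBGKYSeq d ε N,
        IsBBGKYSolution T (fun t => β₀ - lam * t) (fun t => μ₀ - lam * t) F₀ H' →
          EqOn H' H (Icc 0 T) := by
  obtain ⟨H, hH⟩ := exists_solvesBBGKYAt hε hNε hT hlam hβ hF.1 N
  have hH' : ∀ k, SolvesBBGKYAt T (fun t => β₀ - lam * t) F₀ H k :=
    fun k => hH k (Nat.le_add_left _ _)
  have hsol : IsBBGKYSolution T (fun t => β₀ - lam * t) (fun t => μ₀ - lam * t) F₀ H :=
    ⟨inXTilde_of_weightedPath hlam.le fun k => (hH' k).1, fun t ht k => (hH' k).2.1 t ht⟩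
  exact ⟨H, hsol, fun t ht k hk => (hH' k).2.2 t ht hk, fun H' h t ht =>
    funext fun k => bbgky_unique hsol h N k (Nat.le_add_left _ _) t ht⟩

end BBGKY

/-! ### Even extension of functions on the half-space -/

section Fold

variable {d s : ℕ} [NeZero d]

/-- The specular reflection as a linear isometry. -/
def reflectL (d : ℕ) [NeZero d] : E d ≃ₗᵢ[ℝ] E d where
  toFun := reflect
  invFun := reflect
  left_inv := reflect_reflect
  right_inv := reflect_reflect
  map_add' x y := by
    simp only [reflect, inner_add_left, mul_add, add_smul]; abel
  map_smul' c x := by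
    simp only [reflect, inner_smul_left, RingHom.id_apply, smul_sub, smul_smul]
    congr 2
    simp only [conj_trivial]
    ring
  norm_map' := norm_reflect

lemma continuous_reflect : Continuous (reflect : E d → E d) := (reflectL d).continuous

lemma inner_reflect_reflect (x y : E d) : inner ℝ (reflect x) (reflect y) = inner ℝ x y :=
  (reflectL d).inner_map_map x y

lemma reflect_add (x y : E d) : reflect (x + y) = reflect x + reflect y := (reflectL d).map_add x y

lemma reflect_sub (x y : E d) : reflect (x - y) = reflect x - reflect y := (reflectL d).map_sub x y

lemma reflect_smul (c : ℝ) (x : E d) : reflect (c • x) = c • reflect x := (reflectL d).map_smul c x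

lemma inner_reflect_e₁ (x : E d) : inner ℝ (reflect x) (e₁ d) = -inner ℝ x (e₁ d) := by
  rw [reflect, inner_sub_left, inner_smul_left, inner_e₁_self]
  simp only [conj_trivial]
  ring

lemma reflect_of_inner_eq_zero {x : E d} (hx : inner ℝ x (e₁ d) = (0 : ℝ)) : reflect x = x := by
  rw [reflect, hx]; simp

/-- Reflection of the position and of the velocity of the particles in `S`. -/
def reflOn (S : Finset (Fin s)) (Z : Conf d s) : Conf d s := fun i =>
  if i ∈ S then (reflect (Z i).1, reflect (Z i).2) else Z i

/-- Reflection of the position and of the velocity of particle `j`. -/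
def refl (j : Fin s) (Z : Conf d s) : Conf d s :=
  Function.update Z j (reflect (Z j).1, reflect (Z j).2)

open Classical in
/-- Reflection of the particles which are behind the wall. -/
def fold (Z : Conf d s) : Conf d s := fun i =>
  if 0 ≤ inner ℝ (Z i).1 (e₁ d) then Z i else (reflect (Z i).1, reflect (Z i).2)

/-- The reflected flow is straight motion followed by folding; on functions even in each particle
the folding is invisible. -/
lemma freeFlow_eq (t : ℝ) (Z : Conf d s) : freeFlow t Z = fold (drift t Z) := rfl

lemma reflOn_insert {S : Finset (Fin s)} {j : Fin s} (hj : j ∉ S) (Z : Conf d s) :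
    reflOn (insert j S) Z = refl j (reflOn S Z) := by
  funext i
  by_cases h : i = j
  · subst h; simp [reflOn, refl, hj]
  · simp [reflOn, refl, h]

lemma reflOn_empty (Z : Conf d s) : reflOn ∅ Z = Z := by funext i; simp [reflOn]

lemma continuous_reflOn (S : Finset (Fin s)) :
    Continuous (reflOn S : Conf d s → Conf d s) := by
  refine continuous_pi fun i => ?_
  by_cases h : i ∈ S
  · simp only [reflOn, if_pos h]
    exact (continuous_reflect.comp (by fun_prop)).prodMk (continuous_reflect.comp (by fun_prop))
  · simp only [reflOn, if_neg h]; fun_prop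

lemma exists_fold_eq (Z : Conf d s) : ∃ S, fold Z = reflOn S Z := by
  classical
  refine ⟨Finset.univ.filter fun i => ¬ 0 ≤ inner ℝ (Z i).1 (e₁ d), funext fun i => ?_⟩
  by_cases h : 0 ≤ inner ℝ (Z i).1 (e₁ d)
  · simp only [fold, reflOn, Finset.mem_filter_univ, not_true_eq_false, h, ↓reduceIte]
  · simp only [fold, reflOn, Finset.mem_filter_univ, h, not_false_eq_true, ↓reduceIte]

lemma fold_mem (Z : Conf d s) : fold Z ∈ halfPhase d s := by
  intro i
  by_cases h : 0 ≤ inner ℝ (Z i).1 (e₁ d)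
  · simp only [fold, h, ↓reduceIte]
  · simp only [fold, h, ↓reduceIte, inner_reflect_e₁]
    linarith

lemma fold_of_mem {Z : Conf d s} (hZ : Z ∈ halfPhase d s) : fold Z = Z := by
  funext i
  exact if_pos (hZ i)

lemma norm_reflOn (S : Finset (Fin s)) (Z : Conf d s) : ‖reflOn S Z‖ = ‖Z‖ := by
  have h : ∀ i, ‖reflOn S Z i‖ = ‖Z i‖ := fun i => by
    simp only [reflOn]
    split_ifs
    · simp only [Prod.norm_def, norm_reflect]
    · rfl
  have h' : ∀ i, ‖reflOn S Z i‖₊ = ‖Z i‖₊ := fun i => NNReal.eq (h i)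
  simp only [Pi.norm_def, h']

lemma energy_reflOn (S : Finset (Fin s)) (Z : Conf d s) : energy (reflOn S Z) = energy Z := by
  refine Finset.sum_congr rfl fun i _ => ?_
  simp only [reflOn]
  split_ifs
  · simp only [norm_reflect]
  · rfl

lemma norm_fold (Z : Conf d s) : ‖fold Z‖ = ‖Z‖ := by
  obtain ⟨S, hS⟩ := exists_fold_eq Z
  rw [hS, norm_reflOn]

lemma energy_fold (Z : Conf d s) : energy (fold Z) = energy Z := by
  obtain ⟨S, hS⟩ := exists_fold_eq Z
  rw [hS, energy_reflOn]

lemma isClosed_halfPhase : IsClosed (halfPhase d s) := by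
  simp only [halfPhase, ofPred_forall]
  exact isClosed_iInter fun i => isClosed_le continuous_const (by fun_prop)

/-- Continuous functions vanishing at infinity which are even in each particle. -/
structure IsEvenC0 (g : Conf d s → ℝ) : Prop where
  continuous : Continuous g
  vanish : Tendsto g (cocompact _) (𝓝 0)
  even : ∀ j Z, g (refl j Z) = g Z

lemma IsEvenC0.apply_reflOn {g : Conf d s → ℝ} (hg : IsEvenC0 g) (S : Finset (Fin s)) (Z : Conf d s) :
    g (reflOn S Z) = g Z := by
  induction S using Finset.induction_on with
  | empty => rw [reflOn_empty]
  | insert j S hj ih => rw [reflOn_insert hj, hg.even, ih]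

lemma IsEvenC0.apply_fold {g : Conf d s → ℝ} (hg : IsEvenC0 g) (Z : Conf d s) : g (fold Z) = g Z := by
  obtain ⟨S, hS⟩ := exists_fold_eq Z
  rw [hS, hg.apply_reflOn]

lemma ext₀_of_mem (f : C₀(halfPhase d s, ℝ)) {Z : Conf d s} (hZ : Z ∈ halfPhase d s) :
    ext₀ f Z = f ⟨Z, hZ⟩ :=
  Subtype.val_injective.extend_apply f 0 ⟨Z, hZ⟩

/-- The even extension of a function on the phase space of point particles. -/
def evenExt (f : C₀(halfPhase d s, ℝ)) : Conf d s → ℝ := fun Z => f ⟨fold Z, fold_mem Z⟩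

lemma ext₀_fold (f : C₀(halfPhase d s, ℝ)) (Z : Conf d s) : ext₀ f (fold Z) = evenExt f Z :=
  ext₀_of_mem f (fold_mem Z)

lemma ext₀_eq_evenExt (f : C₀(halfPhase d s, ℝ)) {Z : Conf d s} (hZ : Z ∈ halfPhase d s) :
    ext₀ f Z = evenExt f Z := by
  rw [← ext₀_fold, fold_of_mem hZ]

lemma evenExt_coe (f : C₀(halfPhase d s, ℝ)) (Z : halfPhase d s) : evenExt f Z = f Z := by
  rw [← ext₀_eq_evenExt f Z.2, ext₀_of_mem f Z.2]

/-- On the wall the reflection fixes positions, so reflecting a particle there changes only its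
velocity, and the boundary condition applies to one particle at a time. -/
lemma BoundaryCondition.ext₀_reflOn {f : C₀(halfPhase d s, ℝ)} (hf : BoundaryCondition f)
    {Z : Conf d s} (hZ : Z ∈ halfPhase d s) (S : Finset (Fin s))
    (hS : ∀ i ∈ S, inner ℝ (Z i).1 (e₁ d) = (0 : ℝ)) :
    reflOn S Z ∈ halfPhase d s ∧ ext₀ f (reflOn S Z) = ext₀ f Z := by
  induction S using Finset.induction_on with
  | empty => rw [reflOn_empty]; exact ⟨hZ, rfl⟩
  | insert j S hj ih =>
    obtain ⟨h1, h2⟩ := ih fun i hi => hS i (Finset.mem_insert_of_mem hi)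
    have h3 : reflOn S Z j = Z j := if_neg hj
    have h4 : inner ℝ (reflOn S Z j).1 (e₁ d) = (0 : ℝ) := by
      rw [h3]; exact hS j (Finset.mem_insert_self _ _)
    have h5 : refl j (reflOn S Z) =
        Function.update (reflOn S Z) j ((reflOn S Z j).1, reflect (reflOn S Z j).2) := by
      rw [refl, reflect_of_inner_eq_zero h4]
    rw [reflOn_insert hj]
    refine ⟨fun i => ?_, ?_⟩
    · by_cases hij : i = j
      · subst hij; simp only [refl, Function.update_self, inner_reflect_e₁, h4, neg_zero, le_refl]
      · simp only [refl, Function.update_of_ne hij]; exact h1 i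
    · rw [h5, ← hf _ h1 j h4, h2]

/-- The space is covered by finitely many closed sectors, given by the side of the wall on which
each particle lies. On each sector the extension is `f` after a fixed continuous reflection, and on
overlaps, where particles are on the wall, the boundary condition makes the expressions agree. Decay
at infinity holds because folding preserves the norm. -/
lemma isEvenC0_evenExt {f : C₀(halfPhase d s, ℝ)} (hf : BoundaryCondition f) :
    IsEvenC0 (evenExt f) := by
  classical
  have hsgn : ∀ (S : Finset (Fin s)) (Z : Conf d s),
      (∀ i, if i ∈ S then inner ℝ (Z i).1 (e₁ d) ≤ (0 : ℝ) else 0 ≤ inner ℝ (Z i).1 (e₁ d)) →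
      reflOn S Z ∈ halfPhase d s ∧ ext₀ f (reflOn S Z) = evenExt f Z := by
    intro S Z hZ
    -- Within its sector the reflection differs from folding only for particles of S lying on the
    -- wall.
    have h1 : reflOn S Z = reflOn (S.filter fun i => inner ℝ (Z i).1 (e₁ d) = (0 : ℝ)) (fold Z) := by
      funext i
      have hi := hZ i
      by_cases hS : i ∈ S
      · rw [if_pos hS] at hi
        by_cases h0 : inner ℝ (Z i).1 (e₁ d) = (0 : ℝ)
        · simp [reflOn, fold, hS, h0]
        · have : ¬ 0 ≤ inner ℝ (Z i).1 (e₁ d) := fun h => h0 (le_antisymm hi h)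
          simp [reflOn, fold, hS, h0, this]
      · rw [if_neg hS] at hi
        simp [reflOn, fold, hS, hi]
    rw [h1, ← ext₀_fold]
    refine hf.ext₀_reflOn (fold_mem Z) _ fun i hi => ?_
    have h0 := (Finset.mem_filter.1 hi).2
    simp [fold, h0]
  refine ⟨?_, ?_, fun j Z => ?_⟩
  · let A : Finset (Fin s) → Set (Conf d s) := fun S => {Z | ∀ i, if i ∈ S then
      inner ℝ (Z i).1 (e₁ d) ≤ (0 : ℝ) else 0 ≤ inner ℝ (Z i).1 (e₁ d)}
    have hA : ∀ S, IsClosed (A S) := by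
      intro S
      simp only [A, ofPred_forall]
      refine isClosed_iInter fun i => ?_
      split_ifs
      · exact isClosed_le (by fun_prop) continuous_const
      · exact isClosed_le continuous_const (by fun_prop)
    refine (locallyFinite_of_finite A).continuous ?_ hA fun S => ?_
    · refine eq_univ_of_forall fun Z => mem_iUnion.2
        ⟨Finset.univ.filter fun i => inner ℝ (Z i).1 (e₁ d) ≤ (0 : ℝ), fun i => ?_⟩
      by_cases h : inner ℝ (Z i).1 (e₁ d) ≤ (0 : ℝ)
      · simp [h]
      · simp [h, (not_le.1 h).le]
    · rw [continuousOn_iff_continuous_domRestrict]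
      have h1 : (A S).domRestrict (evenExt f) =
          fun Z : A S => f ⟨reflOn S Z, (hsgn S Z Z.2).1⟩ := by
        funext Z
        exact (hsgn S Z Z.2).2.symm.trans (ext₀_of_mem f _)
      rw [h1]
      exact f.continuous.comp (((continuous_reflOn S).comp continuous_subtype_val).subtype_mk _)
  · have h1 : Tendsto (fold : Conf d s → Conf d s) (cocompact _) (cocompact _) := by
      rw [← Metric.cobounded_eq_cocompact, ← comap_norm_atTop, tendsto_comap_iff]
      have : norm ∘ (fold : Conf d s → Conf d s) = norm := funext norm_fold
      rw [this]
      exact tendsto_comap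
    have h2 : Tendsto (fun Z : Conf d s => (⟨fold Z, fold_mem Z⟩ : halfPhase d s)) (cocompact _)
        (cocompact _) := by
      refine Tendsto.mono_right ?_ (comap_cocompact_le continuous_subtype_val)
      rw [tendsto_comap_iff]
      exact h1
    exact (zero_at_infty f).comp h2
  · by_cases h : ∀ i, if i ∈ (Finset.univ.filter fun i => inner ℝ (Z i).1 (e₁ d) ≤ (0 : ℝ)) then
      inner ℝ (Z i).1 (e₁ d) ≤ (0 : ℝ) else 0 ≤ inner ℝ (Z i).1 (e₁ d)
    swap
    · refine absurd (fun i => ?_) h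
      by_cases h : inner ℝ (Z i).1 (e₁ d) ≤ (0 : ℝ)
      · simp [h]
      · simp [h, (not_le.1 h).le]
    set S := Finset.univ.filter fun i => inner ℝ (Z i).1 (e₁ d) ≤ (0 : ℝ) with hS
    -- Reflecting particle j changes its side, which toggles its membership in S; the two
    -- reflections of j cancel.
    have hj : ∀ i, reflOn (symmDiff S {j}) (refl j Z) i = reflOn S Z i := by
      intro i
      by_cases hij : i = j
      · subst hij
        by_cases hi : i ∈ S
        · simp [reflOn, refl, Finset.mem_symmDiff, hi]
        · simp [reflOn, refl, Finset.mem_symmDiff, hi, reflect_reflect]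
      · simp [reflOn, refl, Finset.mem_symmDiff, hij]
    rw [← (hsgn S Z h).2, ← (hsgn (symmDiff S {j}) (refl j Z) fun i => ?_).2, funext hj]
    have hi := h i
    by_cases hij : i = j
    · subst hij
      by_cases hi' : i ∈ S
      · simp only [hi', if_true] at hi
        simp [Finset.mem_symmDiff, hi', refl, inner_reflect_e₁, hi]
      · simp only [hi', if_false] at hi
        simp [Finset.mem_symmDiff, hi', refl, inner_reflect_e₁, hi]
    · simpa [Finset.mem_symmDiff, hij, refl] using hi

/-- The restriction to the half-space of an even function. -/
def restrictHalf (g : Conf d s → ℝ) (hg : IsEvenC0 g) : C₀(halfPhase d s, ℝ) where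
  toFun Z := g Z
  continuous_toFun := hg.continuous.comp continuous_subtype_val
  zero_at_infty' := hg.vanish.comp isClosed_halfPhase.isClosedEmbedding_subtypeVal.tendsto_cocompact

@[simp] lemma restrictHalf_apply {g : Conf d s → ℝ} (hg : IsEvenC0 g) (Z : halfPhase d s) :
    restrictHalf g hg Z = g Z := rfl

lemma evenExt_restrictHalf {g : Conf d s → ℝ} (hg : IsEvenC0 g) :
    evenExt (restrictHalf g hg) = g := funext fun Z => hg.apply_fold Z

lemma boundaryCondition_restrictHalf {g : Conf d s → ℝ} (hg : IsEvenC0 g) :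
    BoundaryCondition (restrictHalf g hg) := by
  intro Z hZ i hi
  have h1 : refl i Z = Function.update Z i ((Z i).1, reflect (Z i).2) := by
    rw [refl, reflect_of_inner_eq_zero hi]
  have h2 : Function.update Z i ((Z i).1, reflect (Z i).2) ∈ halfPhase d s := by
    intro j
    by_cases hj : j = i
    · subst hj; simpa using hZ j
    · simpa [Function.update_of_ne hj] using hZ j
  rw [ext₀_of_mem _ hZ, ext₀_of_mem _ h2, restrictHalf_apply, restrictHalf_apply]
  exact (hg.even i Z).symm.trans (congrArg g h1)

lemma IsEvenC0.of_approx {g : Conf d s → ℝ}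
    (h : ∀ δ > 0, ∃ g', IsEvenC0 g' ∧ ∀ Z, |g Z - g' Z| ≤ δ) : IsEvenC0 g := by
  refine ⟨?_, ?_, fun j Z => ?_⟩
  · refine continuous_of_uniform_approx_of_continuous fun u hu => ?_
    obtain ⟨δ, hδ, hu⟩ := Metric.mem_uniformity_dist.1 hu
    obtain ⟨g', hg', hd⟩ := h (δ / 2) (half_pos hδ)
    exact ⟨g', hg'.continuous, fun Z => hu (by
      rw [Real.dist_eq]; linarith [hd Z])⟩
  · rw [Metric.tendsto_nhds]
    intro δ hδ
    obtain ⟨g', hg', hd⟩ := h (δ / 2) (half_pos hδ)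
    filter_upwards [Metric.tendsto_nhds.1 hg'.vanish (δ / 2) (half_pos hδ)] with Z hZ
    rw [Real.dist_eq, sub_zero] at hZ ⊢
    have := abs_sub_abs_le_abs_sub (g Z) (g' Z)
    linarith [hd Z]
  · refine eq_of_forall_dist_le fun δ hδ => ?_
    obtain ⟨g', hg', hd⟩ := h (δ / 2) (half_pos hδ)
    have h1 := hd (refl j Z)
    have h2 := hd Z
    rw [hg'.even, abs_sub_le_iff] at h1
    rw [abs_sub_le_iff] at h2
    rw [Real.dist_eq, abs_sub_le_iff]
    constructor <;> linarith

lemma IsEvenC0.add {g h : Conf d s → ℝ} (hg : IsEvenC0 g) (hh : IsEvenC0 h) :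
    IsEvenC0 fun Z => g Z + h Z :=
  ⟨hg.continuous.add hh.continuous, by simpa using hg.vanish.add hh.vanish, fun j Z => by
    rw [hg.even, hh.even]⟩

lemma drift_refl (τ : ℝ) (j : Fin s) (Z : Conf d s) :
    drift τ (refl j Z) = refl j (drift τ Z) := by
  funext i
  by_cases hij : i = j
  · subst hij
    simp [drift, refl, reflect_add, reflect_smul]
  · simp [drift, refl, hij]

lemma continuous_drift_left (τ : ℝ) : Continuous (drift τ : Conf d s → Conf d s) := by
  unfold drift; fun_prop

lemma tendsto_drift_cocompact (τ : ℝ) :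
    Tendsto (drift τ : Conf d s → Conf d s) (cocompact _) (cocompact _) := by
  have h1 : (drift (-τ) : Conf d s → Conf d s) ∘ drift τ = id := by
    funext Z; simp [drift_drift]
  refine Tendsto.mono_right (y := comap (drift (-τ)) (cocompact _)) ?_
    (comap_cocompact_le (continuous_drift_left (-τ)))
  rw [tendsto_comap_iff, h1]
  exact tendsto_id

lemma IsEvenC0.comp_drift {g : Conf d s → ℝ} (hg : IsEvenC0 g) (τ : ℝ) :
    IsEvenC0 fun Z => g (drift τ Z) :=
  ⟨hg.continuous.comp (continuous_drift_left τ), hg.vanish.comp (tendsto_drift_cocompact τ),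
    fun j Z => by rw [drift_refl, hg.even]⟩

end Fold

/-! ### The Boltzmann collision operator on even functions -/

section Collision

variable {d s : ℕ} [NeZero d]

open Pointwise in
-- The sphere measure of A is proportional to the volume of the cone over A, and a linear isometry
-- maps cones to cones and preserves volume.
lemma measurePreserving_sphere (L : E d ≃ₗᵢ[ℝ] E d)
    {φ : Metric.sphere (0 : E d) 1 → Metric.sphere (0 : E d) 1} (hφ : ∀ ω, (φ ω : E d) = L ω) :
    MeasurePreserving φ (volume : Measure (E d)).toSphere (volume : Measure (E d)).toSphere := by
  have hm : Measurable φ := by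
    refine Measurable.subtype_mk (p := fun x => x ∈ Metric.sphere (0 : E d) 1)
      (f := fun ω => (φ ω : E d)) ?_
    simp only [hφ]
    exact (L.continuous.comp continuous_subtype_val).measurable
  refine ⟨hm, Measure.ext fun A hA => ?_⟩
  rw [Measure.map_apply hm hA, Measure.toSphere_apply' _ (hm hA), Measure.toSphere_apply' _ hA]
  congr 1
  have h1 : (Ioo (0 : ℝ) 1 • (Subtype.val '' (φ ⁻¹' A)) : Set (E d)) =
      L ⁻¹' (Ioo (0 : ℝ) 1 • (Subtype.val '' A)) := by
    ext x
    simp only [Set.mem_smul, mem_preimage]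
    constructor
    · rintro ⟨r, hr, _, ⟨ω, hω, rfl⟩, rfl⟩
      exact ⟨r, hr, _, ⟨φ ω, hω, rfl⟩, by rw [hφ, map_smul]⟩
    · rintro ⟨r, hr, _, ⟨ω, hω, rfl⟩, hx⟩
      have h2 : L.symm ω ∈ Metric.sphere (0 : E d) 1 := by simp
      have h3 : φ ⟨L.symm ω, h2⟩ = ω := Subtype.ext (by rw [hφ]; simp)
      refine ⟨r, hr, _, ⟨⟨L.symm ω, h2⟩, by rwa [mem_preimage, h3], rfl⟩, L.injective ?_⟩
      rw [map_smul, ← hx, L.apply_symm_apply]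
  rw [h1]
  exact L.measurePreserving.measure_preimage_emb L.toHomeomorph.measurableEmbedding _

/-- Reflection of both the impact parameter and the velocity of an added particle. -/
def adjReflect (d : ℕ) [NeZero d] :
    Metric.sphere (0 : E d) 1 × E d ≃ₜ Metric.sphere (0 : E d) 1 × E d where
  toFun p := (⟨reflect p.1, by simp [norm_reflect]⟩, reflect p.2)
  invFun p := (⟨reflect p.1, by simp [norm_reflect]⟩, reflect p.2)
  left_inv p := by ext <;> simp [reflect_reflect]
  right_inv p := by ext <;> simp [reflect_reflect]
  continuous_toFun := by
    refine Continuous.prodMk (Continuous.subtype_mk (continuous_reflect.comp (by fun_prop)) _)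
      (continuous_reflect.comp (by fun_prop))
  continuous_invFun := by
    refine Continuous.prodMk (Continuous.subtype_mk (continuous_reflect.comp (by fun_prop)) _)
      (continuous_reflect.comp (by fun_prop))

lemma adjReflect_fst (p : Metric.sphere (0 : E d) 1 × E d) :
    ((adjReflect d p).1 : E d) = reflect (p.1 : E d) := rfl

lemma adjReflect_snd (p : Metric.sphere (0 : E d) 1 × E d) :
    (adjReflect d p).2 = reflect p.2 := rfl

lemma measurePreserving_adjReflect :
    MeasurePreserving (adjReflect d) (adjunctionMeasure d) (adjunctionMeasure d) := by
  have h1 : MeasurePreserving (fun ω : Metric.sphere (0 : E d) 1 =>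
      (⟨reflect ω, by simp [norm_reflect]⟩ : Metric.sphere (0 : E d) 1))
      (volume : Measure (E d)).toSphere (volume : Measure (E d)).toSphere :=
    measurePreserving_sphere (reflectL d) fun ω => rfl
  exact h1.prod (reflectL d).measurePreserving

/-- The configuration with an added particle after a collision with particle `i`. -/
def postCollision (Z : Conf d s) (i : Fin s) (p : Metric.sphere (0 : E d) 1 × E d) :
    Conf d (s + 1) :=
  adjoin (Function.update Z i
    ((Z i).1, (Z i).2 - inner ℝ ((Z i).2 - p.2) (p.1 : E d) • (p.1 : E d)))
    (Z i).1 (p.2 + inner ℝ ((Z i).2 - p.2) (p.1 : E d) • (p.1 : E d))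

lemma collisionIntegrand₀_eq (f : Conf d (s + 1) → ℝ) (Z : Conf d s) (i : Fin s)
    (p : Metric.sphere (0 : E d) 1 × E d) : collisionIntegrand₀ f Z i p =
      max (inner ℝ (p.1 : E d) (p.2 - (Z i).2)) 0 *
        (f (postCollision Z i p) - f (adjoin Z (Z i).1 p.2)) := rfl

lemma norm_sq_collision (v w ω : E d) (hω : ‖ω‖ = 1) :
    ‖v - inner ℝ (v - w) ω • ω‖ ^ 2 + ‖w + inner ℝ (v - w) ω • ω‖ ^ 2 = ‖v‖ ^ 2 + ‖w‖ ^ 2 := by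
  rw [norm_sub_sq_real, norm_add_sq_real, norm_smul, hω, inner_smul_right, inner_smul_right,
    inner_sub_left, mul_one, Real.norm_eq_abs, sq_abs]
  ring

lemma energy_update (Z : Conf d s) (i : Fin s) (x v : E d) :
    energy (Function.update Z i (x, v)) + ‖(Z i).2‖ ^ 2 = energy Z + ‖v‖ ^ 2 := by
  unfold energy
  rw [← Finset.add_sum_erase _ _ (Finset.mem_univ i), ← Finset.add_sum_erase (Finset.univ : Finset
    (Fin s)) (fun i => ‖(Z i).2‖ ^ 2) (Finset.mem_univ i), Function.update_self]
  have : ∑ j ∈ Finset.univ.erase i, ‖(Function.update Z i (x, v) j).2‖ ^ 2 =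
      ∑ j ∈ Finset.univ.erase i, ‖(Z j).2‖ ^ 2 :=
    Finset.sum_congr rfl fun j hj => by rw [Function.update_of_ne (Finset.ne_of_mem_erase hj)]
  rw [this]
  ring

lemma energy_postCollision (Z : Conf d s) (i : Fin s) (p : Metric.sphere (0 : E d) 1 × E d) :
    energy (postCollision Z i p) = energy Z + ‖p.2‖ ^ 2 := by
  rw [postCollision, energy_adjoin]
  have h1 := energy_update Z i (Z i).1
    ((Z i).2 - inner ℝ ((Z i).2 - p.2) (p.1 : E d) • (p.1 : E d))
  have h2 := norm_sq_collision (Z i).2 p.2 (p.1 : E d) (by simp)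
  linarith

lemma norm_le_norm_adjoin (Z : Conf d s) (x v : E d) : ‖Z‖ ≤ ‖adjoin Z x v‖ := by
  rw [pi_norm_le_iff_of_nonneg (norm_nonneg _)]
  intro j
  have := norm_le_pi_norm (adjoin Z x v) j.castSucc
  rwa [adjoin_castSucc] at this

/-- Conservation of energy bounds the old velocity of particle i by the two new ones, with a
constant √2 ≤ 2. Hence post-collisional configurations leave every compact set when `Z` does. -/
lemma norm_le_norm_postCollision (Z : Conf d s) (i : Fin s)
    (p : Metric.sphere (0 : E d) 1 × E d) : ‖Z‖ ≤ 2 * ‖postCollision Z i p‖ := by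
  rw [pi_norm_le_iff_of_nonneg (by positivity)]
  intro j
  have hj := norm_le_pi_norm (postCollision Z i p) j.castSucc
  have hl := norm_le_pi_norm (postCollision Z i p) (Fin.last s)
  have hn := norm_nonneg (postCollision Z i p)
  have ej : postCollision Z i p j.castSucc = Function.update Z i
    ((Z i).1, (Z i).2 - inner ℝ ((Z i).2 - p.2) (p.1 : E d) • (p.1 : E d)) j := adjoin_castSucc ..
  have el : postCollision Z i p (Fin.last s) =
    ((Z i).1, p.2 + inner ℝ ((Z i).2 - p.2) (p.1 : E d) • (p.1 : E d)) := adjoin_last ..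
  by_cases hij : j = i
  · subst hij
    rw [ej, Function.update_self, Prod.norm_def, sup_le_iff] at hj
    rw [el, Prod.norm_def, sup_le_iff] at hl
    rw [Prod.norm_def, sup_le_iff]
    refine ⟨by linarith [hj.1], ?_⟩
    have h2 := norm_sq_collision (Z j).2 p.2 (p.1 : E d) (by simp)
    refine abs_le_of_sq_le_sq' ?_ (by positivity) |>.2
    have h3 := pow_le_pow_left₀ (norm_nonneg _) hj.2 2
    have h4 := pow_le_pow_left₀ (norm_nonneg _) hl.2 2
    simp only at h3 h4
    nlinarith [sq_nonneg ‖p.2‖, sq_nonneg ‖postCollision Z j p‖]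
  · rw [ej, Function.update_of_ne hij] at hj
    linarith

lemma continuous_postCollision (i : Fin s) :
    Continuous fun z : Conf d s × (Metric.sphere (0 : E d) 1 × E d) =>
      postCollision z.1 i z.2 := by
  refine continuous_adjoin.comp (f := fun z : Conf d s × (Metric.sphere (0 : E d) 1 × E d) =>
    (Function.update z.1 i ((z.1 i).1, (z.1 i).2 -
      inner ℝ ((z.1 i).2 - z.2.2) (z.2.1 : E d) • (z.2.1 : E d)),
    (z.1 i).1, z.2.2 + inner ℝ ((z.1 i).2 - z.2.2) (z.2.1 : E d) • (z.2.1 : E d))) ?_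
  exact (Continuous.update continuous_fst i (by fun_prop)).prodMk (by fun_prop)

lemma continuous_collisionIntegrand₀ {f : Conf d (s + 1) → ℝ} (hf : Continuous f) (i : Fin s) :
    Continuous fun z : Conf d s × (Metric.sphere (0 : E d) 1 × E d) =>
      collisionIntegrand₀ f z.1 i z.2 := by
  have h1 : Continuous fun z : Conf d s × (Metric.sphere (0 : E d) 1 × E d) =>
      adjoin z.1 (z.1 i).1 z.2.2 :=
    continuous_adjoin.comp (f := fun z : Conf d s × (Metric.sphere (0 : E d) 1 × E d) =>
      (z.1, (z.1 i).1, z.2.2)) (by fun_prop)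
  simp only [collisionIntegrand₀_eq]
  exact Continuous.mul (by fun_prop)
    ((hf.comp (continuous_postCollision i)).sub (hf.comp h1))

lemma abs_collisionIntegrand₀_le {M b β : ℝ} (hM : 0 ≤ M) (hb : b ≤ β) {f : Conf d (s + 1) → ℝ}
    (hf : ∀ W, |f W| ≤ M * Real.exp (-(β / 2 * energy W))) (Z : Conf d s) (i : Fin s)
    (p : Metric.sphere (0 : E d) 1 × E d) : |collisionIntegrand₀ f Z i p| ≤
      (2 * M * (1 + ‖(Z i).2‖) * Real.exp (-(β / 2 * energy Z))) * velWeight b p.2 := by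
  rw [collisionIntegrand₀_eq, abs_mul]
  have h1 : |max (inner ℝ (p.1 : E d) (p.2 - (Z i).2)) 0| ≤ (1 + ‖(Z i).2‖) * (1 + ‖p.2‖) := by
    rw [abs_of_nonneg (le_max_right _ _)]
    exact max_le ((le_abs_self _).trans (abs_inner_sphere_le p.1 p.2 (Z i).2)) (by positivity)
  have h3 := mul_le_mul_of_nonneg_left (exp_adjoin_le hb Z p.2) hM
  have h4 := hf (postCollision Z i p)
  have h5 := hf (adjoin Z (Z i).1 p.2)
  rw [energy_postCollision] at h4
  rw [energy_adjoin] at h5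
  have h2 : |f (postCollision Z i p) - f (adjoin Z (Z i).1 p.2)| ≤
      2 * (M * (Real.exp (-(β / 2 * energy Z)) * Real.exp (-(b / 2 * ‖p.2‖ ^ 2)))) := by
    have := abs_sub (f (postCollision Z i p)) (f (adjoin Z (Z i).1 p.2))
    linarith
  calc _ ≤ ((1 + ‖(Z i).2‖) * (1 + ‖p.2‖)) * (2 *
        (M * (Real.exp (-(β / 2 * energy Z)) * Real.exp (-(b / 2 * ‖p.2‖ ^ 2))))) :=
        mul_le_mul h1 h2 (abs_nonneg _) (by positivity)
    _ = _ := by unfold velWeight; ring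

lemma integrable_collisionIntegrand₀ {M b : ℝ} (hM : 0 ≤ M) (hb : 0 < b)
    {f : Conf d (s + 1) → ℝ} (hc : Continuous f)
    (hf : ∀ W, |f W| ≤ M * Real.exp (-(b / 2 * energy W))) (Z : Conf d s) (i : Fin s) :
    Integrable (collisionIntegrand₀ f Z i) (adjunctionMeasure d) := by
  refine ((integrable_velWeight hb).const_mul _).mono' ?_
    (Eventually.of_forall fun p => abs_collisionIntegrand₀_le hM le_rfl hf Z i p)
  exact ((continuous_collisionIntegrand₀ hc i).comp
    (continuous_const.prodMk continuous_id)).aestronglyMeasurable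

/-- The sum over particles is kept in the bound: the contraction estimate needs a growth linear in s
+ E/2, uniformly in the level, whereas regularity at one fixed level can use the cruder square-root
form. -/
lemma abs_collision₀_le {M b β : ℝ} (hM : 0 ≤ M) (hb0 : 0 < b) (hb : b ≤ β)
    {f : Conf d (s + 1) → ℝ} (hf : ∀ W, |f W| ≤ M * Real.exp (-(β / 2 * energy W)))
    (Z : Conf d s) : |collision₀ f Z| ≤
      (2 * M * velMass d b) * (∑ i, (1 + ‖(Z i).2‖)) * Real.exp (-(β / 2 * energy Z)) := by
  refine (Finset.abs_sum_le_sum_abs _ _).trans ?_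
  rw [Finset.mul_sum, Finset.sum_mul]
  refine Finset.sum_le_sum fun i _ => ?_
  have h1 : |∫ p, collisionIntegrand₀ f Z i p ∂(adjunctionMeasure d)| ≤
      (2 * M * (1 + ‖(Z i).2‖) * Real.exp (-(β / 2 * energy Z))) * velMass d b := by
    rw [velMass, ← integral_const_mul, ← Real.norm_eq_abs]
    refine norm_integral_le_of_norm_le ((integrable_velWeight hb0).const_mul _)
      (Eventually.of_forall fun p => ?_)
    rw [Real.norm_eq_abs]
    exact abs_collisionIntegrand₀_le hM hb hf Z i p
  exact h1.trans (le_of_eq (by ring))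

/-- The right side is proportional to the rate s + E/2 at which the hierarchy weights decay in time.
-/
lemma sum_one_add_norm_le (Z : Conf d s) :
    ∑ i, (1 + ‖(Z i).2‖) ≤ 2 * (s + energy Z / 2) := by
  have h1 : ∑ i, (1 + ‖(Z i).2‖) ≤ ∑ i : Fin s, (2 + ‖(Z i).2‖ ^ 2) :=
    Finset.sum_le_sum fun i _ => by nlinarith [sq_nonneg (‖(Z i).2‖ - 1 / 2)]
  refine h1.trans (le_of_eq ?_)
  rw [Finset.sum_add_distrib, Finset.sum_const, Finset.card_univ, Fintype.card_fin, nsmul_eq_mul,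
    energy]
  ring

lemma sum_one_add_norm_le_sqrt (Z : Conf d s) :
    ∑ i, (1 + ‖(Z i).2‖) ≤ s * (1 + √(energy Z)) := by
  have h1 : ∑ i, (1 + ‖(Z i).2‖) ≤ ∑ _i : Fin s, (1 + √(energy Z)) :=
    Finset.sum_le_sum fun i _ => by linarith [norm_snd_le Z i]
  refine h1.trans (le_of_eq ?_)
  rw [Finset.sum_const, Finset.card_univ, Fintype.card_fin, nsmul_eq_mul]

lemma abs_collision₀_le_sqrt {M b β : ℝ} (hM : 0 ≤ M) (hb0 : 0 < b) (hb : b ≤ β)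
    {f : Conf d (s + 1) → ℝ} (hf : ∀ W, |f W| ≤ M * Real.exp (-(β / 2 * energy W)))
    (Z : Conf d s) : |collision₀ f Z| ≤
      (2 * M * velMass d b * s) * ((1 + √(energy Z)) * Real.exp (-(β / 2 * energy Z))) := by
  refine (abs_collision₀_le hM hb0 hb hf Z).trans ?_
  have h0 := velMass_nonneg d b
  calc _ ≤ (2 * M * velMass d b) * (s * (1 + √(energy Z))) * Real.exp (-(β / 2 * energy Z)) := by
        gcongr
        exact sum_one_add_norm_le_sqrt Z
    _ = _ := by ring

lemma sqrt_mul_exp_le {b β x : ℝ} (hb0 : 0 < b) (hb : b ≤ β) (hx : 0 ≤ x) :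
    (1 + √x) * Real.exp (-(β / 2 * x)) ≤ 2 + 1 / b := by
  have h1 : Real.exp (-(β / 2 * x)) ≤ Real.exp (-(b / 2 * x)) := by
    apply Real.exp_le_exp.2
    have : b / 2 * x ≤ β / 2 * x := by gcongr
    linarith
  have h2 : 1 + √x ≤ 2 + x / 2 := by nlinarith [Real.sq_sqrt hx, sq_nonneg (√x - 1)]
  have h3 := Real.add_one_le_exp (b / 2 * x)
  have h4 : 2 + x / 2 ≤ (2 + 1 / b) * Real.exp (b / 2 * x) := by
    have h5 : (2 + 1 / b) * (b / 2 * x + 1) ≤ (2 + 1 / b) * Real.exp (b / 2 * x) := by gcongr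
    have h6 : (2 + 1 / b) * (b / 2 * x + 1) = b * x + 2 + x / 2 + 1 / b := by field_simp; ring
    have h7 : 0 ≤ b * x := by positivity
    have h8 : 0 ≤ 1 / b := by positivity
    linarith
  calc (1 + √x) * Real.exp (-(β / 2 * x))
      ≤ (2 + x / 2) * Real.exp (-(b / 2 * x)) := mul_le_mul h2 h1 (Real.exp_pos _).le (by positivity)
    _ ≤ _ := by
        rw [Real.exp_neg, ← div_eq_mul_inv, div_le_iff₀ (Real.exp_pos _)]
        exact h4

lemma adjoin_refl (j : Fin s) (Z : Conf d s) (x v : E d) :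
    adjoin (refl j Z) x v = refl j.castSucc (adjoin Z x v) := by
  funext k
  refine Fin.lastCases ?_ (fun k => ?_) k
  · simp [refl, (Fin.castSucc_lt_last j).ne']
  · by_cases h : k = j
    · subst h; simp [refl]
    · have h' : k.castSucc ≠ j.castSucc := fun e => h (Fin.castSucc_injective _ e)
      simp [refl, h]

lemma adjoin_reflect (Z : Conf d s) (x v : E d) :
    adjoin Z (reflect x) (reflect v) = refl (Fin.last s) (adjoin Z x v) := by
  funext k
  refine Fin.lastCases ?_ (fun k => ?_) k
  · simp [refl]
  · simp [refl, (Fin.castSucc_lt_last k).ne]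

lemma refl_update_self (i : Fin s) (Z : Conf d s) (x v : E d) :
    refl i (Function.update Z i (x, v)) = Function.update Z i (reflect x, reflect v) := by
  simp [refl]

lemma refl_update_of_ne {i j : Fin s} (hij : i ≠ j) (Z : Conf d s) (y : E d × E d) :
    Function.update (refl j Z) i y = refl j (Function.update Z i y) := by
  simp only [refl, Function.update_of_ne hij.symm]
  rw [Function.update_comm hij]

lemma postCollision_refl_of_ne {i j : Fin s} (hij : i ≠ j) (Z : Conf d s)
    (p : Metric.sphere (0 : E d) 1 × E d) :
    postCollision (refl j Z) i p = refl j.castSucc (postCollision Z i p) := by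
  have h : refl j Z i = Z i := Function.update_of_ne hij _ _
  rw [postCollision, h, refl_update_of_ne hij, adjoin_refl, postCollision]

lemma postCollision_refl_self (i : Fin s) (Z : Conf d s)
    (p : Metric.sphere (0 : E d) 1 × E d) : postCollision (refl i Z) i (adjReflect d p) =
      refl (Fin.last s) (refl i.castSucc (postCollision Z i p)) := by
  have h : refl i Z i = (reflect (Z i).1, reflect (Z i).2) := Function.update_self _ _ _
  have h2 : ∀ y, Function.update (refl i Z) i y = Function.update Z i y := fun y => by
    simp [refl]
  rw [postCollision, h, adjReflect_fst, adjReflect_snd, ← reflect_sub, inner_reflect_reflect,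
    ← reflect_smul, ← reflect_sub, ← reflect_add, h2, ← refl_update_self, adjoin_refl,
    adjoin_reflect, postCollision]
  simp only [← adjoin_refl, ← adjoin_reflect]

/-- If the reflected particle is the colliding one, the impact direction and the added velocity are
reflected too; this preserves the measure and commutes with the collision law. Otherwise the
reflection passes directly to `f`. -/
lemma collision₀_refl {f : Conf d (s + 1) → ℝ} (hf : ∀ j Z, f (refl j Z) = f Z) (j : Fin s)
    (Z : Conf d s) : collision₀ f (refl j Z) = collision₀ f Z := by
  refine Finset.sum_congr rfl fun i _ => ?_
  by_cases hij : i = j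
  · subst hij
    rw [← measurePreserving_adjReflect.integral_comp (adjReflect d).measurableEmbedding]
    congr 1
    funext p
    have h : refl i Z i = (reflect (Z i).1, reflect (Z i).2) := Function.update_self _ _ _
    rw [collisionIntegrand₀_eq, collisionIntegrand₀_eq, postCollision_refl_self, hf, hf, h,
      adjReflect_fst, adjReflect_snd, adjoin_reflect, adjoin_refl, hf, hf, ← reflect_sub,
      inner_reflect_reflect]
  · congr 1
    funext p
    have h : refl j Z i = Z i := Function.update_of_ne hij _ _
    rw [collisionIntegrand₀_eq, collisionIntegrand₀_eq, postCollision_refl_of_ne hij, hf, h,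
      adjoin_refl, hf]

lemma isCountablyGenerated_cocompact_conf (d s : ℕ) :
    (cocompact (Conf d s)).IsCountablyGenerated := by
  rw [← Metric.cobounded_eq_cocompact, ← comap_norm_atTop]
  infer_instance

/-- Split |f| into two square roots: one tends to zero at infinity, the other carries half of the
Gaussian exponent and absorbs the growth in energy. -/
lemma IsEvenC0.vanish_mul_sqrt {M b : ℝ} (hM : 0 ≤ M) (hb : 0 < b) {f : Conf d s → ℝ}
    (hc : IsEvenC0 f) (hf : ∀ W, |f W| ≤ M * Real.exp (-(b / 2 * energy W))) :
    Tendsto (fun W => |f W| * (1 + √(energy W))) (cocompact _) (𝓝 0) := by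
  have h1 : Tendsto (fun W => √|f W| * (√M * (2 + 1 / (b / 2)))) (cocompact _) (𝓝 0) := by
    have := ((hc.vanish.abs).sqrt).mul_const (√M * (2 + 1 / (b / 2)))
    simpa using this
  refine tendsto_of_tendsto_of_tendsto_of_le_of_le tendsto_const_nhds h1
    (fun W => by positivity) fun W => ?_
  have h2 : √|f W| ≤ √M * Real.exp (-(b / 2 / 2 * energy W)) := by
    refine Real.sqrt_le_iff.2 ⟨by positivity, (hf W).trans (le_of_eq ?_)⟩
    rw [mul_pow, Real.sq_sqrt hM, ← Real.exp_nat_mul]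
    congr 2
    push_cast
    ring
  have h3 := sqrt_mul_exp_le (half_pos hb) le_rfl (energy_nonneg W)
  calc |f W| * (1 + √(energy W)) = √|f W| * (√|f W| * (1 + √(energy W))) := by
        rw [← mul_assoc, Real.mul_self_sqrt (abs_nonneg _)]
    _ ≤ √|f W| * (√M * Real.exp (-(b / 2 / 2 * energy W)) * (1 + √(energy W))) := by gcongr
    _ = √|f W| * (√M * ((1 + √(energy W)) * Real.exp (-(b / 2 / 2 * energy W)))) := by ring
    _ ≤ _ := by gcongr

/-- The collision operator maps even functions with Gaussian decay to even functions. -/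
lemma IsEvenC0.collision₀ {M b : ℝ} (hM : 0 ≤ M) (hb : 0 < b) {f : Conf d (s + 1) → ℝ}
    (hc : IsEvenC0 f) (hf : ∀ W, |f W| ≤ M * Real.exp (-(b / 2 * energy W))) :
    IsEvenC0 (Hierarchy.collision₀ f : Conf d s → ℝ) := by
  have hmeas : ∀ i (Z : Conf d s),
      AEStronglyMeasurable (collisionIntegrand₀ f Z i) (adjunctionMeasure d) := fun i Z =>
    ((continuous_collisionIntegrand₀ hc.continuous i).comp
      (continuous_const.prodMk continuous_id)).aestronglyMeasurable
  have hbd : ∀ i (Z : Conf d s) p, ‖collisionIntegrand₀ f Z i p‖ ≤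
      (2 * M * (2 + 1 / b)) * velWeight b p.2 := by
    intro i Z p
    refine (abs_collisionIntegrand₀_le hM le_rfl hf Z i p).trans ?_
    refine mul_le_mul_of_nonneg_right ?_ (velWeight_nonneg _ _)
    rw [mul_assoc]
    refine mul_le_mul_of_nonneg_left ?_ (by positivity)
    refine le_trans ?_ (sqrt_mul_exp_le hb le_rfl (energy_nonneg Z))
    gcongr
    exact norm_snd_le Z i
  refine ⟨?_, ?_, collision₀_refl hc.even⟩
  · refine continuous_finsetSum _ fun i _ => ?_
    exact continuous_of_dominated (hmeas i) (fun Z => Eventually.of_forall (hbd i Z))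
      ((integrable_velWeight hb).const_mul _) (Eventually.of_forall fun p =>
        (continuous_collisionIntegrand₀ hc.continuous i).comp (Continuous.prodMk_left p))
  · rw [← Finset.sum_const_zero (s := (Finset.univ : Finset (Fin s)))]
    refine tendsto_finsetSum _ fun i _ => ?_
    rw [← integral_zero (Metric.sphere (0 : E d) 1 × E d) ℝ (μ := adjunctionMeasure d)]
    have := isCountablyGenerated_cocompact_conf d s
    refine tendsto_integral_filter_of_dominated_convergence
      (fun p => (2 * M * (2 + 1 / b)) * velWeight b p.2) (Eventually.of_forall (hmeas i))
      (Eventually.of_forall fun Z => Eventually.of_forall (hbd i Z))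
      ((integrable_velWeight hb).const_mul _) (Eventually.of_forall fun p => ?_)
    have hnorm : Tendsto (fun Z : Conf d s => ‖Z‖) (cocompact _) atTop :=
      tendsto_norm_cocompact_atTop
    have t1 : Tendsto (fun Z : Conf d s => postCollision Z i p) (cocompact _) (cocompact _) := by
      rw [← Metric.cobounded_eq_cocompact (α := Conf d (s + 1)), ← comap_norm_atTop,
        tendsto_comap_iff]
      refine tendsto_atTop_mono (f := fun Z : Conf d s => ‖Z‖ / 2) (fun Z => ?_)
        (hnorm.atTop_div_const two_pos)
      have := norm_le_norm_postCollision Z i p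
      simp only [Function.comp_apply]
      linarith
    have t2 : Tendsto (fun Z : Conf d s => adjoin Z (Z i).1 p.2) (cocompact _) (cocompact _) := by
      rw [← Metric.cobounded_eq_cocompact (α := Conf d (s + 1)), ← comap_norm_atTop,
        tendsto_comap_iff]
      exact tendsto_atTop_mono (fun Z => norm_le_norm_adjoin Z _ _) hnorm
    have t0 := hc.vanish_mul_sqrt hM hb hf
    have t3 : Tendsto (fun Z : Conf d s => (1 + ‖p.2‖) *
        (|f (postCollision Z i p)| * (1 + √(energy (postCollision Z i p))) +
          |f (adjoin Z (Z i).1 p.2)| * (1 + √(energy (adjoin Z (Z i).1 p.2)))))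
        (cocompact _) (𝓝 0) := by
      simpa using ((t0.comp t1).add (t0.comp t2)).const_mul (1 + ‖p.2‖)
    refine squeeze_zero_norm (fun Z => ?_) t3
    -- Both configurations at which f is evaluated have energy E + |v|², so the velocity factor is
    -- absorbed into the decay of f at these points.
    have e1 : ‖(Z i).2‖ ≤ √(energy Z + ‖p.2‖ ^ 2) :=
      (norm_snd_le Z i).trans (Real.sqrt_le_sqrt (le_add_of_nonneg_right (by positivity)))
    rw [energy_postCollision, energy_adjoin, collisionIntegrand₀_eq, norm_mul, ← add_mul]
    have e2 : ‖max (inner ℝ (p.1 : E d) (p.2 - (Z i).2)) 0‖ ≤ (1 + ‖(Z i).2‖) * (1 + ‖p.2‖) := by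
      rw [Real.norm_of_nonneg (le_max_right _ _)]
      exact max_le ((le_abs_self _).trans (abs_inner_sphere_le p.1 p.2 (Z i).2)) (by positivity)
    have e3 := norm_sub_le (f (postCollision Z i p)) (f (adjoin Z (Z i).1 p.2))
    simp only [Real.norm_eq_abs] at e2 e3 ⊢
    calc _ ≤ ((1 + ‖(Z i).2‖) * (1 + ‖p.2‖)) *
          (|f (postCollision Z i p)| + |f (adjoin Z (Z i).1 p.2)|) :=
          mul_le_mul e2 e3 (abs_nonneg _) (by positivity)
      _ ≤ ((1 + √(energy Z + ‖p.2‖ ^ 2)) * (1 + ‖p.2‖)) *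
          (|f (postCollision Z i p)| + |f (adjoin Z (Z i).1 p.2)|) := by gcongr
      _ = _ := by ring

lemma collision₀_congr {f g : Conf d (s + 1) → ℝ} (hfg : ∀ W ∈ halfPhase d (s + 1), f W = g W)
    {Z : Conf d s} (hZ : Z ∈ halfPhase d s) (i : Fin s) :
    collisionIntegrand₀ f Z i = collisionIntegrand₀ g Z i := by
  have h1 : ∀ (Y : Conf d s) (x v : E d), Y ∈ halfPhase d s → 0 ≤ inner ℝ x (e₁ d) →
      adjoin Y x v ∈ halfPhase d (s + 1) := by
    intro Y x v hY hx k
    refine Fin.lastCases ?_ (fun k => ?_) k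
    · rwa [adjoin_last]
    · rw [adjoin_castSucc]; exact hY k
  funext p
  rw [collisionIntegrand₀_eq, collisionIntegrand₀_eq, hfg _ (h1 _ _ _ hZ (hZ i)), postCollision,
    hfg _ (h1 _ _ _ (fun k => ?_) (hZ i))]
  by_cases h : k = i
  · subst h; rw [Function.update_self]; exact hZ k
  · rw [Function.update_of_ne h]; exact hZ k

/-- Collisions move no position, so from a folded configuration f is evaluated only in the
half-space, where the zero extension and the even extension agree. Invariance under reflections then
removes the folding. -/
lemma collision₀_ext₀ {f : C₀(halfPhase d (s + 1), ℝ)} (hf : BoundaryCondition f) (Y : Conf d s) :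
    collision₀ (ext₀ f) (fold Y) = collision₀ (evenExt f) Y := by
  have h1 : collision₀ (ext₀ f) (fold Y) = collision₀ (evenExt f) (fold Y) := by
    unfold collision₀
    refine Finset.sum_congr rfl fun i _ => ?_
    rw [collision₀_congr (fun W hW => ext₀_eq_evenExt f hW) (fold_mem Y) i]
  rw [h1]
  obtain ⟨S, hS⟩ := exists_fold_eq Y
  rw [hS]
  clear h1 hS
  induction S using Finset.induction_on with
  | empty => rw [reflOn_empty]
  | insert j S hj ih =>
    rw [reflOn_insert hj, collision₀_refl (isEvenC0_evenExt hf).even, ih]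

end Collision

/-! ### The Duhamel formula for even functions -/

section Duhamel

variable {d s : ℕ} [NeZero d]

lemma abs_mul_gaussWeight_le_iff {x M β : ℝ} {Z : Conf d s} :
    |x| * gaussWeight β Z ≤ M ↔ |x| ≤ M * Real.exp (-(β / 2 * energy Z)) := by
  rw [gaussWeight_eq, Real.exp_neg, ← div_eq_mul_inv, le_div_iff₀ (Real.exp_pos _)]

lemma abs_integral_mul_le_of_exp_decay {J : ℝ → ℝ} {w K a r t : ℝ} (hw : 0 ≤ w) (hK : 0 ≤ K)
    (ha : 0 < a) (hrt : r ≤ t) (hJ : ∀ u ∈ Ioc r t, |J u| * w ≤ K * Real.exp (-(a * (t - u)))) :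
    |∫ u in r..t, J u| * w ≤ K / a := by
  rw [← abs_of_nonneg hw, ← abs_mul, ← intervalIntegral.integral_mul_const, ← Real.norm_eq_abs]
  refine (intervalIntegral.norm_integral_le_of_norm_le hrt
    (g := fun u => K * Real.exp (-(a * (t - u)))) (Eventually.of_forall fun u hu => ?_)
    (Continuous.intervalIntegrable (by fun_prop) _ _)).trans ?_
  · rw [norm_mul, Real.norm_eq_abs, Real.norm_of_nonneg hw]
    exact hJ u hu
  · rw [intervalIntegral.integral_const_mul, integral_exp_decay ha.ne', div_eq_mul_inv K,
      div_eq_mul_inv]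
    refine mul_le_mul_of_nonneg_left ?_ hK
    refine mul_le_of_le_one_left (by positivity) ?_
    linarith [Real.exp_pos (-(a * (t - r)))]

lemma collision₀_sub {M b : ℝ} (hM : 0 ≤ M) (hb : 0 < b) {f g : Conf d (s + 1) → ℝ}
    (hf : Continuous f) (hg : Continuous g)
    (hfM : ∀ W, |f W| ≤ M * Real.exp (-(b / 2 * energy W)))
    (hgM : ∀ W, |g W| ≤ M * Real.exp (-(b / 2 * energy W))) (Z : Conf d s) :
    collision₀ f Z - collision₀ g Z = collision₀ (fun W => f W - g W) Z := by
  simp only [collision₀]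
  rw [← Finset.sum_sub_distrib]
  refine Finset.sum_congr rfl fun i _ => ?_
  rw [← integral_sub (integrable_collisionIntegrand₀ hM hb hf hfM Z i)
    (integrable_collisionIntegrand₀ hM hb hg hgM Z i)]
  congr 1
  funext p
  rw [collisionIntegrand₀_eq, collisionIntegrand₀_eq, collisionIntegrand₀_eq]
  ring

/-- Time-dependent even functions in the weighted space, at one level of the hierarchy. -/
structure EvenPath (T lam β₀ : ℝ) (g : ℝ → Conf d s → ℝ) : Prop where
  even0 : ∀ t ∈ Icc 0 T, IsEvenC0 (g t)
  bound : ∃ M, 0 ≤ M ∧ ∀ t ∈ Icc 0 T, ∀ Z, |g t Z| * gaussWeight (β₀ - lam * t) Z ≤ M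
  left_cont : ∀ t ∈ Ioc 0 T, ∀ δ > 0, ∀ᶠ u in 𝓝[<] t, ∀ Z,
    |g t Z - g u Z| * gaussWeight (β₀ - lam * t) Z ≤ δ

variable {T lam β₀ : ℝ}

lemma eventually_mem_Icc {t : ℝ} (ht : t ∈ Ioc 0 T) : ∀ᶠ u in 𝓝[<] t, u ∈ Icc 0 T ∧ u < t := by
  filter_upwards [Ioo_mem_nhdsLT ht.1] with u hu
  exact ⟨⟨hu.1.le, hu.2.le.trans ht.2⟩, hu.2⟩

lemma EvenPath.of_approx (hlam : 0 ≤ lam) (hβ : 0 ≤ β₀ - lam * T) {g : ℝ → Conf d s → ℝ}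
    (h : ∀ δ > 0, ∃ g', EvenPath T lam β₀ g' ∧ ∀ t ∈ Icc 0 T, ∀ Z,
      |g t Z - g' t Z| * gaussWeight (β₀ - lam * t) Z ≤ δ) : EvenPath T lam β₀ g := by
  refine ⟨fun t ht => IsEvenC0.of_approx fun δ hδ => ?_, ?_, fun t ht δ hδ => ?_⟩
  · obtain ⟨g', hg', hd⟩ := h δ hδ
    refine ⟨g' t, hg'.even0 t ht, fun Z => le_trans ?_ (hd t ht Z)⟩
    have := mul_le_mul_of_nonneg_left ht.2 hlam
    exact le_mul_of_one_le_right (abs_nonneg _) (one_le_gaussWeight (by linarith) Z)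
  · obtain ⟨g', hg', hd⟩ := h 1 one_pos
    obtain ⟨M, hM, h1⟩ := hg'.bound
    refine ⟨M + 1, by positivity, fun t ht Z => ?_⟩
    have h2 := abs_add_le (g t Z - g' t Z) (g' t Z)
    rw [sub_add_cancel] at h2
    have := mul_le_mul_of_nonneg_right h2 (gaussWeight_pos (β₀ - lam * t) Z).le
    linarith [h1 t ht Z, hd t ht Z]
  · obtain ⟨g', hg', hd⟩ := h (δ / 3) (by positivity)
    filter_upwards [hg'.left_cont t ht (δ / 3) (by positivity), eventually_mem_Icc ht]
      with u h1 hu Z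
    have h2 := hd t ⟨ht.1.le, ht.2⟩ Z
    -- The weight decreases in time, so an error controlled at time u < t is controlled with the
    -- weight of time t.
    have h3 : |g u Z - g' u Z| * gaussWeight (β₀ - lam * t) Z ≤ δ / 3 := by
      refine le_trans ?_ (hd u hu.1 Z)
      gcongr
      exact gaussWeight_mono (by nlinarith [hu.2]) Z
    have h4 : |g t Z - g u Z| ≤ |g t Z - g' t Z| + |g' t Z - g' u Z| + |g u Z - g' u Z| := by
      rw [abs_sub_comm (g u Z)]
      have h5 := abs_add_three (g t Z - g' t Z) (g' t Z - g' u Z) (g' u Z - g u Z)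
      have h6 : g t Z - g' t Z + (g' t Z - g' u Z) + (g' u Z - g u Z) = g t Z - g u Z := by ring
      rwa [h6] at h5
    have := mul_le_mul_of_nonneg_right h4 (gaussWeight_pos (β₀ - lam * t) Z).le
    linarith [h1 Z]

/-- The solution at time `t` of the free transport equation with initial datum `f` and source the
collision term of `g`. -/
def duhamel (f : Conf d s → ℝ) (g : ℝ → Conf d (s + 1) → ℝ) (t : ℝ) (Z : Conf d s) : ℝ :=
  f (drift (-t) Z) + ∫ u in (0 : ℝ)..t, collision₀ (g u) (drift (-(t - u)) Z)

lemma sub_mul_le (hlam : 0 ≤ lam) {t : ℝ} (ht : t ∈ Icc 0 T) : β₀ - lam * T ≤ β₀ - lam * t := by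
  have := mul_le_mul_of_nonneg_left ht.2 hlam
  linarith

lemma exp_weight_le (hlam : 0 ≤ lam) {M : ℝ} (hM : 0 ≤ M) {t : ℝ} (ht : t ∈ Icc 0 T)
    {g : Conf d s → ℝ} (hg : ∀ Z, |g Z| * gaussWeight (β₀ - lam * t) Z ≤ M) (Z : Conf d s) :
    |g Z| ≤ M * Real.exp (-((β₀ - lam * T) / 2 * energy Z)) := by
  refine (abs_mul_gaussWeight_le_iff.1 (hg Z)).trans ?_
  have h1 := sub_mul_le (β₀ := β₀) hlam ht
  have h2 := energy_nonneg Z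
  gcongr

lemma EvenPath.isEvenC0_collision₀ (hlam : 0 ≤ lam) (hβ : 0 < β₀ - lam * T)
    {g : ℝ → Conf d (s + 1) → ℝ} (hg : EvenPath T lam β₀ g) {t : ℝ} (ht : t ∈ Icc 0 T) :
    IsEvenC0 (collision₀ (g t) : Conf d s → ℝ) := by
  obtain ⟨M, hM, h1⟩ := hg.bound
  exact (hg.even0 t ht).collision₀ hM hβ (exp_weight_le hlam hM ht (h1 t ht))

lemma EvenPath.abs_collision₀_le (hlam : 0 ≤ lam) (hβ : 0 < β₀ - lam * T)
    {g : ℝ → Conf d (s + 1) → ℝ} (hg : EvenPath T lam β₀ g) :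
    ∃ C, 0 ≤ C ∧ ∀ t ∈ Icc 0 T, ∀ Z : Conf d s, |collision₀ (g t) Z| ≤
      C * ((1 + √(energy Z)) * Real.exp (-((β₀ - lam * t) / 2 * energy Z))) := by
  obtain ⟨M, hM, h1⟩ := hg.bound
  refine ⟨2 * M * velMass d (β₀ - lam * T) * s,
    by have := velMass_nonneg d (β₀ - lam * T); positivity, fun t ht Z => ?_⟩
  exact abs_collision₀_le_sqrt hM hβ (sub_mul_le hlam ht)
    (fun W => abs_mul_gaussWeight_le_iff.1 (h1 t ht W)) Z

/-- The increment splits into the change of the function at a fixed point, small by the weighted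
bound on the collision operator, and the change of the point for the fixed function at time t, small
by continuity. -/
lemma EvenPath.tendsto_collision₀ (hlam : 0 ≤ lam) (hβ : 0 < β₀ - lam * T)
    {g : ℝ → Conf d (s + 1) → ℝ} (hg : EvenPath T lam β₀ g) {Y : ℝ → Conf d s}
    (hY : Continuous Y) {t : ℝ} (ht : t ∈ Ioc 0 T) :
    Tendsto (fun u => collision₀ (g u) (Y u)) (𝓝[<] t) (𝓝 (collision₀ (g t) (Y t))) := by
  have ht' : t ∈ Icc 0 T := ⟨ht.1.le, ht.2⟩
  set b := β₀ - lam * T with hb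
  set K := 2 * velMass d b * s * (2 + 1 / b) with hK
  have hK0 : 0 ≤ K := by have := velMass_nonneg d b; positivity
  obtain ⟨M, hM, h1⟩ := hg.bound
  have hc := ((hg.isEvenC0_collision₀ hlam hβ ht').continuous.comp hY).tendsto t
  rw [Metric.tendsto_nhds]
  intro η hη
  -- K may vanish, hence the added 1.
  have hδ : 0 < η / (2 * (K + 1)) := by positivity
  filter_upwards [hg.left_cont t ht _ hδ, eventually_mem_Icc ht,
    nhdsWithin_le_nhds (Metric.tendsto_nhds.1 hc (η / 2) (half_pos hη))] with u h2 hu h3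
  rw [Real.dist_eq] at h3 ⊢
  simp only [Function.comp_apply] at h3
  have h4 := collision₀_sub hM hβ (hg.even0 t ht').continuous (hg.even0 u hu.1).continuous
    (exp_weight_le hlam hM ht' (h1 t ht')) (exp_weight_le hlam hM hu.1 (h1 u hu.1)) (Y u)
  have h5 := abs_collision₀_le_sqrt hδ.le hβ le_rfl (exp_weight_le hlam hδ.le ht' h2) (Y u)
  rw [← h4] at h5
  have h6 := sqrt_mul_exp_le hβ le_rfl (energy_nonneg (Y u))
  have h7 : |collision₀ (g t) (Y u) - collision₀ (g u) (Y u)| ≤ K * (η / (2 * (K + 1))) := by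
    refine h5.trans ?_
    have h0 := velMass_nonneg d b
    refine (mul_le_mul_of_nonneg_left h6 (by positivity)).trans (le_of_eq ?_)
    rw [hK]; ring
  have h8 : K * (η / (2 * (K + 1))) < η / 2 := by
    rw [mul_div_assoc', div_lt_div_iff₀ (by positivity) two_pos]
    nlinarith
  have h9 := abs_sub_le (collision₀ (g u) (Y u)) (collision₀ (g t) (Y u)) (collision₀ (g t) (Y t))
  rw [abs_sub_comm (collision₀ (g u) (Y u)) (collision₀ (g t) (Y u))] at h9
  linarith

lemma EvenPath.intervalIntegrable_collision₀ (hlam : 0 ≤ lam) (hβ : 0 < β₀ - lam * T)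
    {g : ℝ → Conf d (s + 1) → ℝ} (hg : EvenPath T lam β₀ g) {Y : ℝ → Conf d s}
    (hY : Continuous Y) {r t : ℝ} (hr : r ∈ Icc 0 T) (ht : t ∈ Icc 0 T) :
    IntervalIntegrable (fun u => collision₀ (g u) (Y u)) volume r t := by
  obtain ⟨C, hC, h1⟩ := hg.abs_collision₀_le (s := s) hlam hβ
  have h2 : IntegrableOn (fun u => collision₀ (g u) (Y u)) (Ioc 0 T) := by
    refine Integrable.of_bound ?_ (C * (2 + 1 / (β₀ - lam * T))) ?_
    · exact (aemeasurable_of_leftCont fun u hu =>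
        hg.tendsto_collision₀ hlam hβ hY hu).aestronglyMeasurable
    · filter_upwards [ae_restrict_mem measurableSet_Ioc] with u hu
      have hu' : u ∈ Icc 0 T := ⟨hu.1.le, hu.2⟩
      refine (h1 u hu' (Y u)).trans (mul_le_mul_of_nonneg_left ?_ hC)
      exact sqrt_mul_exp_le hβ (sub_mul_le hlam hu') (energy_nonneg _)
  exact ⟨h2.mono_set (Ioc_subset_Ioc hr.1 ht.2), h2.mono_set (Ioc_subset_Ioc ht.1 hr.2)⟩

lemma continuous_drift_time (t : ℝ) (Z : Conf d s) : Continuous fun u => drift (-(t - u)) Z := by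
  unfold drift; fun_prop

lemma isEvenC0_duhamel (hlam : 0 ≤ lam) (hβ : 0 < β₀ - lam * T) {f : Conf d s → ℝ}
    (hf : IsEvenC0 f) {g : ℝ → Conf d (s + 1) → ℝ} (hg : EvenPath T lam β₀ g) {t : ℝ}
    (ht : t ∈ Icc 0 T) : IsEvenC0 (duhamel f g t) := by
  obtain ⟨C, hC, h1⟩ := hg.abs_collision₀_le (s := s) hlam hβ
  have hev : ∀ u ∈ uIoc 0 t, u ∈ Icc 0 T := fun u hu => by
    rw [uIoc_of_le ht.1] at hu
    exact ⟨hu.1.le, hu.2.trans ht.2⟩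
  have hmeas : ∀ Z, AEStronglyMeasurable (fun u => collision₀ (g u) (drift (-(t - u)) Z))
      (volume.restrict (uIoc 0 t)) := fun Z =>
    (intervalIntegrable_iff.1 (hg.intervalIntegrable_collision₀ hlam hβ (continuous_drift_time t Z)
      ⟨le_rfl, ht.1.trans ht.2⟩ ht)).aestronglyMeasurable
  have hbd : ∀ Z, ∀ᵐ u, u ∈ uIoc 0 t → ‖collision₀ (g u) (drift (-(t - u)) Z)‖ ≤
      C * (2 + 1 / (β₀ - lam * T)) := fun Z => Eventually.of_forall fun u hu =>
    (h1 u (hev u hu) _).trans (mul_le_mul_of_nonneg_left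
      (sqrt_mul_exp_le hβ (sub_mul_le hlam (hev u hu)) (energy_nonneg _)) hC)
  have hcol : ∀ u ∈ uIoc 0 t, IsEvenC0 fun Z : Conf d s => collision₀ (g u) (drift (-(t - u)) Z) :=
    fun u hu => (hg.isEvenC0_collision₀ hlam hβ (hev u hu)).comp_drift _
  refine (hf.comp_drift (-t)).add ⟨?_, ?_, fun j Z => ?_⟩
  · exact intervalIntegral.continuous_of_dominated_interval hmeas hbd intervalIntegrable_const
      (Eventually.of_forall fun u hu => (hcol u hu).continuous)
  · have := isCountablyGenerated_cocompact_conf d s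
    have h2 := intervalIntegral.tendsto_integral_filter_of_dominated_convergence
      (l := cocompact (Conf d s)) (f := fun _ => (0 : ℝ)) (fun _ => C * (2 + 1 / (β₀ - lam * T)))
      (Eventually.of_forall hmeas) (Eventually.of_forall hbd) intervalIntegrable_const
      (Eventually.of_forall fun u hu => (hcol u hu).vanish)
    simpa using h2
  · refine intervalIntegral.integral_congr_ae (Eventually.of_forall fun u hu => ?_)
    exact (hcol u hu).even j Z

/-- The semigroup property read along a free trajectory: moving the point with the flow leaves only
the sources emitted between the two times. -/
lemma duhamel_eq_add (hlam : 0 ≤ lam) (hβ : 0 < β₀ - lam * T) (f : Conf d s → ℝ)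
    {g : ℝ → Conf d (s + 1) → ℝ} (hg : EvenPath T lam β₀ g) {u t : ℝ}
    (hu : u ∈ Icc 0 T) (ht : t ∈ Icc 0 T) (Z : Conf d s) :
    duhamel f g t (drift (t - u) Z) =
      duhamel f g u Z + ∫ r in u..t, collision₀ (g r) (drift (r - u) Z) := by
  have h0 : (0 : ℝ) ∈ Icc 0 T := ⟨le_rfl, ht.1.trans ht.2⟩
  have hY : Continuous fun r : ℝ => drift (r - u) Z := by unfold drift; fun_prop
  have h1 : ∀ r, drift (-(t - r)) (drift (t - u) Z) = drift (r - u) Z := fun r => by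
    rw [drift_drift]; congr 1; ring
  have h2 : ∀ r, drift (-(u - r)) Z = drift (r - u) Z := fun r => by congr 1; ring
  have h3 : drift (-t) (drift (t - u) Z) = drift (-u) Z := by
    rw [drift_drift]; congr 1; ring
  simp only [duhamel, h1, h2, h3]
  rw [add_assoc, intervalIntegral.integral_add_adjacent_intervals
    (hg.intervalIntegrable_collision₀ hlam hβ hY h0 hu)
    (hg.intervalIntegrable_collision₀ hlam hβ hY hu ht)]

lemma dist_drift_le {τ : ℝ} (hτ : 0 ≤ τ) (Z : Conf d s) : dist Z (drift τ Z) ≤ τ * √(energy Z) := by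
  rw [dist_pi_le_iff (by positivity)]
  intro i
  rw [Prod.dist_eq, drift_fst, drift_snd, dist_self, dist_self_add_right, norm_smul,
    Real.norm_of_nonneg hτ]
  refine max_le ?_ (by positivity)
  gcongr
  exact norm_snd_le Z i

/-- Continuity of free transport in the weighted norm, for functions whose weighted norm decays for
large velocities. -/
lemma IsEvenC0.exists_abs_sub_drift_le {φ : Conf d s → ℝ} (hφ : IsEvenC0 φ) {β K : ℝ} (hβ : 0 ≤ β)
    (htail : ∀ Z, 1 ≤ energy Z → |φ Z| * gaussWeight β Z * √(energy Z) ≤ K)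
    {δ : ℝ} (hδ : 0 < δ) :
    ∃ τ₀ > 0, ∀ τ, 0 ≤ τ → τ < τ₀ → ∀ Z, |φ Z - φ (drift τ Z)| * gaussWeight β Z ≤ δ := by
  have huc : UniformContinuous φ := hφ.continuous.uniformContinuous_of_tendsto_cocompact hφ.vanish
  -- Above energy R each of the two values is at most δ/2 by the tail bound. Below it the
  -- displacement in time τ is at most τ√R and the weight is bounded, so uniform continuity applies.
  set R := 1 + (2 * K / δ) ^ 2 with hR
  have hR1 : 1 ≤ R := by rw [hR]; nlinarith [sq_nonneg (2 * K / δ)]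
  set w := Real.exp (β / 2 * R) with hw
  obtain ⟨η, hη, hd⟩ := Metric.uniformContinuous_iff.1 huc (δ / w) (by positivity)
  have hR0 : 0 < √R := Real.sqrt_pos.2 (by linarith)
  refine ⟨η / √R, by positivity, fun τ hτ hττ Z => ?_⟩
  rcases le_or_gt (energy Z) R with h | h
  · have h1 : dist Z (drift τ Z) < η := by
      refine (dist_drift_le hτ Z).trans_lt ?_
      rw [lt_div_iff₀ hR0] at hττ
      refine lt_of_le_of_lt ?_ hττ
      gcongr
    have h2 := (hd h1).le
    rw [Real.dist_eq] at h2
    have h3 : gaussWeight β Z ≤ w := by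
      rw [gaussWeight_eq, hw]
      gcongr
    calc |φ Z - φ (drift τ Z)| * gaussWeight β Z ≤ δ / w * w :=
          mul_le_mul h2 h3 (gaussWeight_pos _ _).le (by positivity)
      _ = δ := div_mul_cancel₀ _ (Real.exp_pos _).ne'
  · have key : ∀ Y : Conf d s, energy Y = energy Z → |φ Y| * gaussWeight β Y ≤ δ / 2 := by
      intro Y hY
      have h1 := htail Y (by linarith)
      have h2 : 2 * K / δ ≤ √(energy Y) := Real.le_sqrt_of_sq_le (by linarith)
      have h3 : 0 < √(energy Y) := Real.sqrt_pos.2 (by linarith)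
      have h4 : 2 * K ≤ √(energy Y) * δ := (div_le_iff₀ hδ).1 h2
      by_contra hc
      push Not at hc
      have := mul_lt_mul_of_pos_right hc h3
      linarith
    have h1 := key Z rfl
    have h2 := key (drift τ Z) (energy_drift τ Z)
    have h3 : gaussWeight β (drift τ Z) = gaussWeight β Z := rfl
    rw [h3] at h2
    have := mul_le_mul_of_nonneg_right (abs_sub (φ Z) (φ (drift τ Z)))
      (gaussWeight_pos β Z).le
    linarith

/-- At a positive time the weight is strictly weaker than the initial one, which gives the datum a
factor exp(-lam t E / 2). In the collision term, time integration gives 2 / (lam E) against a growth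
1 + √E. Both leave room for an additional √E. -/
lemma duhamel_tail (hlam : 0 < lam) (hβ : 0 < β₀ - lam * T) {f : Conf d s → ℝ} {M₀ : ℝ}
    (hM₀ : 0 ≤ M₀) (hf : ∀ Z, |f Z| * gaussWeight β₀ Z ≤ M₀) {g : ℝ → Conf d (s + 1) → ℝ}
    (hg : EvenPath T lam β₀ g) {t : ℝ} (ht : t ∈ Ioc 0 T) :
    ∃ K, ∀ Z, 1 ≤ energy Z →
      |duhamel f g t Z| * gaussWeight (β₀ - lam * t) Z * √(energy Z) ≤ K := by
  obtain ⟨C, hC, h1⟩ := hg.abs_collision₀_le (s := s) hlam.le hβ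
  have ht0 := ht.1
  refine ⟨M₀ * (2 / (lam * t)) + 4 * C / lam, fun Z hZ => ?_⟩
  set x := energy Z with hx
  have hx0 : 0 < x := by linarith
  set w := gaussWeight (β₀ - lam * t) Z with hw
  have hw0 : 0 < w := gaussWeight_pos _ _
  have hsx : √x ≤ x := Real.sqrt_le_iff.2 ⟨hx0.le, by nlinarith⟩
  have hsx0 : 0 ≤ √x := Real.sqrt_nonneg x
  have a1 : |f (drift (-t) Z)| * w * √x ≤ M₀ * (2 / (lam * t)) := by
    have e1 := hf (drift (-t) Z)
    have e2 : w = gaussWeight β₀ (drift (-t) Z) * Real.exp (-(lam * t / 2 * x)) := by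
      rw [hw, gaussWeight_eq, gaussWeight_eq, energy_drift, ← Real.exp_add]
      congr 1
      ring
    have e3 : Real.exp (-(lam * t / 2 * x)) * √x ≤ 2 / (lam * t) := by
      have := Real.add_one_le_exp (lam * t / 2 * x)
      rw [Real.exp_neg, inv_mul_eq_div, div_le_div_iff₀ (Real.exp_pos _) (by positivity)]
      have e4 : √x * (lam * t) ≤ x * (lam * t) := by gcongr
      nlinarith
    rw [e2, ← mul_assoc, mul_assoc]
    exact mul_le_mul e1 e3 (by positivity) hM₀
  have a2 : |∫ u in (0 : ℝ)..t, collision₀ (g u) (drift (-(t - u)) Z)| * w ≤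
      (C * (1 + √x)) / (lam * x / 2) := by
    refine abs_integral_mul_le_of_exp_decay hw0.le (by positivity) (by positivity) ht.1.le
      fun u hu => ?_
    have e1 := h1 u ⟨hu.1.le, hu.2.trans ht.2⟩ (drift (-(t - u)) Z)
    rw [energy_drift, ← hx] at e1
    refine (mul_le_mul_of_nonneg_right e1 hw0.le).trans (le_of_eq ?_)
    rw [hw, gaussWeight_eq, ← hx, mul_assoc, mul_assoc, mul_assoc, ← Real.exp_add]
    congr 3
    ring_nf
  have a3 : |∫ u in (0 : ℝ)..t, collision₀ (g u) (drift (-(t - u)) Z)| * w * √x ≤ 4 * C / lam := by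
    refine (mul_le_mul_of_nonneg_right a2 hsx0).trans ?_
    rw [div_mul_eq_mul_div, div_le_div_iff₀ (by positivity) hlam]
    have e1 : (1 + √x) * √x ≤ 2 * x := by nlinarith [Real.sq_sqrt hx0.le]
    have e2 := mul_le_mul_of_nonneg_left e1 (mul_nonneg hC hlam.le)
    nlinarith
  have a4 := mul_le_mul_of_nonneg_right (abs_add_le (f (drift (-t) Z))
    (∫ u in (0 : ℝ)..t, collision₀ (g u) (drift (-(t - u)) Z))) (mul_nonneg hw0.le hsx0)
  rw [duhamel]
  nlinarith

/-- For left-continuity, time u is compared with time t along the free trajectory. This produces the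
effect of a short free transport on the solution at time t, controlled by the velocity tail, and a
collision integral over [u, t]. -/
lemma evenPath_duhamel (hlam : 0 < lam) (hβ : 0 < β₀ - lam * T) {f : Conf d s → ℝ}
    (hf : IsEvenC0 f) {M₀ : ℝ} (hM₀ : 0 ≤ M₀) (hfM : ∀ Z, |f Z| * gaussWeight β₀ Z ≤ M₀)
    {g : ℝ → Conf d (s + 1) → ℝ} (hg : EvenPath T lam β₀ g) :
    EvenPath T lam β₀ (duhamel f g) := by
  obtain ⟨C, hC, h1⟩ := hg.abs_collision₀_le (s := s) hlam.le hβ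
  refine ⟨fun t ht => isEvenC0_duhamel hlam.le hβ hf hg ht, ?_, fun t ht δ hδ => ?_⟩
  · refine ⟨M₀ + C * (|T| + √(2 * |T| / lam)), by positivity, fun t ht Z => ?_⟩
    have e1 : |f (drift (-t) Z)| * gaussWeight (β₀ - lam * t) Z ≤ M₀ := by
      refine le_trans ?_ (hfM (drift (-t) Z))
      gcongr
      exact gaussWeight_mono (by have := mul_nonneg hlam.le ht.1; linarith) Z
    have e2 := abs_integral_mul_gaussWeight_le hlam hC ht.1
      (J := fun u => collision₀ (g u) (drift (-(t - u)) Z)) (Z := Z) (β₀ := β₀)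
      (fun u hu => h1 u ⟨hu.1.le, hu.2.trans ht.2⟩ _)
    have e3 : C * ((t - 0) + √(2 * (t - 0) / lam)) ≤ C * (|T| + √(2 * |T| / lam)) := by
      rw [sub_zero]
      have := ht.2.trans (le_abs_self T)
      gcongr
    have e4 := mul_le_mul_of_nonneg_right (abs_add_le (f (drift (-t) Z))
      (∫ u in (0 : ℝ)..t, collision₀ (g u) (drift (-(t - u)) Z)))
      (gaussWeight_pos (β₀ - lam * t) Z).le
    rw [duhamel]
    linarith
  · have ht' : t ∈ Icc 0 T := ⟨ht.1.le, ht.2⟩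
    obtain ⟨K, htail⟩ := duhamel_tail hlam hβ hM₀ hfM hg ht
    obtain ⟨τ₀, hτ₀, hdr⟩ := (isEvenC0_duhamel hlam.le hβ hf hg ht').exists_abs_sub_drift_le
      (hβ.le.trans (sub_mul_le hlam.le ht')) htail (half_pos hδ)
    have h2 : Tendsto (fun u => C * ((t - u) + √(2 * (t - u) / lam))) (𝓝[<] t) (𝓝 0) := by
      have h2 : Continuous fun u => C * ((t - u) + √(2 * (t - u) / lam)) := by fun_prop
      have h3 := (h2.tendsto t).mono_left (nhdsWithin_le_nhds (s := Iio t))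
      simpa using h3
    have h3 : ∀ᶠ u in 𝓝[<] t, t - τ₀ < u :=
      nhdsWithin_le_nhds (Ioi_mem_nhds (by linarith))
    filter_upwards [h2.eventually_lt_const (half_pos hδ), h3, eventually_mem_Icc ht]
      with u hu1 hu2 hu3 Z
    have e1 := hdr (t - u) (by linarith [hu3.2]) (by linarith) Z
    have e2 := duhamel_eq_add hlam.le hβ f hg hu3.1 ht' Z
    have e3 := abs_integral_mul_gaussWeight_le hlam hC hu3.2.le
      (J := fun r => collision₀ (g r) (drift (r - u) Z)) (Z := Z) (β₀ := β₀)
      (fun r hr => h1 r ⟨hu3.1.1.trans hr.1.le, hr.2.trans ht.2⟩ _)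
    have e4 : duhamel f g t Z - duhamel f g u Z =
        (duhamel f g t Z - duhamel f g t (drift (t - u) Z)) +
          ∫ r in u..t, collision₀ (g r) (drift (r - u) Z) := by
      rw [e2]; ring
    have e5 := mul_le_mul_of_nonneg_right (abs_add_le
      (duhamel f g t Z - duhamel f g t (drift (t - u) Z))
      (∫ r in u..t, collision₀ (g r) (drift (r - u) Z))) (gaussWeight_pos (β₀ - lam * t) Z).le
    rw [e4]
    linarith

lemma duhamel_sub (hlam : 0 ≤ lam) (hβ : 0 < β₀ - lam * T) (f : Conf d s → ℝ)
    {g g' : ℝ → Conf d (s + 1) → ℝ} (hg : EvenPath T lam β₀ g) (hg' : EvenPath T lam β₀ g')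
    {t : ℝ} (ht : t ∈ Icc 0 T) (Z : Conf d s) :
    duhamel f g t Z - duhamel f g' t Z =
      ∫ u in (0 : ℝ)..t, collision₀ (fun W => g u W - g' u W) (drift (-(t - u)) Z) := by
  have h0 : (0 : ℝ) ∈ Icc 0 T := ⟨le_rfl, ht.1.trans ht.2⟩
  have hY := continuous_drift_time t Z
  obtain ⟨M, hM, h1⟩ := hg.bound
  obtain ⟨M', hM', h2⟩ := hg'.bound
  rw [duhamel, duhamel, add_sub_add_left_eq_sub, ← intervalIntegral.integral_sub
    (hg.intervalIntegrable_collision₀ hlam hβ hY h0 ht)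
    (hg'.intervalIntegrable_collision₀ hlam hβ hY h0 ht)]
  refine intervalIntegral.integral_congr fun u hu => ?_
  rw [uIcc_of_le ht.1] at hu
  have hu' : u ∈ Icc 0 T := ⟨hu.1, hu.2.trans ht.2⟩
  exact collision₀_sub (hM.trans (le_max_left M M')) hβ (hg.even0 u hu').continuous
    (hg'.even0 u hu').continuous
    (exp_weight_le hlam (hM.trans (le_max_left M M')) hu' fun W =>
      (h1 u hu' W).trans (le_max_left M M'))
    (exp_weight_le hlam (hM.trans (le_max_left M M')) hu' fun W =>
      (h2 u hu' W).trans (le_max_right M M')) _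

end Duhamel

/-! ### Solution of the Boltzmann hierarchy -/

section Boltzmann

variable {d : ℕ} [NeZero d] {T lam β₀ μ₀ b : ℝ}

/-- The weight of the hierarchy norms, at level `k` and time `t`. -/
def levelWeight {k : ℕ} (lam β₀ μ₀ t : ℝ) (Z : Conf d (k + 1)) : ℝ :=
  Real.exp ((k + 1 : ℝ) * (μ₀ - lam * t)) * gaussWeight (β₀ - lam * t) Z

lemma levelWeight_pos {k : ℕ} (t : ℝ) (Z : Conf d (k + 1)) : 0 < levelWeight lam β₀ μ₀ t Z :=
  mul_pos (Real.exp_pos _) (gaussWeight_pos _ _)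

lemma levelWeight_drift {k : ℕ} (t τ : ℝ) (Z : Conf d (k + 1)) :
    levelWeight lam β₀ μ₀ t (drift τ Z) = levelWeight lam β₀ μ₀ t Z := rfl

lemma levelWeight_antitone {k : ℕ} (hlam : 0 ≤ lam) {t u : ℝ} (h : u ≤ t) (Z : Conf d (k + 1)) :
    levelWeight lam β₀ μ₀ t Z ≤ levelWeight lam β₀ μ₀ u Z := by
  have h1 := mul_le_mul_of_nonneg_left h hlam
  refine mul_le_mul (Real.exp_le_exp.2 ?_) (gaussWeight_mono (by linarith) Z)
    (gaussWeight_pos _ _).le (Real.exp_pos _).le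
  gcongr

lemma abs_mul_levelWeight_le_iff {k : ℕ} {x M t : ℝ} {Z : Conf d (k + 1)} :
    |x| * levelWeight lam β₀ μ₀ t Z ≤ M ↔
      |x| * gaussWeight (β₀ - lam * t) Z ≤ M * Real.exp (-((k + 1 : ℝ) * (μ₀ - lam * t))) := by
  rw [levelWeight, Real.exp_neg, ← div_eq_mul_inv, le_div_iff₀ (Real.exp_pos _)]
  ring_nf

/-- The contraction estimate. -/
lemma abs_integral_collision₀_le (hlam : 0 < lam) (hb0 : 0 < b) (hb : b ≤ β₀ - lam * T)
    (hθ : 8 * velMass d b * Real.exp (lam * T - μ₀) ≤ lam) {k : ℕ} {M : ℝ} (hM : 0 ≤ M)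
    {h : ℝ → Conf d (k + 1 + 1) → ℝ}
    (hh : ∀ u ∈ Icc 0 T, ∀ W, |h u W| * levelWeight lam β₀ μ₀ u W ≤ M) {t : ℝ}
    (ht : t ∈ Icc 0 T) (Z : Conf d (k + 1)) :
    |∫ u in (0 : ℝ)..t, collision₀ (h u) (drift (-(t - u)) Z)| * levelWeight lam β₀ μ₀ t Z ≤
      M / 2 := by
  have hv := velMass_nonneg d b
  have hE := energy_nonneg Z
  -- With s = k + 1, lam a is the exponential rate of the level weight, and 2a dominates the
  -- velocity growth of the collision operator.
  set a : ℝ := (k + 1 : ℝ) + energy Z / 2 with ha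
  have ha0 : 0 < a := by positivity
  refine (abs_integral_mul_le_of_exp_decay (a := lam * a)
    (K := M * (4 * velMass d b * Real.exp (lam * T - μ₀)) * a) (levelWeight_pos t Z).le
    (by positivity) (by positivity) ht.1 fun u hu => ?_).trans ?_
  · have hu' : u ∈ Icc 0 T := ⟨hu.1.le, hu.2.trans ht.2⟩
    have h1 : ∀ W, |h u W| ≤ M * Real.exp (-((((k + 1 : ℕ) : ℝ) + 1) * (μ₀ - lam * u))) *
        Real.exp (-((β₀ - lam * u) / 2 * energy W)) := fun W =>
      abs_mul_gaussWeight_le_iff.1 (abs_mul_levelWeight_le_iff.1 (hh u hu' W))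
    have h2 := abs_collision₀_le (by positivity) hb0 (hb.trans (sub_mul_le hlam.le hu')) h1
      (drift (-(t - u)) Z)
    have h3 := sum_one_add_norm_le (drift (-(t - u)) Z)
    rw [energy_drift] at h2 h3
    push_cast at h2 h3
    rw [← ha] at h3
    have h4 := h2.trans (mul_le_mul_of_nonneg_right (mul_le_mul_of_nonneg_left h3
      (by positivity)) (Real.exp_pos _).le)
    refine (mul_le_mul_of_nonneg_right h4 (levelWeight_pos t Z).le).trans ?_
    -- Of the weights at levels k + 2 and k + 1, the one unmatched particle leaves exp(lam u - μ₀),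
    -- and the time difference leaves the decay at rate lam a.
    have h5 : Real.exp (-(((k : ℝ) + 1 + 1) * (μ₀ - lam * u))) *
        Real.exp (-((β₀ - lam * u) / 2 * energy Z)) * levelWeight lam β₀ μ₀ t Z =
        Real.exp (lam * u - μ₀) * Real.exp (-(lam * a * (t - u))) := by
      rw [levelWeight, gaussWeight_eq, ← Real.exp_add, ← Real.exp_add, ← Real.exp_add,
        ← Real.exp_add, ha]
      congr 1
      ring
    have h6 : Real.exp (lam * u - μ₀) ≤ Real.exp (lam * T - μ₀) := by
      have := mul_le_mul_of_nonneg_left hu'.2 hlam.le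
      exact Real.exp_le_exp.2 (by linarith)
    calc _ = 4 * M * velMass d b * a * (Real.exp (-(((k : ℝ) + 1 + 1) * (μ₀ - lam * u))) *
          Real.exp (-((β₀ - lam * u) / 2 * energy Z)) * levelWeight lam β₀ μ₀ t Z) := by ring
      _ = 4 * M * velMass d b * a *
          (Real.exp (lam * u - μ₀) * Real.exp (-(lam * a * (t - u)))) := by rw [h5]
      _ ≤ 4 * M * velMass d b * a *
          (Real.exp (lam * T - μ₀) * Real.exp (-(lam * a * (t - u)))) := by gcongr
      _ = _ := by ring
  -- The factor a lost in the collision cancels the one gained from the time integral, and the lower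
  -- bound on `lam` makes the remaining constant at most 1/2.
  · rw [div_le_div_iff₀ (by positivity) two_pos]
    have := mul_le_mul_of_nonneg_left hθ (mul_nonneg hM ha0.le)
    linarith

/-- Differences of images of the Duhamel map are half as large as the differences of the sources. -/
lemma abs_duhamel_sub_le (hlam : 0 < lam) (hb0 : 0 < b) (hb : b ≤ β₀ - lam * T)
    (hθ : 8 * velMass d b * Real.exp (lam * T - μ₀) ≤ lam) {k : ℕ} {M : ℝ} (hM : 0 ≤ M)
    (f : Conf d (k + 1) → ℝ) {g g' : ℝ → Conf d (k + 1 + 1) → ℝ} (hg : EvenPath T lam β₀ g)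
    (hg' : EvenPath T lam β₀ g')
    (h : ∀ u ∈ Icc 0 T, ∀ W, |g u W - g' u W| * levelWeight lam β₀ μ₀ u W ≤ M) {t : ℝ}
    (ht : t ∈ Icc 0 T) (Z : Conf d (k + 1)) :
    |duhamel f g t Z - duhamel f g' t Z| * levelWeight lam β₀ μ₀ t Z ≤ M / 2 := by
  rw [duhamel_sub hlam.le (hb0.trans_le hb) f hg hg' ht]
  exact abs_integral_collision₀_le hlam hb0 hb hθ hM h ht Z

/-- The Picard iterates of the Boltzmann hierarchy. -/
def picard (f : (k : ℕ) → Conf d (k + 1) → ℝ) : ℕ → ℝ → (k : ℕ) → Conf d (k + 1) → ℝ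
  | 0 => fun _ _ _ => 0
  | n + 1 => fun t k => duhamel (f k) (fun u => picard f n u (k + 1)) t

lemma evenPath_zero (s : ℕ) : EvenPath T lam β₀ fun _ (_ : Conf d s) => (0 : ℝ) :=
  ⟨fun _ _ => ⟨continuous_const, tendsto_const_nhds, fun _ _ => rfl⟩,
    ⟨0, le_rfl, fun _ _ _ => by simp⟩,
    fun _ _ δ hδ => Eventually.of_forall fun _ _ => by simpa using hδ.le⟩

variable {f : (k : ℕ) → Conf d (k + 1) → ℝ} {M₀ : ℝ}

lemma evenPath_picard (hlam : 0 < lam) (hβ : 0 < β₀ - lam * T) (hf : ∀ k, IsEvenC0 (f k))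
    (hM₀ : 0 ≤ M₀) (hfM : ∀ k Z, |f k Z| * levelWeight lam β₀ μ₀ 0 Z ≤ M₀) (n k : ℕ) :
    EvenPath T lam β₀ fun t => picard f n t k := by
  induction n generalizing k with
  | zero => exact evenPath_zero _
  | succ n ih =>
    refine evenPath_duhamel hlam hβ (hf k) (M₀ := M₀ * Real.exp (-((k + 1 : ℝ) * μ₀)))
      (by positivity) (fun Z => ?_) (ih (k + 1))
    simpa using abs_mul_levelWeight_le_iff.1 (hfM k Z)

/-- The first increment is the freely transported datum, of norm at most M₀ since weights decrease
in time; each further Duhamel step halves it, at all levels simultaneously. -/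
lemma abs_picard_sub_le (hlam : 0 < lam) (hb0 : 0 < b) (hb : b ≤ β₀ - lam * T)
    (hθ : 8 * velMass d b * Real.exp (lam * T - μ₀) ≤ lam) (hf : ∀ k, IsEvenC0 (f k))
    (hM₀ : 0 ≤ M₀) (hfM : ∀ k Z, |f k Z| * levelWeight lam β₀ μ₀ 0 Z ≤ M₀) (n : ℕ) {t : ℝ}
    (ht : t ∈ Icc 0 T) (k : ℕ) (Z : Conf d (k + 1)) :
    |picard f (n + 1) t k Z - picard f n t k Z| * levelWeight lam β₀ μ₀ t Z ≤ M₀ / 2 ^ n := by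
  induction n generalizing t k with
  | zero =>
    have h1 : picard f 1 t k Z = f k (drift (-t) Z) := by
      simp [picard, duhamel, collision₀, collisionIntegrand₀]
    have h2 : picard f 0 t k Z = 0 := rfl
    rw [h1, h2, sub_zero, pow_zero, div_one, ← levelWeight_drift t (-t)]
    exact (mul_le_mul_of_nonneg_left (levelWeight_antitone hlam.le ht.1 _) (abs_nonneg _)).trans
      (hfM k _)
  | succ n ih =>
    have hβ := hb0.trans_le hb
    have h1 := abs_duhamel_sub_le hlam hb0 hb hθ (by positivity) (f k)
      (evenPath_picard hlam hβ hf hM₀ hfM (n + 1) (k + 1))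
      (evenPath_picard hlam hβ hf hM₀ hfM n (k + 1)) (fun u hu W => ih hu (k + 1) W) ht Z
    refine h1.trans (le_of_eq ?_)
    rw [pow_succ, div_div]

/-- The iterates form a geometric series in the hierarchy norm, with total 2 M₀. The limit inherits
evenness and left-continuity level by level and satisfies the equation because the Duhamel map
contracts. -/
lemma exists_even_solution (hlam : 0 < lam) (hb0 : 0 < b) (hb : b ≤ β₀ - lam * T)
    (hθ : 8 * velMass d b * Real.exp (lam * T - μ₀) ≤ lam) (hf : ∀ k, IsEvenC0 (f k))
    (hM₀ : 0 ≤ M₀) (hfM : ∀ k Z, |f k Z| * levelWeight lam β₀ μ₀ 0 Z ≤ M₀) :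
    ∃ G : ℝ → (k : ℕ) → Conf d (k + 1) → ℝ, (∀ k, EvenPath T lam β₀ fun t => G t k) ∧
      (∀ t ∈ Icc 0 T, ∀ k Z, |G t k Z| * levelWeight lam β₀ μ₀ t Z ≤ 2 * M₀) ∧
      ∀ t ∈ Icc 0 T, ∀ k Z, G t k Z = duhamel (f k) (fun u => G u (k + 1)) t Z := by
  have hβ := hb0.trans_le hb
  have hP := evenPath_picard hlam hβ hf hM₀ hfM
  let G : ℝ → (k : ℕ) → Conf d (k + 1) → ℝ := fun t k Z =>
    limUnder atTop fun n => picard f n t k Z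
  have hG : ∀ n, ∀ t ∈ Icc 0 T, ∀ k Z,
      |G t k Z - picard f n t k Z| * levelWeight lam β₀ μ₀ t Z ≤ 2 * M₀ / 2 ^ n := by
    intro n t ht k Z
    have hw := levelWeight_pos (lam := lam) (β₀ := β₀) (μ₀ := μ₀) t Z
    have h1 : ∀ n, dist (picard f n t k Z) (picard f (n + 1) t k Z) ≤
        2 * M₀ / levelWeight lam β₀ μ₀ t Z / 2 / 2 ^ n := by
      intro n
      rw [dist_comm, Real.dist_eq]
      have := abs_picard_sub_le hlam hb0 hb hθ hf hM₀ hfM n ht k Z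
      rw [← le_div_iff₀ hw] at this
      refine this.trans (le_of_eq ?_)
      field_simp
    have h2 := (cauchySeq_of_le_geometric_two h1).tendsto_limUnder
    have h3 := dist_le_of_le_geometric_two_of_tendsto h1 h2 n
    rw [dist_comm, Real.dist_eq] at h3
    rw [← le_div_iff₀ hw]
    refine h3.trans (le_of_eq ?_)
    field_simp
  have hpow : Tendsto (fun n : ℕ => 2 * M₀ / 2 ^ n) atTop (𝓝 0) := by
    have := (tendsto_pow_atTop_nhds_zero_of_lt_one (r := (1 / 2 : ℝ)) (by norm_num)
      (by norm_num)).const_mul (2 * M₀)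
    simpa [div_eq_mul_inv] using this
  have hGe : ∀ k, EvenPath T lam β₀ fun t => G t k := by
    intro k
    refine EvenPath.of_approx hlam.le hβ.le fun δ hδ => ?_
    -- Bounds, uniformly in time, the cost of passing from the hierarchy norm to the Gaussian norm
    -- at the fixed level k.
    set c := Real.exp (|(k + 1 : ℝ) * (μ₀ - lam * T)| ) with hc
    obtain ⟨n, hn⟩ := (hpow.eventually_lt_const
      (show (0 : ℝ) < δ / c by positivity)).exists
    refine ⟨_, hP n k, fun t ht Z => ?_⟩
    refine (abs_mul_levelWeight_le_iff.1 (hG n t ht k Z)).trans ?_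
    have h1 : Real.exp (-((k + 1 : ℝ) * (μ₀ - lam * t))) ≤ c := by
      refine Real.exp_le_exp.2 (le_trans ?_ (neg_le_abs _))
      have := mul_le_mul_of_nonneg_left ht.2 hlam.le
      gcongr
    calc 2 * M₀ / 2 ^ n * Real.exp (-((k + 1 : ℝ) * (μ₀ - lam * t))) ≤ δ / c * c :=
          mul_le_mul hn.le h1 (Real.exp_pos _).le (by positivity)
      _ = δ := div_mul_cancel₀ _ (Real.exp_pos _).ne'
  refine ⟨G, hGe, fun t ht k Z => ?_, fun t ht k Z => ?_⟩
  · simpa [picard] using hG 0 t ht k Z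
  · have hw := levelWeight_pos (lam := lam) (β₀ := β₀) (μ₀ := μ₀) t Z
    have h1 : ∀ n : ℕ, |G t k Z - duhamel (f k) (fun u => G u (k + 1)) t Z| *
        levelWeight lam β₀ μ₀ t Z ≤ 2 * M₀ / 2 ^ n := by
      intro n
      have h2 := abs_duhamel_sub_le hlam hb0 hb hθ (by positivity) (f k) (hGe (k + 1))
        (hP n (k + 1)) (fun u hu W => hG n u hu (k + 1) W) ht Z
      have h3 := hG (n + 1) t ht k Z
      have h4 : picard f (n + 1) t k Z = duhamel (f k) (fun u => picard f n u (k + 1)) t Z := rfl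
      rw [h4] at h3
      have h5 := abs_sub_le (G t k Z) (duhamel (f k) (fun u => picard f n u (k + 1)) t Z)
        (duhamel (f k) (fun u => G u (k + 1)) t Z)
      rw [abs_sub_comm (duhamel (f k) (fun u => picard f n u (k + 1)) t Z)] at h5
      have h6 := mul_le_mul_of_nonneg_right h5 hw.le
      have h7 : 2 * M₀ / 2 ^ (n + 1) = 2 * M₀ / 2 ^ n / 2 := by rw [pow_succ, div_div]
      linarith
    have h2 := ge_of_tendsto' hpow h1
    have h3 : |G t k Z - duhamel (f k) (fun u => G u (k + 1)) t Z| ≤ 0 := by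
      by_contra hc
      push Not at hc
      exact absurd h2 (not_le.2 (mul_pos hc hw))
    exact sub_eq_zero.1 (abs_nonpos_iff.1 h3)

/-- A difference bounded in the hierarchy norm, uniformly over levels and times, is halved by every
use of the equation, so it is at most M / 2^n for every n. -/
lemma even_solution_unique (hlam : 0 < lam) (hb0 : 0 < b) (hb : b ≤ β₀ - lam * T)
    (hθ : 8 * velMass d b * Real.exp (lam * T - μ₀) ≤ lam) {M : ℝ} (hM : 0 ≤ M)
    {G G' : ℝ → (k : ℕ) → Conf d (k + 1) → ℝ} (hG : ∀ k, EvenPath T lam β₀ fun t => G t k)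
    (hG' : ∀ k, EvenPath T lam β₀ fun t => G' t k)
    (hb1 : ∀ t ∈ Icc 0 T, ∀ k Z, |G t k Z - G' t k Z| * levelWeight lam β₀ μ₀ t Z ≤ M)
    (h : ∀ t ∈ Icc 0 T, ∀ k Z, G t k Z = duhamel (f k) (fun u => G u (k + 1)) t Z)
    (h' : ∀ t ∈ Icc 0 T, ∀ k Z, G' t k Z = duhamel (f k) (fun u => G' u (k + 1)) t Z) :
    ∀ t ∈ Icc 0 T, ∀ k Z, G t k Z = G' t k Z := by
  have key : ∀ n : ℕ, ∀ t ∈ Icc 0 T, ∀ k Z,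
      |G t k Z - G' t k Z| * levelWeight lam β₀ μ₀ t Z ≤ M / 2 ^ n := by
    intro n
    induction n with
    | zero => simpa using hb1
    | succ n ih =>
      intro t ht k Z
      rw [h t ht k Z, h' t ht k Z, pow_succ, ← div_div]
      exact abs_duhamel_sub_le hlam hb0 hb hθ (by positivity) (f k) (hG (k + 1)) (hG' (k + 1))
        (fun u hu W => ih u hu (k + 1) W) ht Z
  intro t ht k Z
  have hpow : Tendsto (fun n : ℕ => M / 2 ^ n) atTop (𝓝 0) := by
    have := (tendsto_pow_atTop_nhds_zero_of_lt_one (r := (1 / 2 : ℝ)) (by norm_num)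
      (by norm_num)).const_mul M
    simpa [div_eq_mul_inv] using this
  have h2 := ge_of_tendsto' hpow fun n => key n t ht k Z
  have h3 : |G t k Z - G' t k Z| ≤ 0 := by
    by_contra hc
    push Not at hc
    exact absurd h2 (not_le.2 (mul_pos hc (levelWeight_pos t Z)))
  exact sub_eq_zero.1 (abs_nonpos_iff.1 h3)

/-! ### Translation to functions on the half-space -/

lemma gaussWeight_fold {s : ℕ} (β : ℝ) (Z : Conf d s) :
    gaussWeight β (fold Z) = gaussWeight β Z := by
  rw [gaussWeight_eq, gaussWeight_eq, energy_fold]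

lemma normZero_le_ofReal_iff {s : ℕ} {β M : ℝ} (hM : 0 ≤ M) (f : C₀(halfPhase d s, ℝ)) :
    normZero β f ≤ ENNReal.ofReal M ↔ ∀ Z, |evenExt f Z| * gaussWeight β Z ≤ M := by
  rw [normZero, iSup_le_iff]
  constructor
  · intro h Z
    have := (ENNReal.ofReal_le_ofReal_iff hM).1 (h ⟨fold Z, fold_mem Z⟩)
    rwa [gaussWeight_fold] at this
  · intro h Z
    have := h Z
    rw [evenExt_coe] at this
    exact ENNReal.ofReal_le_ofReal this

lemma normBoltzmann_le_ofReal_iff {t M : ℝ} (hM : 0 ≤ M) (F : BoltzmannSeq d) :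
    normBoltzmann (β₀ - lam * t) (μ₀ - lam * t) F ≤ ENNReal.ofReal M ↔
      ∀ k Z, |evenExt (F k) Z| * levelWeight lam β₀ μ₀ t Z ≤ M := by
  rw [normBoltzmann, iSup_le_iff]
  refine forall_congr' fun k => ?_
  have h1 : ENNReal.ofReal M = ENNReal.ofReal (M * Real.exp (-((k + 1 : ℝ) * (μ₀ - lam * t)))) *
      ENNReal.ofReal (Real.exp ((k + 1 : ℝ) * (μ₀ - lam * t))) := by
    rw [← ENNReal.ofReal_mul (by positivity), mul_assoc, ← Real.exp_add, neg_add_cancel,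
      Real.exp_zero, mul_one]
  rw [h1, ENNReal.mul_le_mul_iff_left (ENNReal.ofReal_pos.2 (Real.exp_pos _)).ne'
    ENNReal.ofReal_ne_top, normZero_le_ofReal_iff (by positivity)]
  exact forall_congr' fun Z => abs_mul_levelWeight_le_iff.symm

lemma exists_bound_of_normBoltzmann {t : ℝ} {F : BoltzmannSeq d}
    (hF : normBoltzmann (β₀ - lam * t) (μ₀ - lam * t) F < ∞) :
    ∃ M, 0 ≤ M ∧ ∀ k Z, |evenExt (F k) Z| * levelWeight lam β₀ μ₀ t Z ≤ M := by
  refine ⟨(normBoltzmann (β₀ - lam * t) (μ₀ - lam * t) F).toReal, ENNReal.toReal_nonneg, ?_⟩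
  rw [← normBoltzmann_le_ofReal_iff ENNReal.toReal_nonneg, ENNReal.ofReal_toReal hF.ne]

lemma evenExt_sub {s : ℕ} (f g : C₀(halfPhase d s, ℝ)) (Z : Conf d s) :
    evenExt (f - g) Z = evenExt f Z - evenExt g Z := rfl

lemma InXTildeBoltzmann.exists_bound {F : ℝ → BoltzmannSeq d}
    (hF : InXTildeBoltzmann T (fun t => β₀ - lam * t) (fun t => μ₀ - lam * t) F) :
    ∃ M, 0 ≤ M ∧ ∀ t ∈ Icc 0 T, ∀ k Z,
      |evenExt (F t k) Z| * levelWeight lam β₀ μ₀ t Z ≤ M := by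
  have h1 : (⨆ t ∈ Icc 0 T, normBoltzmann (β₀ - lam * t) (μ₀ - lam * t) (F t)) < ∞ := hF.bounded
  refine ⟨(⨆ t ∈ Icc 0 T, normBoltzmann (β₀ - lam * t) (μ₀ - lam * t) (F t)).toReal,
    ENNReal.toReal_nonneg, fun t ht => ?_⟩
  rw [← normBoltzmann_le_ofReal_iff ENNReal.toReal_nonneg, ENNReal.ofReal_toReal h1.ne]
  exact le_iSup₂ (f := fun t (_ : t ∈ Icc 0 T) =>
    normBoltzmann (β₀ - lam * t) (μ₀ - lam * t) (F t)) t ht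

lemma InXTildeBoltzmann.evenPath (hlam : 0 ≤ lam) {F : ℝ → BoltzmannSeq d}
    (hF : InXTildeBoltzmann T (fun t => β₀ - lam * t) (fun t => μ₀ - lam * t) F) (k : ℕ) :
    EvenPath T lam β₀ fun t => evenExt (F t k) := by
  refine ⟨fun t ht => isEvenC0_evenExt ((hF.mem t ht).1 k).1, ?_, fun t ht δ hδ => ?_⟩
  · obtain ⟨M, hM, h1⟩ := hF.exists_bound
    refine ⟨M * Real.exp (-((k + 1 : ℝ) * (μ₀ - lam * T))), by positivity, fun t ht Z => ?_⟩
    refine (abs_mul_levelWeight_le_iff.1 (h1 t ht k Z)).trans ?_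
    have := mul_le_mul_of_nonneg_left ht.2 hlam
    gcongr
  · have h1 := hF.left_cont t ht k
    rw [ENNReal.tendsto_nhds_zero] at h1
    filter_upwards [h1 (ENNReal.ofReal δ) (ENNReal.ofReal_pos.2 hδ)] with u hu Z
    have := (normZero_le_ofReal_iff hδ.le _).1 hu Z
    rwa [evenExt_sub] at this

/-- The free flow folds the straight motion; the even extension of the datum absorbs the folding,
and so does the collision term. -/
lemma boltzmannOperator_eq {F₀ : BoltzmannSeq d} {F : ℝ → BoltzmannSeq d} {t : ℝ}
    (ht : t ∈ Icc 0 T) {k : ℕ} (hF : ∀ u ∈ Icc 0 T, BoundaryCondition (F u (k + 1)))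
    (Z : Conf d (k + 1)) : boltzmannOperator F₀ F t k Z =
      duhamel (evenExt (F₀ k)) (fun u => evenExt (F u (k + 1))) t Z := by
  rw [boltzmannOperator, duhamel, freeTransport, freeFlow_eq, ext₀_fold]
  congr 1
  refine intervalIntegral.integral_congr fun u hu => ?_
  rw [uIcc_of_le ht.1] at hu
  simp only [freeTransport, freeFlow_eq]
  exact collision₀_ext₀ (hF u ⟨hu.1, hu.2.trans ht.2⟩) _

lemma IsBoltzmannSolution.evenExt_eq_duhamel (hlam : 0 ≤ lam) (hβ : 0 < β₀ - lam * T)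
    {F₀ : BoltzmannSeq d} (hF₀ : ∀ k, BoundaryCondition (F₀ k)) {F : ℝ → BoltzmannSeq d}
    (hF : IsBoltzmannSolution T (fun t => β₀ - lam * t) (fun t => μ₀ - lam * t) F₀ F) {t : ℝ}
    (ht : t ∈ Icc 0 T) (k : ℕ) (Z : Conf d (k + 1)) : evenExt (F t k) Z =
      duhamel (evenExt (F₀ k)) (fun u => evenExt (F u (k + 1))) t Z := by
  have h1 := isEvenC0_duhamel hlam hβ (isEvenC0_evenExt (hF₀ k))
    (hF.mem.evenPath hlam (k + 1)) ht
  rw [← h1.apply_fold, ← boltzmannOperator_eq ht fun u hu => ((hF.mem.mem u hu).1 (k + 1)).1]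
  exact hF.fixed t ht k ⟨fold Z, fold_mem Z⟩

/-- Existence and uniqueness for the Boltzmann hierarchy. -/
theorem exists_unique_boltzmann (hT : 0 ≤ T) (hlam : 0 < lam) (hb0 : 0 < b)
    (hb : b ≤ β₀ - lam * T) (hθ : 8 * velMass d b * Real.exp (lam * T - μ₀) ≤ lam)
    {F₀ : BoltzmannSeq d} (hF₀ : F₀ ∈ XBoltzmann d β₀ μ₀) :
    ∃ F : ℝ → BoltzmannSeq d,
      IsBoltzmannSolution T (fun t => β₀ - lam * t) (fun t => μ₀ - lam * t) F₀ F ∧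
      BoltzmannConverges T F ∧
      ∀ F' : ℝ → BoltzmannSeq d,
        IsBoltzmannSolution T (fun t => β₀ - lam * t) (fun t => μ₀ - lam * t) F₀ F' →
          EqOn F' F (Icc 0 T) := by
  classical
  have hβ := hb0.trans_le hb
  have hBC : ∀ k, BoundaryCondition (F₀ k) := fun k => (hF₀.1 k).1
  obtain ⟨M₀, hM₀, hfM⟩ := exists_bound_of_normBoltzmann (β₀ := β₀) (μ₀ := μ₀) (lam := lam)
    (t := 0) (F := F₀) (by simpa using hF₀.2)
  obtain ⟨G, hGe, hGb, hGd⟩ := exists_even_solution hlam hb0 hb hθ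
    (fun k => isEvenC0_evenExt (hBC k)) hM₀ hfM
  let F : ℝ → BoltzmannSeq d := fun t k =>
    if ht : t ∈ Icc 0 T then restrictHalf (G t k) ((hGe k).even0 t ht) else 0
  have hF : ∀ t ∈ Icc 0 T, ∀ k, evenExt (F t k) = G t k := by
    intro t ht k
    simp only [F, dif_pos ht, evenExt_restrictHalf]
  have hFBC : ∀ t ∈ Icc 0 T, ∀ k, BoundaryCondition (F t k) := by
    intro t ht k
    simp only [F, dif_pos ht]
    exact boundaryCondition_restrictHalf _
  have hnorm : ∀ t ∈ Icc 0 T,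
      normBoltzmann (β₀ - lam * t) (μ₀ - lam * t) (F t) ≤ ENNReal.ofReal (2 * M₀) := by
    intro t ht
    rw [normBoltzmann_le_ofReal_iff (by positivity)]
    intro k Z
    rw [hF t ht]
    exact hGb t ht k Z
  have hmem : InXTildeBoltzmann T (fun t => β₀ - lam * t) (fun t => μ₀ - lam * t) F := by
    refine ⟨fun t ht => ⟨fun k => ⟨hFBC t ht k, ?_⟩, (hnorm t ht).trans_lt ENNReal.ofReal_lt_top⟩,
      (iSup₂_le hnorm).trans_lt ENNReal.ofReal_lt_top, fun t ht k => ?_⟩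
    · obtain ⟨M, hM, h1⟩ := (hGe k).bound
      refine lt_of_le_of_lt ((normZero_le_ofReal_iff hM _).2 fun Z => ?_) ENNReal.ofReal_lt_top
      rw [hF t ht]
      exact h1 t ht Z
    · rw [ENNReal.tendsto_nhds_zero]
      intro δ hδ
      -- The tolerance δ may be infinite; capping it at 1 yields a positive real number.
      have hδ' : 0 < (min δ 1).toReal :=
        ENNReal.toReal_pos (lt_min hδ one_pos).ne' (ne_top_of_le_ne_top ENNReal.one_ne_top
          (min_le_right _ _))
      filter_upwards [(hGe k).left_cont t ht _ hδ', eventually_mem_Icc ht] with u hu1 hu2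
      have h1 : normZero (β₀ - lam * t) (F t k - F u k) ≤ ENNReal.ofReal (min δ 1).toReal := by
        rw [normZero_le_ofReal_iff hδ'.le]
        intro Z
        rw [evenExt_sub, hF t ⟨ht.1.le, ht.2⟩, hF u hu2.1]
        exact hu1 Z
      exact h1.trans (ENNReal.ofReal_toReal_le.trans (min_le_left _ _))
  have hsol : IsBoltzmannSolution T (fun t => β₀ - lam * t) (fun t => μ₀ - lam * t) F₀ F := by
    refine ⟨hmem, fun t ht k Z => ?_⟩
    rw [boltzmannOperator_eq ht fun u hu => hFBC u hu (k + 1), ← evenExt_coe, hF t ht, hGd t ht]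
    simp only [duhamel]
    congr 1
    refine intervalIntegral.integral_congr fun u hu => ?_
    rw [uIcc_of_le ht.1] at hu
    simp only [hF u ⟨hu.1, hu.2.trans ht.2⟩]
  refine ⟨F, hsol, fun t ht k Z hZ => ⟨?_, fun i => ?_⟩, fun F' hF' => ?_⟩
  · have h1 := (hGe (k + 1)).intervalIntegrable_collision₀ hlam.le hβ (continuous_drift_time t Z)
      ⟨le_rfl, hT⟩ ht
    refine h1.congr fun u hu => ?_
    rw [uIoc_of_le ht.1] at hu
    have hu' : u ∈ Icc 0 T := ⟨hu.1.le, hu.2.trans ht.2⟩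
    simp only [freeTransport, freeFlow_eq]
    rw [collision₀_ext₀ (hFBC u hu' (k + 1)), hF u hu']
  · obtain ⟨M, hM, h1⟩ := (hGe (k + 1)).bound
    rw [collision₀_congr (g := G t (k + 1)) (fun W hW => ?_) hZ i]
    · exact integrable_collisionIntegrand₀ hM hβ ((hGe (k + 1)).even0 t ht).continuous
        (exp_weight_le hlam.le hM ht (h1 t ht)) Z i
    · rw [ext₀_eq_evenExt _ hW, hF t ht]
  · obtain ⟨M, hM, h1⟩ := hmem.exists_bound
    obtain ⟨M', hM', h2⟩ := hF'.mem.exists_bound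
    have h3 := even_solution_unique hlam hb0 hb hθ (M := M' + M) (by positivity)
      (G := fun t k => evenExt (F' t k)) (G' := fun t k => evenExt (F t k))
      (fun k => hF'.mem.evenPath hlam.le k) (fun k => hmem.evenPath hlam.le k)
      (fun t ht k Z => ?_)
      (fun t ht k Z => hF'.evenExt_eq_duhamel hlam.le hβ hBC ht k Z)
      (fun t ht k Z => hsol.evenExt_eq_duhamel hlam.le hβ hBC ht k Z)
    · intro t ht
      funext k
      ext Z
      rw [← evenExt_coe, ← evenExt_coe]
      exact h3 t ht k Z
    · have h4 := mul_le_mul_of_nonneg_right (abs_sub (evenExt (F' t k) Z) (evenExt (F t k) Z))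
        (levelWeight_pos (lam := lam) (β₀ := β₀) (μ₀ := μ₀) t Z).le
      linarith [h1 t ht k Z, h2 t ht k Z]

end Boltzmann

end Hierarchy

end

/-! ### Choice of the decay rate and of the time of existence -/

theorem mainTheorem8 (d : ℕ) [NeZero d] (hd : 2 ≤ d) (β₀ : ℝ) (hβ₀ : 0 < β₀) (μ₀ : ℝ) :
    ∃ lam T : ℝ, 0 < lam ∧ 0 < T ∧ (∀ t ∈ Icc 0 T, 0 < β₀ - lam * t) ∧
      ∀ (N : ℕ) (ε : ℝ), 1 ≤ N → 0 < ε → (N : ℝ) * ε ^ (d - 1) = 1 →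
        ∀ F_N₀ ∈ XBBGKY d ε N β₀ μ₀, ∀ F₀ ∈ XBoltzmann d β₀ μ₀,
          (∃ H : ℝ → BBGKYSeq d ε N,
            IsBBGKYSolution T (fun t => β₀ - lam * t) (fun t => μ₀ - lam * t) F_N₀ H ∧
            BBGKYConverges T H ∧
            ∀ H' : ℝ → BBGKYSeq d ε N,
              IsBBGKYSolution T (fun t => β₀ - lam * t) (fun t => μ₀ - lam * t) F_N₀ H' →
                EqOn H' H (Icc 0 T)) ∧
          (∃ F : ℝ → BoltzmannSeq d,
            IsBoltzmannSolution T (fun t => β₀ - lam * t) (fun t => μ₀ - lam * t) F₀ F ∧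
            BoltzmannConverges T F ∧
            ∀ F' : ℝ → BoltzmannSeq d,
              IsBoltzmannSolution T (fun t => β₀ - lam * t) (fun t => μ₀ - lam * t) F₀ F' →
                EqOn F' F (Icc 0 T)) := by
  have hv := velMass_nonneg d (β₀ / 2)
  -- The contraction condition contains exp(lam T - μ₀); since lam T ≤ 1 will hold, exp(1 - μ₀)
  -- replaces it and the definition is not circular. The added 1 ensures positivity.
  set lam := 8 * velMass d (β₀ / 2) * Real.exp (1 - μ₀) + 1 with hlam'
  have hlam : 0 < lam := by positivity
  -- The bound lam T ≤ β₀/2 keeps the inverse temperature above β₀/2, which is the value used in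
  -- `velMass`.
  set T := min (β₀ / 2) 1 / lam with hT'
  have hT : 0 < T := div_pos (lt_min (half_pos hβ₀) one_pos) hlam
  have hlamT : lam * T = min (β₀ / 2) 1 := mul_div_cancel₀ _ hlam.ne'
  have hb : β₀ / 2 ≤ β₀ - lam * T := by
    rw [hlamT]
    linarith [min_le_left (β₀ / 2) 1]
  have hθ : 8 * velMass d (β₀ / 2) * Real.exp (lam * T - μ₀) ≤ lam := by
    have h1 : Real.exp (lam * T - μ₀) ≤ Real.exp (1 - μ₀) := by
      rw [hlamT]
      gcongr
      exact min_le_right _ _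
    have h2 : 8 * velMass d (β₀ / 2) * Real.exp (lam * T - μ₀) ≤
        8 * velMass d (β₀ / 2) * Real.exp (1 - μ₀) := by gcongr
    linarith
  have hβ : 0 < β₀ - lam * T := (half_pos hβ₀).trans_le hb
  refine ⟨lam, T, hlam, hT, fun t ht => hβ.trans_le (sub_mul_le hlam.le ht), ?_⟩
  intro N ε _ hε hNε F_N₀ hF_N₀ F₀ hF₀
  exact ⟨exists_unique_bbgky hε hNε hT hlam hβ hF_N₀,
    exists_unique_boltzmann hT.le hlam (half_pos hβ₀) hb hθ hF₀⟩
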